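/- Let $M$ be a compact Riemannian manifold (smooth, without boundary, not necessarily connected) of dimension $m$, with geodesic distance $d$ (equal to $\infty$ between points of different components) and Riemannian volume measure, and let $\nu, k\in\mathbb N$, $\sigma\in(0,1)$, $1\le p<\infty$ and $s=k+\sigma$. For a function $u\colon M\to\mathbb R^\nu$ let $D^j u$ denote its $j$-th weak covariant derivative for the Levi-Civita connection (with $D^0u=u$). For $k\ge 1$, the difference $D^ku(x)-D^ku(y)$ is understood after identifying tangent spaces: it stands for $D^ku(x)-D^ku(y)\circ(P_{x,y}\times\dots\times P_{x,y})$, where $P_{x,y}\colon T_xM\to T_yM$ $(x,y\in M)$ is any fixed family of linear maps, uniformly bounded, continuously differentiable in $(x,y)$ near the diagonal, and with $P_{x,x}=\mathrm{id}$ (for example, the parallel transport along the shortest geodesic from $x$ to $y$ when $d(x,y)$ is smaller than the injectivity radius, and any linear isometry otherwise). For $A\subseteq M\times M$ put $$ [v]_{A}^p=\iint_{A}\frac{|D^kv(x)-D^kv(y)|^p}{d(x,y)^{m+\sigma p}}\,dx\,dy . $$ The space $W^{s,p}(M,\mathbb R^\nu)$ consists of all $u\in L^p(M,\mathbb R^\nu)$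 whose weak derivatives $D^ju$, $j\le k$, exist and belong to $L^p$ and for which $[u]_{M\times M}<\infty$; it is normed by $\sum_{j=0}^k\|D^ju\|_{L^p}+[u]_{M\times M}$. Let $(u_n)_{n\in\mathbb N}$ be a sequence in $W^{s,p}(M,\mathbb R^\nu)$ and let $u\colon M\to\mathbb R^\nu$. The following are equivalent: (i) $u\in W^{s,p}(M,\mathbb R^\nu)$ and $u_n\to u$ in $W^{s,p}(M,\mathbb R^\nu)$; (ii) $u\in L^p(M,\mathbb R^\nu)$, $u_n\to u$ in $L^p(M,\mathbb R^\nu)$ and $$ \lim_{\rho\to0^+}\ \limsup_{n\to\infty}\ \iint_{\{(x,y)\in M\times M:\ d(x,y)<\rho\}}\frac{|D^ku_n(x)-D^ku_n(y)|^p}{d(x,y)^{m+\sigma p}}\,dx\,dy=0; $$ (iii) $u\in L^p(M,\mathbb R^\nu)$, $u_n\to u$ in $L^p(M,\mathbb R^\nu)$ and $$ \lim_{\rho\to0^+}\ \sup_{n\in\mathbb N}\ \iint_{\{(x,y)\in M\times M:\ d(x,y)<\rho\}}\frac{|D^ku_n(x)-D^ku_n(y)|^p}{d(x,y)^{m+\sigma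 p}}\,dx\,dy=0 . $$ -/

import Mathlib

open Bundle Manifold MeasureTheory Filter Topology
open scoped ENNReal ContDiff

noncomputable section

namespace FracSobolev

/-- `h` is the weak derivative of `f` in the direction `v` on the open set `Ω ⊆ ℝᵐ`. -/
def HasWeakDirDeriv {m ν : ℕ} (Ω : Set (EuclideanSpace ℝ (Fin m)))
    (f : EuclideanSpace ℝ (Fin m) → EuclideanSpace ℝ (Fin ν)) (v : EuclideanSpace ℝ (Fin m))
    (h : EuclideanSpace ℝ (Fin m) → EuclideanSpace ℝ (Fin ν)) : Prop :=
  LocallyIntegrableOn f Ω ∧ LocallyIntegrableOn h Ω ∧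
    ∀ ψ : EuclideanSpace ℝ (Fin m) → ℝ, ContDiff ℝ ∞ ψ → HasCompactSupport ψ → tsupport ψ ⊆ Ω →
      ∫ z, fderiv ℝ ψ z v • f z = -∫ z, ψ z • h z

section Manifold

variable {m : ℕ} {M : Type*} [EMetricSpace M] [ChartedSpace (EuclideanSpace ℝ (Fin m)) M]

/-- (Not necessarily continuous) covariant `k`-tensor fields on `M` with values in `ℝ^ν`. -/
abbrev TensorField (m : ℕ) (M : Type*) [EMetricSpace M]
    [ChartedSpace (EuclideanSpace ℝ (Fin m)) M] (ν k : ℕ) : Type _ :=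
  ∀ x : M, ContinuousMultilinearMap ℝ (fun _ : Fin k => TangentSpace (𝓡 m) x)
    (EuclideanSpace ℝ (Fin ν))

/-- An `ℝ^ν`-valued function as a tensor field of order `0`. -/
def zeroTensor {ν : ℕ} (u : M → EuclideanSpace ℝ (Fin ν)) : TensorField m M ν 0 :=
  fun x => ContinuousMultilinearMap.constOfIsEmpty ℝ (fun _ : Fin 0 => TangentSpace (𝓡 m) x) (u x)

/-- The differential at `z ∈ ℝᵐ` of the parametrization inverse to the chart at `x₀`; it maps the
standard basis to the coordinate vector fields. -/
def paramDeriv (x₀ : M) (z : EuclideanSpace ℝ (Fin m)) :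
    EuclideanSpace ℝ (Fin m) →L[ℝ] TangentSpace (𝓡 m) ((extChartAt (𝓡 m) x₀).symm z) :=
  mfderiv (𝓡 m) (𝓡 m) (extChartAt (𝓡 m) x₀).symm z

/-- The expression of a tensor field in the chart at `x₀`. -/
def TensorField.inChart {ν k : ℕ} (T : TensorField m M ν k) (x₀ : M)
    (z : EuclideanSpace ℝ (Fin m)) (v : Fin k → EuclideanSpace ℝ (Fin m)) :
    EuclideanSpace ℝ (Fin ν) :=
  T ((extChartAt (𝓡 m) x₀).symm z) (fun i => paramDeriv x₀ z (v i))

variable [RiemannianBundle (fun x : M => TangentSpace (𝓡 m) x)]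

/-- The coefficients `g_{ij}` of the metric in the chart at `x₀`. -/
def gram (x₀ : M) (z : EuclideanSpace ℝ (Fin m)) : Matrix (Fin m) (Fin m) ℝ :=
  Matrix.of fun i j =>
    inner ℝ (paramDeriv x₀ z (EuclideanSpace.single i 1))
      (paramDeriv x₀ z (EuclideanSpace.single j 1))

/-- The partial derivative `∂_l g_{ij}` in the chart at `x₀`. -/
def gramDeriv (x₀ : M) (z : EuclideanSpace ℝ (Fin m)) (l i j : Fin m) : ℝ :=
  fderiv ℝ (fun w => gram x₀ w i j) z (EuclideanSpace.single l 1)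

/-- The Christoffel symbols of the Levi-Civita connection in the chart at `x₀`:
`Γ^l_{ij} = ½ ∑_q g^{lq} (∂_i g_{jq} + ∂_j g_{iq} - ∂_q g_{ij})`. -/
def christoffel (x₀ : M) (z : EuclideanSpace ℝ (Fin m)) (l i j : Fin m) : ℝ :=
  (1 / 2 : ℝ) * ∑ q, (gram x₀ z)⁻¹ l q *
    (gramDeriv x₀ z i j q + gramDeriv x₀ z j i q - gramDeriv x₀ z q i j)

/-- The vector `Γ(v, w) = ∑ Γ^l_{ij} v^i w^j e_l`. -/
def christoffelVec (x₀ : M) (z v w : EuclideanSpace ℝ (Fin m)) : EuclideanSpace ℝ (Fin m) :=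
  WithLp.toLp 2 fun l => ∑ i, ∑ j, christoffel x₀ z l i j * v i * w j

/-- `S` is the weak covariant derivative `D T` of the tensor field `T`: in each chart,
`S(v₀, v₁, …, v_k) = ∂_{v₀} T(v₁, …, v_k) - ∑_r T(v₁, …, Γ(v₀, v_r), …, v_k)`
for constant vectors `v₀, …, v_k`, with a weak derivative on the right. -/
def IsWeakCovDeriv {ν k : ℕ} (T : TensorField m M ν k) (S : TensorField m M ν (k + 1)) : Prop :=
  ∀ (x₀ : M) (v₀ : EuclideanSpace ℝ (Fin m)) (v : Fin k → EuclideanSpace ℝ (Fin m)),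
    HasWeakDirDeriv (extChartAt (𝓡 m) x₀).target (fun z => T.inChart x₀ z v) v₀
      (fun z => S.inChart x₀ z (Fin.cons v₀ v) +
        ∑ r, T.inChart x₀ z (Function.update v r (christoffelVec x₀ z v₀ (v r))))

/-- `T` is a `k`-th order weak covariant derivative of the function `u`. -/
def IsIterWeakCovDeriv {ν : ℕ} (u : M → EuclideanSpace ℝ (Fin ν)) :
    (k : ℕ) → TensorField m M ν k → Prop
  | 0, T => T = zeroTensor u
  | k + 1, S => ∃ T : TensorField m M ν k, IsIterWeakCovDeriv u k T ∧ IsWeakCovDeriv T S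

open Classical in
/-- The weak derivative `Dᵏ u`, which is unique almost everywhere when it exists
(junk value `0` otherwise). -/
def weakDeriv {ν : ℕ} (k : ℕ) (u : M → EuclideanSpace ℝ (Fin ν)) : TensorField m M ν k :=
  if h : ∃ T, IsIterWeakCovDeriv u k T then h.choose else 0

/-- A way of comparing tangent vectors at nearby points of `M`: linear maps
`P x y : T_x M → T_y M`, bounded uniformly, depending on `(x, y)` in a continuously differentiable
way near the diagonal, with `P x x = id`. An example on a compact manifold is the parallel
transport along the shortest geodesic from `x` to `y`, which is defined and smooth when `d(x, y)`
is less than the injectivity radius (for the other pairs any linear isometry, say, will do). -/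
structure IsTransport [IsManifold (𝓡 m) ∞ M]
    (P : ∀ x y : M, TangentSpace (𝓡 m) x →L[ℝ] TangentSpace (𝓡 m) y) :
    Prop where
  diag : ∀ (x : M) (v : TangentSpace (𝓡 m) x), P x x v = v
  bounded : ∃ C : ℝ, ∀ (x y : M) (v : TangentSpace (𝓡 m) x), ‖P x y v‖ ≤ C * ‖v‖
  contMDiffAt : ∀ x₀ : M,
    ContMDiffAt ((𝓡 m).prod (𝓡 m))
      𝓘(ℝ, EuclideanSpace ℝ (Fin m) →L[ℝ] EuclideanSpace ℝ (Fin m)) 1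
      (fun q : M × M => ContinuousLinearMap.inCoordinates
        (EuclideanSpace ℝ (Fin m)) (TangentSpace (𝓡 m) (M := M))
        (EuclideanSpace ℝ (Fin m)) (TangentSpace (𝓡 m) (M := M)) x₀ q.1 x₀ q.2 (P q.1 q.2))
      (x₀, x₀)

section ExistsTransport

local notation "𝔼" => EuclideanSpace ℝ (Fin m)
local notation "TM" => (TangentSpace (𝓡 m) : M → Type _)

variable [IsManifold (𝓡 m) ∞ M]
  [IsContMDiffRiemannianBundle (𝓡 m) ∞ (EuclideanSpace ℝ (Fin m))
    (fun x : M => TangentSpace (𝓡 m) x)]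

theorem isContinuousRiemannianBundle : IsContinuousRiemannianBundle 𝔼 TM := by
  obtain ⟨g, hg, h⟩ := ‹IsContMDiffRiemannianBundle (𝓡 m) ∞ 𝔼
    (fun x : M => TangentSpace (𝓡 m) x)›.exists_contMDiff
  exact ⟨g, hg.continuous, h⟩

theorem exists_bound_symmL (c y₀ : M) (h : y₀ ∈ (trivializationAt 𝔼 TM c).baseSet) :
    ∃ C : ℝ, 0 ≤ C ∧ ∀ᶠ y in 𝓝 y₀, ∀ v, ‖(trivializationAt 𝔼 TM c).symmL ℝ y v‖ ≤ C * ‖v‖ := by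
  have := isContinuousRiemannianBundle (m := m) (M := M)
  obtain ⟨C, hC, h1⟩ := eventually_norm_symmL_trivializationAt_lt 𝔼 TM y₀
  have h2 := (contMDiffAt_coordChangeL (n := 1) (IB := 𝓡 m) (e := trivializationAt 𝔼 TM c)
    (e' := trivializationAt 𝔼 TM y₀) h (FiberBundle.mem_baseSet_trivializationAt' y₀)).continuousAt
  obtain ⟨D, hD0, hD⟩ : ∃ D : ℝ, 0 ≤ D ∧ ∀ᶠ y in 𝓝 y₀, ‖((trivializationAt 𝔼 TM c).coordChangeL ℝ
      (trivializationAt 𝔼 TM y₀) y : 𝔼 →L[ℝ] 𝔼)‖ ≤ D :=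
    ⟨_, by positivity, (h2.norm.eventually_lt_const (lt_add_one _)).mono fun _ h => h.le⟩
  refine ⟨C * D, by positivity, ?_⟩
  filter_upwards [h1, hD, (trivializationAt 𝔼 TM c).open_baseSet.mem_nhds h,
    (trivializationAt 𝔼 TM y₀).open_baseSet.mem_nhds
      (FiberBundle.mem_baseSet_trivializationAt' y₀)] with y a b hy hy'
  have : (trivializationAt 𝔼 TM c).symmL ℝ y = ((trivializationAt 𝔼 TM y₀).symmL ℝ y) ∘L
     ((trivializationAt 𝔼 TM c).coordChangeL ℝ
      (trivializationAt 𝔼 TM y₀) y : 𝔼 →L[ℝ] 𝔼) := by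
    ext v
    simp only [ContinuousLinearMap.comp_apply, ContinuousLinearEquiv.coe_coe,
      Trivialization.coordChangeL_apply _ _ (And.intro hy hy'), Trivialization.symmL_apply _ hy,
      Trivialization.symmL_apply _ hy']
    exact ((trivializationAt 𝔼 TM y₀).symm_proj_apply ⟨y, _⟩ hy').symm
  intro v
  rw [this, ContinuousLinearMap.comp_apply, mul_assoc]
  refine (ContinuousLinearMap.le_opNorm _ _).trans ?_
  exact mul_le_mul a.le ((ContinuousLinearMap.le_opNorm _ _).trans
    (mul_le_mul_of_nonneg_right b (norm_nonneg _))) (norm_nonneg _) hC.le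

theorem exists_bound_continuousLinearMapAt (c y₀ : M) (h : y₀ ∈ (trivializationAt 𝔼 TM c).baseSet) :
    ∃ C : ℝ, 0 ≤ C ∧ ∀ᶠ y in 𝓝 y₀, ∀ v : TangentSpace (𝓡 m) y,
      ‖(trivializationAt 𝔼 TM c).continuousLinearMapAt ℝ y v‖ ≤ C * ‖v‖ := by
  have := isContinuousRiemannianBundle (m := m) (M := M)
  obtain ⟨C, hC, h1⟩ := eventually_norm_trivializationAt_lt 𝔼 TM y₀
  have h2 := (contMDiffAt_coordChangeL (n := 1) (IB := 𝓡 m) (e := trivializationAt 𝔼 TM y₀)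
    (e' := trivializationAt 𝔼 TM c) (FiberBundle.mem_baseSet_trivializationAt' y₀) h).continuousAt
  obtain ⟨D, hD0, hD⟩ : ∃ D : ℝ, 0 ≤ D ∧ ∀ᶠ y in 𝓝 y₀, ‖((trivializationAt 𝔼 TM y₀).coordChangeL ℝ
      (trivializationAt 𝔼 TM c) y : 𝔼 →L[ℝ] 𝔼)‖ ≤ D :=
    ⟨_, by positivity, (h2.norm.eventually_lt_const (lt_add_one _)).mono fun _ h => h.le⟩
  refine ⟨D * C, by positivity, ?_⟩
  filter_upwards [h1, hD, (trivializationAt 𝔼 TM c).open_baseSet.mem_nhds h,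
    (trivializationAt 𝔼 TM y₀).open_baseSet.mem_nhds
      (FiberBundle.mem_baseSet_trivializationAt' y₀)] with y a b hy hy'
  have : (trivializationAt 𝔼 TM c).continuousLinearMapAt ℝ y =
     ((trivializationAt 𝔼 TM y₀).coordChangeL ℝ
      (trivializationAt 𝔼 TM c) y : 𝔼 →L[ℝ] 𝔼) ∘L
      ((trivializationAt 𝔼 TM y₀).continuousLinearMapAt ℝ y) := by
    ext1 v
    simp only [ContinuousLinearMap.comp_apply, ContinuousLinearEquiv.coe_coe,
      Trivialization.coordChangeL_apply _ _ (And.intro hy' hy),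
      Trivialization.continuousLinearMapAt_apply, Trivialization.linearMapAt_apply, hy, hy',
      if_true]
    rw [(trivializationAt 𝔼 TM y₀).symm_proj_apply ⟨y, v⟩ hy']
  intro v
  rw [this, ContinuousLinearMap.comp_apply, mul_assoc]
  refine (ContinuousLinearMap.le_opNorm _ _).trans ?_
  exact mul_le_mul b ((ContinuousLinearMap.le_opNorm _ _).trans
    (mul_le_mul_of_nonneg_right a.le (norm_nonneg _))) (norm_nonneg _) hD0

/-- Transports exist on every compact Riemannian manifold. -/
theorem exists_isTransport [CompactSpace M] :
    ∃ P : ∀ x y : M, TangentSpace (𝓡 m) x →L[ℝ] TangentSpace (𝓡 m) y, IsTransport P := by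
  obtain ⟨ι, f, -⟩ := SmoothBumpCovering.exists_isSubordinate (𝓡 m) (M := M) isClosed_univ
    (U := fun _ => Set.univ) (fun _ _ => univ_mem)
  let _ : Fintype ι := f.fintype
  set S : M → ℝ := fun x => ∑ i, f i x * f i x with hS
  have hS0 : ∀ x, S x ≠ 0 := fun x => by
    refine ne_of_gt (Finset.sum_pos' (fun i _ => mul_self_nonneg _)
      ⟨f.ind x trivial, Finset.mem_univ _, ?_⟩)
    rw [f.apply_ind x trivial]; norm_num
  have hf : ∀ i, ContMDiff (𝓡 m) 𝓘(ℝ) 1 (f i) := fun i => (f i).contMDiff.of_le (by norm_cast)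
  have hSs : ContMDiff (𝓡 m) 𝓘(ℝ) 1 S := contMDiff_finsetSum fun i _ => (hf i).mul (hf i)
  set e := fun i => trivializationAt 𝔼 TM (f.c i) with he
  set B : ι → ∀ x y : M, TangentSpace (𝓡 m) x →L[ℝ] TangentSpace (𝓡 m) y := fun i x y =>
    ((S x)⁻¹ * f i x * f i y) • ((e i).symmL ℝ y ∘L (e i).continuousLinearMapAt ℝ x) with hB
  have hsupp : ∀ i, ∀ x ∈ tsupport (f i), x ∈ (e i).baseSet := fun i x hx => by
    simpa [he] using (f i).tsupport_subset_chartAt_source hx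
  have hz : ∀ i x₀, x₀ ∉ tsupport (f i) → ∀ᶠ x in 𝓝 x₀, f i x = 0 := fun i x₀ h =>
    notMem_tsupport_iff_eventuallyEq.1 h
  have hbd : ∀ i (q : M × M), ∃ C : ℝ, ∀ᶠ r in 𝓝 q, ∀ v : TangentSpace (𝓡 m) r.1, ‖B i r.1 r.2 v‖ ≤ C * ‖v‖ := by
    rintro i ⟨x₀, y₀⟩
    rw [nhds_prod_eq]
    by_cases hx : x₀ ∈ tsupport (f i)
    swap
    · refine ⟨0, ((hz i x₀ hx).prod_inl _).mono fun r hr v => ?_⟩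
      have hs : B i r.1 r.2 = 0 := by simp [hB, hr]
      rw [hs, zero_mul, zero_apply, norm_zero]
    by_cases hy : y₀ ∈ tsupport (f i)
    swap
    · refine ⟨0, ((hz i y₀ hy).prod_inr _).mono fun r hr v => ?_⟩
      have hs : B i r.1 r.2 = 0 := by simp [hB, hr]
      rw [hs, zero_mul, zero_apply, norm_zero]
    obtain ⟨C₁, hC₁, h₁⟩ := exists_bound_symmL (f.c i) y₀ (hsupp i _ hy)
    obtain ⟨C₂, hC₂, h₂⟩ := exists_bound_continuousLinearMapAt (f.c i) x₀ (hsupp i _ hx)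
    have h₃ : ∀ᶠ x in 𝓝 x₀, ‖(S x)⁻¹‖ ≤ ‖(S x₀)⁻¹‖ + 1 :=
      ((hSs.continuous.continuousAt.inv₀ (hS0 x₀)).norm.eventually_lt_const
        (lt_add_one _)).mono fun _ h => h.le
    have hf1 : ∀ x, ‖f i x‖ ≤ 1 := fun x => by
      rw [Real.norm_of_nonneg (f i).nonneg]; exact (f i).le_one
    refine ⟨(‖(S x₀)⁻¹‖ + 1) * 1 * 1 * (C₁ * C₂), ?_⟩
    filter_upwards [h₁.prod_inr _, h₂.prod_inl _, h₃.prod_inl _] with r a b c v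
    have hd : ‖(e i).symmL ℝ r.2 ((e i).continuousLinearMapAt ℝ r.1 v)‖ ≤ C₁ * C₂ * ‖v‖ := by
      rw [mul_assoc]
      exact (a _).trans (mul_le_mul_of_nonneg_left (b v) hC₁)
    have hk : ‖(S r.1)⁻¹ * f i r.1 * f i r.2‖ ≤ (‖(S x₀)⁻¹‖ + 1) * 1 * 1 := by
      rw [norm_mul, norm_mul]
      gcongr
      · exact hf1 _
      · exact hf1 _
    have hs : B i r.1 r.2 v = ((S r.1)⁻¹ * f i r.1 * f i r.2) •
      (e i).symmL ℝ r.2 ((e i).continuousLinearMapAt ℝ r.1 v) := rfl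
    rw [hs, mul_assoc (_ * 1 * 1)]
    refine (norm_smul_le _ _).trans ?_
    exact mul_le_mul hk hd (norm_nonneg _) (by positivity)
  refine ⟨fun x y => ∑ i, B i x y, ?_, ?_, ?_⟩
  · intro x v
    have : ∀ i, B i x x v = ((S x)⁻¹ * (f i x * f i x)) • v := fun i => by
      by_cases hx : x ∈ tsupport (f i)
      · have := (e i).symmL_continuousLinearMapAt (R := ℝ) (hsupp i x hx) v
        simp only [hB, smul_apply, ContinuousLinearMap.comp_apply, this,
          mul_assoc]
      · simp [hB, (hz i x hx).self_of_nhds]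
    rw [sum_apply, Finset.sum_congr rfl fun i _ => this i, ← Finset.sum_smul,
      ← Finset.mul_sum, inv_mul_cancel₀ (hS0 x), one_smul]
  · have : ∀ i, ∃ C : ℝ, ∀ (q : M × M) (v : TangentSpace (𝓡 m) q.1), ‖B i q.1 q.2 v‖ ≤ C * ‖v‖ := fun i => by
      choose C hC using hbd i
      obtain ⟨t, -, ht⟩ := isCompact_univ.elim_nhds_subcover _ fun q (_ : q ∈ Set.univ) => hC q
      refine ⟨∑ q ∈ t, |C q|, fun q v => ?_⟩
      obtain ⟨q', hq', h⟩ := Set.mem_iUnion₂.1 (ht (Set.mem_univ q))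
      refine (show ‖B i q.1 q.2 v‖ ≤ C q' * ‖v‖ from h v).trans ?_
      exact mul_le_mul_of_nonneg_right ((le_abs_self _).trans
        (Finset.single_le_sum (f := fun q => |C q|) (fun _ _ => abs_nonneg _) hq')) (norm_nonneg _)
    choose C hC using this
    refine ⟨∑ i, C i, fun x y v => ?_⟩
    rw [sum_apply, Finset.sum_mul]
    exact (norm_sum_le _ _).trans (Finset.sum_le_sum fun i _ => hC i (x, y) v)
  · intro x₀
    have hterm : ∀ i, ContMDiffAt ((𝓡 m).prod (𝓡 m)) 𝓘(ℝ, 𝔼 →L[ℝ] 𝔼) 1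
      (fun q : M × M => ContinuousLinearMap.inCoordinates 𝔼 TM 𝔼 TM x₀ q.1 x₀ q.2 (B i q.1 q.2))
      (x₀, x₀) := fun i => by
      by_cases hx : x₀ ∈ tsupport (f i)
      · have hb := hsupp i _ hx
        have hb' := FiberBundle.mem_baseSet_trivializationAt' (F := 𝔼) (E := TM) x₀
        have h1 : ContMDiffAt ((𝓡 m).prod (𝓡 m)) 𝓘(ℝ, 𝔼 →L[ℝ] 𝔼) 1 (fun q : M × M =>
            ((e i).coordChangeL ℝ (trivializationAt 𝔼 TM x₀) q.2 : 𝔼 →L[ℝ] 𝔼)) (x₀, x₀) :=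
          (contMDiff_snd.contMDiffAt (n := 1)).coordChangeL hb hb'
        have h2 : ContMDiffAt ((𝓡 m).prod (𝓡 m)) 𝓘(ℝ, 𝔼 →L[ℝ] 𝔼) 1 (fun q : M × M =>
            ((trivializationAt 𝔼 TM x₀).coordChangeL ℝ (e i) q.1 : 𝔼 →L[ℝ] 𝔼)) (x₀, x₀) :=
          (contMDiff_fst.contMDiffAt (n := 1)).coordChangeL hb' hb
        have hc : ContMDiffAt ((𝓡 m).prod (𝓡 m)) 𝓘(ℝ) 1 (fun q : M × M =>
            (S q.1)⁻¹ * f i q.1 * f i q.2) (x₀, x₀) := by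
          have hi : ContMDiff (𝓡 m) 𝓘(ℝ) 1 fun x => (S x)⁻¹ := hSs.inv₀ hS0
          exact (((hi.comp contMDiff_fst).mul ((hf i).comp contMDiff_fst)).mul
            ((hf i).comp contMDiff_snd)).contMDiffAt
        refine (hc.smul (h1.clm_comp h2)).congr_of_eventuallyEq ?_
        rw [nhds_prod_eq]
        have hm := ((e i).open_baseSet.inter
          (trivializationAt 𝔼 TM x₀).open_baseSet).mem_nhds (show x₀ ∈ _ from ⟨hb, hb'⟩)
        filter_upwards [prod_mem_prod hm hm] with q hq
        obtain ⟨⟨hq1, hq2⟩, hq3, hq4⟩ := hq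
        ext1 v
        simp only [ContinuousLinearMap.inCoordinates, hB, ContinuousLinearMap.comp_apply,
          smul_apply, map_smul, Pi.smul_apply',
          ContinuousLinearEquiv.coe_coe]
        rw [Trivialization.coordChangeL_apply _ _ ⟨hq2, hq1⟩,
          Trivialization.coordChangeL_apply _ _ ⟨hq3, hq4⟩]
        simp only [Trivialization.continuousLinearMapAt_apply, Trivialization.linearMapAt_apply,
          Trivialization.symmL_apply _ hq2, Trivialization.symmL_apply _ hq3, hq1, hq4, if_true]
      · refine ContMDiffAt.congr_of_eventuallyEq (contMDiffAt_const (c := (0 : 𝔼 →L[ℝ] 𝔼))) ?_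
        rw [nhds_prod_eq]
        refine ((hz i x₀ hx).prod_inl _).mono fun r hr => ?_
        simp [hB, hr, ContinuousLinearMap.inCoordinates]
    refine (ContMDiffAt.sum (t := Finset.univ) fun i _ => hterm i).congr_of_eventuallyEq
      (Eventually.of_forall fun q => ?_)
    simp [ContinuousLinearMap.inCoordinates, ContinuousLinearMap.finsetSum_comp,
      ContinuousLinearMap.comp_finsetSum]

end ExistsTransport

variable [MeasurableSpace M] [BorelSpace M]

/-- The Riemannian volume measure of the `m`-dimensional Riemannian manifold `M`: its
`m`-dimensional Hausdorff measure for the geodesic distance, normalized so as to be the Lebesgue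
measure on `ℝᵐ`. -/
def riemVol (m : ℕ) (M : Type*) [EMetricSpace M] [MeasurableSpace M] [BorelSpace M] : Measure M :=
  μHE[m]

/-- `(∫_M |T|^p)^{1/p}`. -/
def lpNorm {ν k : ℕ} (p : ℝ) (T : TensorField m M ν k) : ℝ≥0∞ :=
  (∫⁻ x, ‖T x‖ₑ ^ p ∂(riemVol m M)) ^ (1 / p)

/-- The Gagliardo energy `∬_A |T(x) - T(y)|^p / d(x, y)^{m + σ p} dx dy` over a set `A` of pairs,
where `T(y)` is brought to the point `x` through `P x y`. -/
def gagliardo {ν k : ℕ} (P : ∀ x y : M, TangentSpace (𝓡 m) x →L[ℝ] TangentSpace (𝓡 m) y)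
    (σ p : ℝ) (A : Set (M × M)) (T : TensorField m M ν k) : ℝ≥0∞ :=
  ∫⁻ q in A, ‖T q.1 - (T q.2).compContinuousLinearMap (fun _ => P q.1 q.2)‖ₑ ^ p /
    edist q.1 q.2 ^ ((m : ℝ) + σ * p) ∂((riemVol m M).prod (riemVol m M))

/-- Membership in `W^{k+σ,p}(M, ℝ^ν)`. -/
structure MemW {ν : ℕ} (P : ∀ x y : M, TangentSpace (𝓡 m) x →L[ℝ] TangentSpace (𝓡 m) y)
    (k : ℕ) (σ p : ℝ) (u : M → EuclideanSpace ℝ (Fin ν)) : Prop where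
  memLp : MemLp u (ENNReal.ofReal p) (riemVol m M)
  weaklyDiff : ∃ T : TensorField m M ν k, IsIterWeakCovDeriv u k T
  lpNorm_lt_top : ∀ j ≤ k, lpNorm p (weakDeriv (m := m) j u) < ⊤
  gagliardo_lt_top : gagliardo P σ p Set.univ (weakDeriv k u) < ⊤

/-- The norm of `W^{k+σ,p}(M, ℝ^ν)`. -/
def normW {ν : ℕ} (P : ∀ x y : M, TangentSpace (𝓡 m) x →L[ℝ] TangentSpace (𝓡 m) y)
    (k : ℕ) (σ p : ℝ) (u : M → EuclideanSpace ℝ (Fin ν)) : ℝ≥0∞ :=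
  ∑ j ∈ Finset.range (k + 1), lpNorm p (weakDeriv (m := m) j u) +
    gagliardo P σ p Set.univ (weakDeriv k u) ^ (1 / p)

/-- `u_n → u` in `W^{k+σ,p}(M, ℝ^ν)`. -/
def TendstoW {ν : ℕ} (P : ∀ x y : M, TangentSpace (𝓡 m) x →L[ℝ] TangentSpace (𝓡 m) y)
    (k : ℕ) (σ p : ℝ) (u : ℕ → M → EuclideanSpace ℝ (Fin ν))
    (u' : M → EuclideanSpace ℝ (Fin ν)) : Prop :=
  MemW P k σ p u' ∧ Tendsto (fun n => normW P k σ p (u n - u')) atTop (𝓝 0)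

/-- `u_n → u` in `L^p(M, ℝ^ν)`, where `M` has dimension `m`. -/
def TendstoLp (m : ℕ) {M : Type*} [EMetricSpace M] [MeasurableSpace M] [BorelSpace M] {ν : ℕ}
    (p : ℝ) (u : ℕ → M → EuclideanSpace ℝ (Fin ν)) (u' : M → EuclideanSpace ℝ (Fin ν)) : Prop :=
  MemLp u' (ENNReal.ofReal p) (riemVol m M) ∧
    Tendsto (fun n => eLpNorm (u n - u') (ENNReal.ofReal p) (riemVol m M)) atTop (𝓝 0)

end Manifold

end FracSobolev

end

noncomputable section

set_option linter.unusedSectionVars false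

namespace FracSobolev

open scoped NNReal
open Set Metric

/-! ### Charts: smooth metric coefficients, Christoffel symbols, bi-Lipschitz balls. -/

section Geometry

variable {m : ℕ} {M : Type*} [EMetricSpace M] [ChartedSpace (EuclideanSpace ℝ (Fin m)) M]

local notation "𝔼" => EuclideanSpace ℝ (Fin m)
local notation "TM" => (TangentSpace (𝓡 m) : M → Type _)

/-! The deep implication is (ii) ⇒ (i). It rests on the coercivity estimate
`IsTransport.exists_energy_le`: for every ρ > 0 and every j ≤ k, ∫|Dʲv|ᵖ ≤ C₀ E_ρ(v) + A_ρ ∫|v|ᵖ,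
where E_ρ(v) is the Gagliardo energy of Dᵏv over d < ρ and C₀ does not depend on ρ. Applied to v =
u_n - u_l, with ρ chosen first to make E_ρ small and n, l chosen afterwards, it shows that all
derivatives up to order k are Cauchy in Lᵖ.

The estimate is proved in small chart balls where the chart is bi-Lipschitz. A component f of S =
Dʲ⁺¹v is written as the mean of f(z) - f(w) against a mollifier of width δ, plus the mollification
of f. In the latter the derivative is moved onto the mollifier, so it is bounded by T = Dʲv with a
constant depending on δ (`exists_mollify_le`). The mean oscillation is bounded in two ways. If S has
a weak derivative Q, increments along segments are O(δ) in Lᵖ in terms of Q and S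
(`IsGoodBall.oscillation_le`); this gives interpolation between three consecutive orders. At the top
order, the mollifier is at most B δ⁻ᵐ, hence at most a constant times d^(-(m+σp)) on its support, so
the oscillation is bounded by the Gagliardo energy near the diagonal
(`IsGoodBall.oscillation_le_gagliardo`), up to a small multiple of the norm of S because a transport
is only close to the identity in coordinates. Chaining these bounds and absorbing small multiples of
finite quantities gives the estimate.

The Lᵖ limits exist by completeness (`exists_tendsto_energy`) and are again weak derivatives
(`IsWeakCovDeriv.of_tendsto`). The energy of the difference near the diagonal is controlled by
Fatou's lemma along an almost everywhere convergent subsequence. Far from the diagonal the kernel is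
bounded, so Lᵖ convergence suffices. This is `IsTransport.exists_limit`.

For (i) ⇒ (iii), the fields with large index are compared with the limit, and each of the finitely
many others has small energy near the diagonal because a finite measure is continuous from above
(`IsTransport.tendsto_iSup_gagliardo`). The step (iii) ⇒ (ii) only uses limsup ≤ sup. -/

theorem symm_mem_source {c : M} {z : 𝔼} (hz : z ∈ (extChartAt (𝓡 m) c).target) :
    (extChartAt (𝓡 m) c).symm z ∈ (chartAt 𝔼 c).source := by
  rw [← extChartAt_source (𝓡 m)]
  exact (extChartAt (𝓡 m) c).map_target hz

variable [IsManifold (𝓡 m) ∞ M]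

/-- Identifies the coordinate frame with the inverse trivialization of the tangent bundle, so that
smoothness and local norm bounds of the Riemannian bundle apply to it. -/
theorem paramDeriv_eq_symmL {c : M} {z : 𝔼} (hz : z ∈ (extChartAt (𝓡 m) c).target) :
    paramDeriv c z = (trivializationAt 𝔼 TM c).symmL ℝ ((extChartAt (𝓡 m) c).symm z) := by
  have h := TangentBundle.symmL_trivializationAt (𝕜 := ℝ) (I := 𝓡 m) (symm_mem_source hz)
  have hz' : extChartAt (𝓡 m) c ((extChartAt (𝓡 m) c).symm z) = z :=
    (extChartAt (𝓡 m) c).right_inv hz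
  rw [hz', ModelWithCorners.range_eq_univ, mfderivWithin_univ] at h
  exact h.symm

theorem continuousLinearMapAt_paramDeriv {c : M} {z : 𝔼}
    (hz : z ∈ (extChartAt (𝓡 m) c).target) (v : 𝔼) :
    (trivializationAt 𝔼 TM c).continuousLinearMapAt ℝ ((extChartAt (𝓡 m) c).symm z)
      (paramDeriv c z v) = v := by
  rw [paramDeriv_eq_symmL hz]
  exact (trivializationAt 𝔼 TM c).continuousLinearMapAt_symmL
    (by simpa using symm_mem_source hz) v

theorem paramDeriv_continuousLinearMapAt {c : M} {z : 𝔼}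
    (hz : z ∈ (extChartAt (𝓡 m) c).target)
    (v : TangentSpace (𝓡 m) ((extChartAt (𝓡 m) c).symm z)) :
    paramDeriv c z ((trivializationAt 𝔼 TM c).continuousLinearMapAt ℝ
      ((extChartAt (𝓡 m) c).symm z) v) = v := by
  rw [paramDeriv_eq_symmL hz]
  exact (trivializationAt 𝔼 TM c).symmL_continuousLinearMapAt
    (by simpa using symm_mem_source hz) v

variable [RiemannianBundle (fun x : M => TangentSpace (𝓡 m) x)]
  [IsContMDiffRiemannianBundle (𝓡 m) ∞ (EuclideanSpace ℝ (Fin m))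
    (fun x : M => TangentSpace (𝓡 m) x)]

theorem contDiffOn_inner_paramDeriv (c : M) (v w : 𝔼) :
    ContDiffOn ℝ ∞ (fun z => inner ℝ (paramDeriv c z v) (paramDeriv c z w))
      (extChartAt (𝓡 m) c).target := by
  rw [← contMDiffOn_iff_contDiffOn]
  have hs : ∀ v : 𝔼, ContMDiffOn (𝓡 m) ((𝓡 m).prod 𝓘(ℝ, 𝔼)) ∞
      (fun x => (⟨x, (trivializationAt 𝔼 TM c).symmL ℝ x v⟩ : TotalSpace 𝔼 TM))
      (chartAt 𝔼 c).source := fun v => by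
    have hb : (trivializationAt 𝔼 TM c).baseSet = (chartAt 𝔼 c).source := by simp
    rw [← hb, (trivializationAt 𝔼 TM c).contMDiffOn_section_baseSet_iff]
    refine (contMDiffOn_const (c := v)).congr fun x hx => ?_
    rw [Trivialization.symmL_apply _ hx, Trivialization.apply_mk_symm _ hx]
  have h := (hs v).inner_bundle (hs w)
  have h' := h.comp (contMDiffOn_extChartAt_symm (I := 𝓡 m) (n := ∞) c)
    (fun z hz => symm_mem_source hz)
  refine h'.congr fun z hz => ?_
  simp only [paramDeriv_eq_symmL hz]
  rfl

theorem contDiffOn_gram (c : M) (i j : Fin m) :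
    ContDiffOn ℝ ∞ (fun z => gram c z i j) (extChartAt (𝓡 m) c).target :=
  contDiffOn_inner_paramDeriv c _ _

theorem isOpen_target (c : M) : IsOpen (extChartAt (𝓡 m) c).target :=
  isOpen_extChartAt_target c

theorem continuousOn_gramDeriv (c : M) (l i j : Fin m) :
    ContinuousOn (fun z => gramDeriv c z l i j) (extChartAt (𝓡 m) c).target :=
  ((contDiffOn_gram c i j).continuousOn_fderiv_of_isOpen (isOpen_target c) (by simp)).clm_apply
    continuousOn_const

/-- A kernel vector of the Gram matrix would be a coordinate vector whose image under `paramDeriv`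
has length zero, which contradicts injectivity of `paramDeriv`. -/
theorem det_gram_ne_zero {c : M} {z : 𝔼} (hz : z ∈ (extChartAt (𝓡 m) c).target) :
    (gram c z).det ≠ 0 := by
  intro h
  obtain ⟨a, ha, h0⟩ := Matrix.exists_mulVec_eq_zero_iff.2 h
  set v : 𝔼 := WithLp.toLp 2 a with hv
  have hsum : paramDeriv c z v = ∑ j, a j • paramDeriv c z (EuclideanSpace.single j 1) := by
    have : v = ∑ j, a j • EuclideanSpace.single j (1 : ℝ) := by
      ext i
      simp [hv, Pi.single_apply]
    conv_lhs => rw [this]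
    rw [map_sum]
    exact Finset.sum_congr rfl fun j _ => map_smul _ _ _
  have hin : inner ℝ (paramDeriv c z v) (paramDeriv c z v) = (0 : ℝ) := by
    conv_lhs => rw [hsum]
    rw [sum_inner]
    refine Finset.sum_eq_zero fun i _ => ?_
    have h2 := congrFun h0 i
    simp only [Matrix.mulVec, dotProduct, Pi.zero_apply, gram, Matrix.of_apply] at h2
    rw [real_inner_smul_left, inner_sum]
    simp only [real_inner_smul_right]
    rw [Finset.sum_congr rfl fun j _ => mul_comm (a j) _, h2, mul_zero]
  have h1 : paramDeriv c z v = 0 := inner_self_eq_zero.1 hin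
  have h2 := continuousLinearMapAt_paramDeriv hz v
  rw [h1, map_zero] at h2
  exact ha (by simpa [hv] using congrArg WithLp.ofLp h2.symm)

theorem continuousOn_christoffel (c : M) (l i j : Fin m) :
    ContinuousOn (fun z => christoffel c z l i j) (extChartAt (𝓡 m) c).target := by
  have hg : ContinuousOn (fun z => gram c z) (extChartAt (𝓡 m) c).target := by
    exact continuousOn_pi.2 fun i => continuousOn_pi.2 fun j =>
      (contDiffOn_gram c i j).continuousOn
  have hinv : ContinuousOn (fun z => (gram c z)⁻¹) (extChartAt (𝓡 m) c).target := by
    simp only [Matrix.inv_def, Ring.inverse_eq_inv']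
    refine ContinuousOn.smul (ContinuousOn.inv₀ ?_ fun z hz => det_gram_ne_zero hz) ?_
    · exact Continuous.comp_continuousOn (continuous_id.matrix_det) hg
    · exact (Continuous.matrix_adjugate (continuous_id (X := Matrix (Fin m) (Fin m) ℝ))).comp_continuousOn
        hg
  have hinv' : ∀ l q, ContinuousOn (fun z => (gram c z)⁻¹ l q) (extChartAt (𝓡 m) c).target :=
    fun l q => (continuousOn_pi.1 ((continuousOn_pi.1 hinv) l)) q
  unfold christoffel
  refine continuousOn_const.mul (continuousOn_finsetSum _ fun q _ => (hinv' l q).mul ?_)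
  exact ((continuousOn_gramDeriv c _ _ _).add (continuousOn_gramDeriv c _ _ _)).sub
    (continuousOn_gramDeriv c _ _ _)

theorem continuousOn_christoffelVec (c : M) (v w : 𝔼) :
    ContinuousOn (fun z => christoffelVec c z v w) (extChartAt (𝓡 m) c).target := by
  unfold christoffelVec
  refine (PiLp.continuous_toLp 2 _).comp_continuousOn (continuousOn_pi.2 fun l => ?_)
  exact continuousOn_finsetSum _ fun i _ => continuousOn_finsetSum _ fun j _ =>
    ((continuousOn_christoffel c l i j).mul continuousOn_const).mul continuousOn_const

theorem exists_bound_christoffelVec (c : M) {z₁ : 𝔼} (hz : z₁ ∈ (extChartAt (𝓡 m) c).target) :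
    ∃ C : ℝ, 0 ≤ C ∧ ∀ᶠ z in 𝓝 z₁, ∀ v w : 𝔼, ‖christoffelVec c z v w‖ ≤ C * ‖v‖ * ‖w‖ := by
  have h : ∀ l i j : Fin m, ∀ᶠ z in 𝓝 z₁, ‖christoffel c z l i j‖ ≤ ‖christoffel c z₁ l i j‖ + 1 :=
    fun l i j => (((continuousOn_christoffel c l i j).continuousAt
      ((isOpen_target c).mem_nhds hz)).norm.eventually_lt_const (lt_add_one _)).mono fun _ h => h.le
  refine ⟨∑ l, ∑ i, ∑ j, (‖christoffel c z₁ l i j‖ + 1), by positivity, ?_⟩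
  filter_upwards [eventually_all.2 fun l => eventually_all.2 fun i => eventually_all.2 (h l i)]
    with z hz v w
  have hsum : christoffelVec c z v w = ∑ l, (∑ i, ∑ j, christoffel c z l i j * v i * w j) •
      EuclideanSpace.single l (1 : ℝ) := by
    ext q
    simp [christoffelVec, Pi.single_apply]
  rw [hsum, Finset.sum_mul, Finset.sum_mul]
  refine (norm_sum_le _ _).trans (Finset.sum_le_sum fun l _ => ?_)
  rw [norm_smul, PiLp.norm_single, norm_one, mul_one, Finset.sum_mul, Finset.sum_mul]
  refine (norm_sum_le _ _).trans (Finset.sum_le_sum fun i _ => ?_)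
  rw [Finset.sum_mul, Finset.sum_mul]
  refine (norm_sum_le _ _).trans (Finset.sum_le_sum fun j _ => ?_)
  rw [norm_mul, norm_mul]
  gcongr
  · exact hz l i j
  · exact PiLp.norm_apply_le v i
  · exact PiLp.norm_apply_le w j

variable [IsRiemannianManifold (𝓡 m) M]

/-- A closed ball in the target of the chart at `c` on which the chart is bi-Lipschitz, and the
coordinate frame and the Christoffel symbols are controlled. -/
structure IsGoodBall (c : M) (z₁ : 𝔼) (R : ℝ) (C : ℝ≥0) : Prop where
  pos : 0 < R
  one_le : 1 ≤ C
  subset : closedBall z₁ R ⊆ (extChartAt (𝓡 m) c).target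
  edist_le : ∀ z ∈ closedBall z₁ R, ∀ w ∈ closedBall z₁ R,
    edist ((extChartAt (𝓡 m) c).symm z) ((extChartAt (𝓡 m) c).symm w) ≤ C * edist z w
  le_edist : ∀ z ∈ closedBall z₁ R, ∀ w ∈ closedBall z₁ R,
    edist z w ≤ C * edist ((extChartAt (𝓡 m) c).symm z) ((extChartAt (𝓡 m) c).symm w)
  norm_le : ∀ z ∈ closedBall z₁ R, ∀ v : 𝔼, ‖paramDeriv c z v‖ ≤ C * ‖v‖
  le_norm : ∀ z ∈ closedBall z₁ R, ∀ v : 𝔼, ‖v‖ ≤ C * ‖paramDeriv c z v‖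
  christoffel_le : ∀ z ∈ closedBall z₁ R, ∀ v w : 𝔼, ‖christoffelVec c z v w‖ ≤ C * ‖v‖ * ‖w‖

/-- The image of the straight segment is an admissible path. Convexity of the ball keeps the segment
where the differential is bounded by C, so its length is at most C times the Euclidean distance. -/
theorem edist_symm_le {c : M} {z₁ : 𝔼} {R : ℝ} {C : ℝ≥0}
    (hR : ball z₁ R ⊆ (extChartAt (𝓡 m) c).target)
    (hC : ∀ z ∈ ball z₁ R, ∀ v : 𝔼, ‖paramDeriv c z v‖ ≤ C * ‖v‖)
    {z w : 𝔼} (hz : z ∈ ball z₁ R) (hw : w ∈ ball z₁ R) :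
    edist ((extChartAt (𝓡 m) c).symm z) ((extChartAt (𝓡 m) c).symm w) ≤ C * edist z w := by
  rw [IsRiemannianManifold.out (I := 𝓡 m)]
  let η := ContinuousAffineMap.lineMap (R := ℝ) z w
  set γ := (extChartAt (𝓡 m) c).symm ∘ η
  have hη : Icc 0 1 ⊆ ⇑η ⁻¹' (ball z₁ R) := by
    simp only [← image_subset_iff, ContinuousAffineMap.coe_lineMap_eq,
     ← segment_eq_image_lineMap, η]
    exact (convex_ball _ _).segment_subset hz hw
  have η_smooth : CMDiff[Icc 0 1] 1 η := by
    apply ContMDiff.contMDiffOn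
    rw [contMDiff_iff_contDiff]
    exact ContinuousAffineMap.contDiff _
  have hsub := hη.trans (preimage_mono hR)
  have : riemannianEDist (𝓡 m) ((extChartAt (𝓡 m) c).symm z) ((extChartAt (𝓡 m) c).symm w) ≤
      pathELength (𝓡 m) γ 0 1 := by
    apply riemannianEDist_le_pathELength _ _ _ zero_le_one
    · exact (contMDiffOn_extChartAt_symm c).comp η_smooth hsub
    · simp [γ, η, ContinuousAffineMap.coe_lineMap_eq]
    · simp [γ, η, ContinuousAffineMap.coe_lineMap_eq]
  apply this.trans
  rw [← lintegral_fderiv_lineMap_eq_edist, pathELength_eq_lintegral_mfderivWithin_Icc,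
    ← lintegral_const_mul' _ _ ENNReal.coe_ne_top]
  apply setLIntegral_mono' measurableSet_Icc (fun t ht ↦ ?_)
  have h1 : mfderivWithin 𝓘(ℝ, ℝ) (𝓡 m) γ (Icc 0 1) t =
      (paramDeriv c (η t)) ∘L (mfderivWithin 𝓘(ℝ, ℝ) (𝓡 m) η (Icc 0 1) t) := by
    apply mfderiv_comp_mfderivWithin
    · have := mdifferentiableWithinAt_extChartAt_symm (I := 𝓡 m) (hsub ht)
      rwa [ModelWithCorners.range_eq_univ, mdifferentiableWithinAt_univ] at this
    · exact η_smooth.mdifferentiableOn one_ne_zero t ht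
    · rw [uniqueMDiffWithinAt_iff_uniqueDiffWithinAt]
      exact uniqueDiffOn_Icc zero_lt_one t ht
  have h2 : mfderivWithin 𝓘(ℝ, ℝ) (𝓡 m) γ (Icc 0 1) t 1 =
      paramDeriv c (η t) (fderivWithin ℝ η (Icc 0 1) t 1) := by
    rw [← mfderivWithin_eq_fderivWithin]
    exact DFunLike.congr_fun h1 1
  have h := hC (η t) (hη ht) (fderivWithin ℝ η (Icc 0 1) t 1)
  rw [h2, ← ofReal_norm, ← ofReal_norm, ← ENNReal.ofReal_coe_nnreal,
    ← ENNReal.ofReal_mul (by positivity)]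
  exact ENNReal.ofReal_le_ofReal h

/-- The chart lengthens paths at most by the factor C as long as they stay in `s`. Two points of the
ε-ball are less than 2ε apart, so an almost shortest path between them stays in the 3ε-ball, and
thus in `s`. -/
theorem edist_extChartAt_le {c : M} {s : Set M} {C : ℝ≥0} (hs : s ⊆ (chartAt 𝔼 c).source)
    (hC : ∀ y ∈ s, ∀ v : TangentSpace (𝓡 m) y,
      ‖(trivializationAt 𝔼 TM c).continuousLinearMapAt ℝ y v‖ ≤ C * ‖v‖)
    {y₁ : M} {ε : ℝ≥0∞} (hε : Metric.eball y₁ (3 * ε) ⊆ s)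
    {x y : M} (hx : x ∈ Metric.eball y₁ ε) (hy : y ∈ Metric.eball y₁ ε) :
    edist (extChartAt (𝓡 m) c x) (extChartAt (𝓡 m) c y) ≤ C * edist x y := by
  have hxy : edist x y < 2 * ε := by
    calc edist x y ≤ edist x y₁ + edist y₁ y := edist_triangle _ _ _
      _ < ε + ε := ENNReal.add_lt_add hx (by rwa [edist_comm])
      _ = 2 * ε := (two_mul _).symm
  -- Lengths r slightly above the distance are needed, since a shortest path may not exist; r then
  -- decreases to the distance. The case C = 0 is separate because the limit is taken after dividing
  -- by C.
  suffices h : ∀ r, edist x y < r → r < 2 * ε →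
      edist (extChartAt (𝓡 m) c x) (extChartAt (𝓡 m) c y) ≤ C * r by
    by_cases h0 : (C : ℝ≥0∞) = 0
    · simpa [h0] using h _ (exists_between hxy).choose_spec.1 (exists_between hxy).choose_spec.2
    · rw [mul_comm, ← ENNReal.div_le_iff_le_mul (Or.inl h0) (Or.inl ENNReal.coe_ne_top)]
      refine le_of_forall_gt_imp_ge_of_dense fun r hr => ?_
      rcases lt_or_ge r (2 * ε) with h2 | h2
      · rw [ENNReal.div_le_iff_le_mul (Or.inl h0) (Or.inl ENNReal.coe_ne_top), mul_comm]
        exact h r hr h2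
      · obtain ⟨q, hq1, hq2⟩ := exists_between hxy
        refine le_trans ?_ (hq2.le.trans h2)
        rw [ENNReal.div_le_iff_le_mul (Or.inl h0) (Or.inl ENNReal.coe_ne_top), mul_comm]
        exact h q hq1 hq2
  intro r hr hrε
  rw [IsRiemannianManifold.out (I := 𝓡 m)] at hr
  obtain ⟨γ, hγx, hγy, γ_smooth, hγ, -⟩ :=
    exists_lt_locally_constant_of_riemannianEDist_lt hr zero_lt_one
  have hmem : ∀ t ∈ Icc (0 : ℝ) 1, γ t ∈ s := by
    intro t ht
    apply hε
    have h1 : edist x (γ t) ≤ pathELength (𝓡 m) γ 0 1 := by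
      rw [IsRiemannianManifold.out (I := 𝓡 m)]
      exact (riemannianEDist_le_pathELength γ_smooth.contMDiffOn hγx rfl ht.1).trans
        (pathELength_mono le_rfl ht.2)
    calc edist (γ t) y₁ ≤ edist (γ t) x + edist x y₁ := edist_triangle _ _ _
      _ < 2 * ε + ε := ENNReal.add_lt_add
        (by rw [edist_comm]; exact (h1.trans_lt hγ).trans hrε) hx
      _ = 3 * ε := by ring
  let γ' := extChartAt (𝓡 m) c ∘ γ
  have hC' : CMDiff[Icc 0 1] 1 γ' :=
    contMDiffOn_extChartAt.comp (I' := 𝓡 m) (t := (chartAt 𝔼 c).source)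
      γ_smooth.contMDiffOn (fun t' ht' ↦ hs (hmem t' ht'))
  calc edist (extChartAt (𝓡 m) c x) (extChartAt (𝓡 m) c y)
    _ = ‖γ' 1 - γ' 0‖ₑ := by rw [edist_comm, edist_eq_enorm_sub]; simp [γ', hγx, hγy]
    _ ≤ ∫⁻ t' in Icc 0 1, ‖derivWithin γ' (Icc 0 1) t'‖ₑ := by
      apply enorm_sub_le_lintegral_derivWithin_Icc_of_contDiffOn_Icc _ zero_le_one
      rwa [← contMDiffOn_iff_contDiffOn]
    _ ≤ ∫⁻ t' in Icc 0 1, C * ‖mfderivWithin 𝓘(ℝ, ℝ) (𝓡 m) γ (Icc 0 1) t' 1‖ₑ := by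
      apply setLIntegral_mono' measurableSet_Icc (fun t' ht' ↦ ?_)
      have h1 : mfderivWithin 𝓘(ℝ, ℝ) (𝓡 m) γ' (Icc 0 1) t' =
          (mfderiv (𝓡 m) (𝓡 m) (extChartAt (𝓡 m) c) (γ t')) ∘L
            (mfderivWithin 𝓘(ℝ, ℝ) (𝓡 m) γ (Icc 0 1) t') := by
        apply mfderiv_comp_mfderivWithin
        · exact mdifferentiableAt_extChartAt (hs (hmem t' ht'))
        · exact (γ_smooth.mdifferentiable one_ne_zero).mdifferentiableOn _ ht'
        · rw [uniqueMDiffWithinAt_iff_uniqueDiffWithinAt]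
          exact uniqueDiffOn_Icc zero_lt_one _ ht'
      have h2 : derivWithin γ' (Icc 0 1) t' =
          (trivializationAt 𝔼 TM c).continuousLinearMapAt ℝ (γ t')
            (mfderivWithin 𝓘(ℝ, ℝ) (𝓡 m) γ (Icc 0 1) t' 1) := by
        rw [← fderivWithin_derivWithin, ← mfderivWithin_eq_fderivWithin,
          TangentBundle.continuousLinearMapAt_trivializationAt (hs (hmem t' ht'))]
        exact DFunLike.congr_fun h1 1
      have h := hC (γ t') (hmem t' ht') (mfderivWithin 𝓘(ℝ, ℝ) (𝓡 m) γ (Icc 0 1) t' 1)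
      rw [h2, ← ofReal_norm, ← ofReal_norm, ← ENNReal.ofReal_coe_nnreal,
        ← ENNReal.ofReal_mul (by positivity)]
      exact ENNReal.ofReal_le_ofReal h
    _ = C * pathELength (𝓡 m) γ 0 1 := by
      rw [lintegral_const_mul' _ _ ENNReal.coe_ne_top,
          pathELength_eq_lintegral_mfderivWithin_Icc]
    _ ≤ C * r := by gcongr

theorem exists_isGoodBall {c : M} {z₁ : 𝔼} (hz : z₁ ∈ (extChartAt (𝓡 m) c).target) :
    ∃ (R : ℝ) (C : ℝ≥0), IsGoodBall c z₁ R C := by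
  set y₁ := (extChartAt (𝓡 m) c).symm z₁ with hy₁
  have hy : y₁ ∈ (chartAt 𝔼 c).source := symm_mem_source hz
  have hb : (trivializationAt 𝔼 TM c).baseSet = (chartAt 𝔼 c).source := by simp
  obtain ⟨C₁, h₁0, h₁⟩ := exists_bound_symmL (m := m) c y₁ (hb ▸ hy)
  obtain ⟨C₂, h₂0, h₂⟩ := exists_bound_continuousLinearMapAt (m := m) c y₁ (hb ▸ hy)
  obtain ⟨C₃, h₃0, h₃⟩ := exists_bound_christoffelVec c hz
  lift C₁ to ℝ≥0 using h₁0
  lift C₂ to ℝ≥0 using h₂0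
  lift C₃ to ℝ≥0 using h₃0
  -- One constant serves for all bounds; the summand 1 gives `one_le`.
  set C := 1 + C₁ + C₂ + C₃ with hC
  have hC1 : (C₁ : ℝ) ≤ C := by
    rw [hC]; push_cast; nlinarith [C₂.2, C₃.2, C₁.2]
  have hC2 : C₂ ≤ C := by
    rw [hC, add_right_comm]; exact le_add_self
  have hC3 : (C₃ : ℝ) ≤ C := by
    rw [hC]; push_cast; nlinarith [C₂.2, C₃.2, C₁.2]
  have hsm : ContinuousAt (extChartAt (𝓡 m) c).symm z₁ := continuousAt_extChartAt_symm'' hz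
  obtain ⟨ε₀, hε₀, hε⟩ := EMetric.mem_nhds_iff.1
    (h₂.and ((chartAt 𝔼 c).open_source.mem_nhds hy))
  -- The radius ε₀/3 leaves room for the paths in `edist_extChartAt_le`, which run inside the ball
  -- of three times the radius.
  have h3 : (3 : ℝ≥0∞) * (ε₀ / 3) = ε₀ := ENNReal.mul_div_cancel (by simp) (by simp)
  have hε3 : 0 < ε₀ / 3 := ENNReal.div_pos hε₀.ne' (by simp)
  have hev : ∀ᶠ z in 𝓝 z₁, z ∈ (extChartAt (𝓡 m) c).target ∧
      (∀ v, ‖(trivializationAt 𝔼 TM c).symmL ℝ ((extChartAt (𝓡 m) c).symm z) v‖ ≤ C₁ * ‖v‖) ∧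
      (extChartAt (𝓡 m) c).symm z ∈ Metric.eball y₁ (ε₀ / 3) ∧
      ∀ v w : 𝔼, ‖christoffelVec c z v w‖ ≤ C₃ * ‖v‖ * ‖w‖ :=
    ((isOpen_target c).eventually_mem hz).and ((hsm.eventually h₁).and
      ((hsm.eventually (Metric.eball_mem_nhds _ hε3)).and h₃))
  obtain ⟨R, hR, hR'⟩ := Metric.mem_nhds_iff.1 hev
  have hsub : closedBall z₁ (R / 2) ⊆ ball z₁ R := closedBall_subset_ball (by linarith)
  have hle : ∀ z ∈ ball z₁ R, ∀ v : 𝔼, ‖paramDeriv c z v‖ ≤ C * ‖v‖ := fun z hz v => by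
    obtain ⟨a, b, -, -⟩ := hR' hz
    rw [paramDeriv_eq_symmL a]
    exact (b v).trans (by gcongr)
  refine ⟨R / 2, C, half_pos hR, ?_, fun z hz => (hR' (hsub hz)).1, fun z hz w hw => ?_,
    fun z hz w hw => ?_, fun z hz => hle z (hsub hz), fun z hz v => ?_, fun z hz v w => ?_⟩
  · rw [hC, add_assoc, add_assoc]; exact le_self_add
  · exact edist_symm_le (fun z hz => (hR' hz).1) hle (hsub hz) (hsub hw)
  · obtain ⟨a, -, b, -⟩ := hR' (hsub hz)
    obtain ⟨a', -, b', -⟩ := hR' (hsub hw)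
    have := edist_extChartAt_le (c := c) (C := C₂) (s := Metric.eball y₁ ε₀)
      (fun y hy => (hε hy).2) (fun y hy => (hε hy).1) (by rw [h3]) b b'
    rw [(extChartAt (𝓡 m) c).right_inv a, (extChartAt (𝓡 m) c).right_inv a'] at this
    exact this.trans (by gcongr)
  · obtain ⟨a, -, b, -⟩ := hR' (hsub hz)
    have hle3 : ε₀ / 3 ≤ ε₀ := ENNReal.div_le_of_le_mul (le_mul_of_one_le_right' (by norm_num))
    have h4 := (hε (Metric.eball_subset_eball hle3 b)).1 (paramDeriv c z v)
    rw [continuousLinearMapAt_paramDeriv a] at h4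
    exact h4.trans (by gcongr)
  · exact ((hR' (hsub hz)).2.2.2 v w).trans (by gcongr)

end Geometry

/-! ### Comparison of the Riemannian volume with Lebesgue measure in charts. -/

section Volume

variable {m : ℕ} {M : Type*} [EMetricSpace M] [ChartedSpace (EuclideanSpace ℝ (Fin m)) M]

local notation "𝔼" => EuclideanSpace ℝ (Fin m)
local notation "Φ[" c "]" => PartialEquiv.symm (extChartAt (𝓡 m) c)
local notation "TM" => (TangentSpace (𝓡 m) : M → Type _)

variable [IsManifold (𝓡 m) ∞ M] [RiemannianBundle (fun x : M => TangentSpace (𝓡 m) x)]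
  [IsContMDiffRiemannianBundle (𝓡 m) ∞ (EuclideanSpace ℝ (Fin m))
    (fun x : M => TangentSpace (𝓡 m) x)]
  [IsRiemannianManifold (𝓡 m) M] [MeasurableSpace M] [BorelSpace M]

namespace IsGoodBall

variable {c : M} {z₁ : EuclideanSpace ℝ (Fin m)} {R : ℝ} {C : ℝ≥0}


theorem mono (h : IsGoodBall c z₁ R C) {r : ℝ} (hr : 0 < r) (hrR : r ≤ R) :
    IsGoodBall c z₁ r C := by
  have hs := closedBall_subset_closedBall (x := z₁) hrR
  exact ⟨hr, h.one_le, hs.trans h.subset, fun z hz w hw => h.edist_le z (hs hz) w (hs hw),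
    fun z hz w hw => h.le_edist z (hs hz) w (hs hw), fun z hz => h.norm_le z (hs hz),
    fun z hz => h.le_norm z (hs hz), fun z hz => h.christoffel_le z (hs hz)⟩

/-- A C-Lipschitz map multiplies m-dimensional Hausdorff measure by at most Cᵐ. Such two-sided
bounds are all that is used about the volume; no Jacobian formula enters. -/
theorem riemVol_image_le (h : IsGoodBall c z₁ R C) {s : Set 𝔼} (hs : s ⊆ (closedBall z₁ R)) :
    riemVol m M (Φ[c] '' s) ≤ (C : ℝ≥0∞) ^ m * volume s := by
  have hl : LipschitzOnWith C Φ[c] s := fun z hz w hw => h.edist_le z (hs hz) w (hs hw)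
  have := hl.hausdorffMeasure_image_le (d := m) (by positivity)
  rw [← EuclideanSpace.euclideanHausdorffMeasure_eq_volume m, riemVol,
    Measure.euclideanHausdorffMeasure_def, Measure.euclideanHausdorffMeasure_def,
    Measure.smul_apply, Measure.smul_apply, mul_smul_comm]
  rw [ENNReal.rpow_natCast] at this
  gcongr

theorem volume_le (h : IsGoodBall c z₁ R C) {s : Set 𝔼} (hs : s ⊆ (closedBall z₁ R)) :
    volume s ≤ (C : ℝ≥0∞) ^ m * riemVol m M (Φ[c] '' s) := by
  have hl : LipschitzOnWith C (extChartAt (𝓡 m) c) (Φ[c] '' s) := by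
    rintro _ ⟨z, hz, rfl⟩ _ ⟨w, hw, rfl⟩
    rw [(extChartAt (𝓡 m) c).right_inv (h.subset (hs hz)),
      (extChartAt (𝓡 m) c).right_inv (h.subset (hs hw))]
    exact h.le_edist z (hs hz) w (hs hw)
  have h1 : extChartAt (𝓡 m) c '' (Φ[c] '' s) = s := by
    rw [image_image]
    refine (image_congr fun z hz => ?_).trans (image_id s)
    exact (extChartAt (𝓡 m) c).right_inv (h.subset (hs hz))
  have := hl.hausdorffMeasure_image_le (d := m) (by positivity)
  rw [h1, ENNReal.rpow_natCast] at this
  rw [← EuclideanSpace.euclideanHausdorffMeasure_eq_volume m, riemVol,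
    Measure.euclideanHausdorffMeasure_def, Measure.euclideanHausdorffMeasure_def,
    Measure.smul_apply, Measure.smul_apply, mul_smul_comm]
  gcongr

theorem continuousOn_symm (h : IsGoodBall c z₁ R C) : ContinuousOn Φ[c] (closedBall z₁ R) :=
  (continuousOn_extChartAt_symm c).mono h.subset

theorem isClosed_image (h : IsGoodBall c z₁ R C) : IsClosed (Φ[c] '' (closedBall z₁ R)) :=
  ((isCompact_closedBall z₁ R).image_of_continuousOn h.continuousOn_symm).isClosed

theorem mapsTo_extChartAt (h : IsGoodBall c z₁ R C) {x : M} (hx : x ∈ Φ[c] '' (closedBall z₁ R)) :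
    extChartAt (𝓡 m) c x ∈ (closedBall z₁ R) ∧ Φ[c] (extChartAt (𝓡 m) c x) = x := by
  obtain ⟨z, hz, rfl⟩ := hx
  rw [(extChartAt (𝓡 m) c).right_inv (h.subset hz)]
  exact ⟨hz, rfl⟩

theorem image_mem_nhds (h : IsGoodBall c z₁ R C) {r : ℝ} (hr : 0 < r) :
    Φ[c] '' closedBall z₁ r ∈ 𝓝 (Φ[c] z₁) := by
  have h1 := h.subset (mem_closedBall_self h.pos.le)
  have h2 : ContinuousAt (extChartAt (𝓡 m) c) (Φ[c] z₁) :=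
    continuousAt_extChartAt' ((extChartAt (𝓡 m) c).map_target h1)
  filter_upwards [h2.preimage_mem_nhds (closedBall_mem_nhds _ hr),
    extChartAt_source_mem_nhds' (I := 𝓡 m) ((extChartAt (𝓡 m) c).map_target h1)] with x hx hx'
  rw [mem_preimage, (extChartAt (𝓡 m) c).right_inv h1] at hx
  exact ⟨_, hx, (extChartAt (𝓡 m) c).left_inv hx'⟩

end IsGoodBall

open Classical in
/-- A measurable extension of the parametrization of a ball in a chart. -/
def ballParam (c : M) (z₁ : 𝔼) (R : ℝ) : 𝔼 → M :=
  (closedBall z₁ R).piecewise (extChartAt (𝓡 m) c).symm (fun _ => c)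

open Classical in
/-- A measurable extension of the chart on the image of a ball. -/
def ballChart (c : M) (z₁ : 𝔼) (R : ℝ) : M → 𝔼 :=
  (Φ[c] '' closedBall z₁ R).piecewise (extChartAt (𝓡 m) c) (fun _ => z₁)

open Classical in
theorem ballParam_eq {c : M} {z₁ : 𝔼} {R : ℝ} {z : 𝔼} (hz : z ∈ closedBall z₁ R) :
    ballParam c z₁ R z = Φ[c] z :=
  piecewise_eq_of_mem _ _ _ hz

open Classical in
theorem ballChart_eq {c : M} {z₁ : 𝔼} {R : ℝ} {x : M}
    (hx : x ∈ Φ[c] '' closedBall z₁ R) :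
    ballChart c z₁ R x = extChartAt (𝓡 m) c x :=
  piecewise_eq_of_mem _ _ _ hx

namespace IsGoodBall

variable {c : M} {z₁ : EuclideanSpace ℝ (Fin m)} {R : ℝ} {C : ℝ≥0}


open Classical in
theorem measurable_ballParam (h : IsGoodBall c z₁ R C) : Measurable (ballParam c z₁ R) :=
  h.continuousOn_symm.measurable_piecewise continuousOn_const measurableSet_closedBall

open Classical in
theorem measurable_ballChart (h : IsGoodBall c z₁ R C) : Measurable (ballChart c z₁ R) := by
  refine ContinuousOn.measurable_piecewise ?_ continuousOn_const h.isClosed_image.measurableSet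
  refine (continuousOn_extChartAt c).mono ?_
  rintro _ ⟨z, hz, rfl⟩
  exact (extChartAt (𝓡 m) c).map_target (h.subset hz)

/-- Domination of the image measure gives both an integral inequality and absolute continuity; the
latter transfers almost everywhere measurability from M to the chart. -/
theorem map_ballParam_le (h : IsGoodBall c z₁ R C) :
    Measure.map (ballParam c z₁ R) (volume.restrict (closedBall z₁ R)) ≤ ((C : ℝ≥0∞) ^ m) • riemVol m M := by
  refine Measure.le_iff.2 fun s hs => ?_
  rw [Measure.map_apply h.measurable_ballParam hs,
    Measure.restrict_apply (h.measurable_ballParam hs), Measure.smul_apply, smul_eq_mul]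
  refine (h.volume_le inter_subset_right).trans ?_
  gcongr
  rintro _ ⟨z, ⟨hz, hz'⟩, rfl⟩
  rwa [mem_preimage, ballParam_eq hz'] at hz

theorem restrict_le_map_ballParam (h : IsGoodBall c z₁ R C) {s : Set 𝔼} (hs : s ⊆ (closedBall z₁ R))
    (hm : MeasurableSet s) :
    (riemVol m M).restrict (Φ[c] '' s) ≤
      ((C : ℝ≥0∞) ^ m) • Measure.map (ballParam c z₁ R) (volume.restrict s) := by
  refine Measure.le_iff.2 fun t ht => ?_
  rw [Measure.restrict_apply ht, Measure.smul_apply, smul_eq_mul,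
    Measure.map_apply h.measurable_ballParam ht, Measure.restrict_apply' hm]
  refine le_trans (measure_mono ?_) (h.riemVol_image_le (inter_subset_right.trans hs))
  rintro _ ⟨hx, z, hz, rfl⟩
  exact ⟨z, ⟨by rwa [mem_preimage, ballParam_eq (hs hz)], hz⟩, rfl⟩

theorem map_ballChart_le (h : IsGoodBall c z₁ R C) :
    Measure.map (ballChart c z₁ R) ((riemVol m M).restrict (Φ[c] '' (closedBall z₁ R))) ≤
      ((C : ℝ≥0∞) ^ m) • volume.restrict (closedBall z₁ R) := by
  refine Measure.le_iff.2 fun s hs => ?_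
  rw [Measure.map_apply h.measurable_ballChart hs,
    Measure.restrict_apply (h.measurable_ballChart hs), Measure.smul_apply, smul_eq_mul,
    Measure.restrict_apply hs]
  refine le_trans (measure_mono ?_) (h.riemVol_image_le inter_subset_right)
  rintro x ⟨hx, hx'⟩
  rw [mem_preimage, ballChart_eq hx'] at hx
  exact ⟨_, ⟨hx, (h.mapsTo_extChartAt hx').1⟩, (h.mapsTo_extChartAt hx').2⟩

theorem ae_of_ae_volume (h : IsGoodBall c z₁ R C) {q : M → Prop}
    (hq : ∀ᵐ z ∂(volume.restrict (closedBall z₁ R)), q (Φ[c] z)) :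
    ∀ᵐ x ∂((riemVol m M).restrict (Φ[c] '' (closedBall z₁ R))), q x := by
  rw [ae_restrict_iff' h.isClosed_image.measurableSet]
  rw [ae_restrict_iff' measurableSet_closedBall] at hq
  rw [ae_iff] at hq ⊢
  refine measure_mono_null (t := Φ[c] '' ({z | ¬(z ∈ (closedBall z₁ R) → q (Φ[c] z))} ∩ (closedBall z₁ R))) ?_ ?_
  · intro x hx
    simp only [mem_ofPred_eq, Classical.not_imp] at hx
    obtain ⟨⟨z, hz, rfl⟩, hx⟩ := hx
    exact ⟨z, ⟨by simpa using ⟨by simpa using hz, hx⟩, hz⟩, rfl⟩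
  · refine le_antisymm ((h.riemVol_image_le inter_subset_right).trans ?_) zero_le
    rw [measure_mono_null inter_subset_left hq, mul_zero]

theorem ae_volume_of_ae (h : IsGoodBall c z₁ R C) {q : M → Prop}
    (hq : ∀ᵐ x ∂(riemVol m M), q x) : ∀ᵐ z ∂(volume.restrict (closedBall z₁ R)), q (Φ[c] z) := by
  rw [ae_restrict_iff' measurableSet_closedBall]
  rw [ae_iff] at hq ⊢
  refine le_antisymm ((h.volume_le (s := {z | ¬(z ∈ (closedBall z₁ R) → q (Φ[c] z))}) ?_).trans ?_) zero_le
  · intro z hz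
    simp only [mem_ofPred_eq, Classical.not_imp] at hz
    exact hz.1
  · rw [measure_mono_null ?_ hq, mul_zero]
    rintro _ ⟨z, hz, rfl⟩
    simp only [mem_ofPred_eq, Classical.not_imp] at hz ⊢
    exact hz.2

theorem lintegral_symm_le (h : IsGoodBall c z₁ R C) {g : M → ℝ≥0∞}
    (hg : AEMeasurable g (riemVol m M)) :
    ∫⁻ z in (closedBall z₁ R), g (Φ[c] z) ≤ (C : ℝ≥0∞) ^ m * ∫⁻ x, g x ∂(riemVol m M) := by
  have hac : Measure.map (ballParam c z₁ R) (volume.restrict (closedBall z₁ R)) ≪ riemVol m M :=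
    Measure.AbsolutelyContinuous.trans h.map_ballParam_le.absolutelyContinuous
      Measure.smul_absolutelyContinuous
  calc ∫⁻ z in (closedBall z₁ R), g (Φ[c] z) = ∫⁻ z in (closedBall z₁ R), g (ballParam c z₁ R z) :=
        setLIntegral_congr_fun measurableSet_closedBall fun z hz => by rw [ballParam_eq hz]
    _ = ∫⁻ x, g x ∂(Measure.map (ballParam c z₁ R) (volume.restrict (closedBall z₁ R))) :=
        (lintegral_map' (hg.mono_ac hac) h.measurable_ballParam.aemeasurable).symm
    _ ≤ ∫⁻ x, g x ∂(((C : ℝ≥0∞) ^ m) • riemVol m M) := lintegral_mono' h.map_ballParam_le le_rfl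
    _ = _ := by rw [lintegral_smul_measure, smul_eq_mul]

theorem lintegral_image_le (h : IsGoodBall c z₁ R C) {s : Set 𝔼} (hs : s ⊆ (closedBall z₁ R))
    (hm : MeasurableSet s) (g : M → ℝ≥0∞) :
    ∫⁻ x in Φ[c] '' s, g x ∂(riemVol m M) ≤ (C : ℝ≥0∞) ^ m * ∫⁻ z in s, g (Φ[c] z) := by
  refine (lintegral_mono' (h.restrict_le_map_ballParam hs hm) le_rfl).trans ?_
  rw [lintegral_smul_measure, smul_eq_mul]
  gcongr
  refine (lintegral_map_le _ _).trans (le_of_eq ?_)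
  exact setLIntegral_congr_fun hm fun z hz => by rw [ballParam_eq (hs hz)]

end IsGoodBall

variable [CompactSpace M]

theorem secondCountableTopology : SecondCountableTopology M :=
  EMetric.secondCountable_of_sigmaCompact M

theorem isFiniteMeasure_riemVol : IsFiniteMeasure (riemVol m M) := by
  have h : ∀ c : M, ∃ s ∈ 𝓝 c, riemVol m M s < ⊤ := fun c => by
    obtain ⟨R, C, h⟩ := exists_isGoodBall (m := m) (mem_extChartAt_target (I := 𝓡 m) c)
    refine ⟨_, by simpa using h.image_mem_nhds h.pos, ?_⟩
    refine (h.riemVol_image_le subset_rfl).trans_lt ?_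
    exact ENNReal.mul_lt_top (by finiteness) measure_closedBall_lt_top
  refine ⟨isCompact_univ.measure_lt_top_of_nhdsWithin fun x _ => ?_⟩
  obtain ⟨s, hs, h⟩ := h x
  exact ⟨s, mem_nhdsWithin_of_mem_nhds hs, h⟩

/-- Chart-wise almost everywhere properties hold almost everywhere. -/
theorem ae_of_forall_chart {q : M → Prop}
    (h : ∀ c : M, ∀ᵐ z ∂(volume.restrict (extChartAt (𝓡 m) c).target),
      q (Φ[c] z)) : ∀ᵐ x ∂(riemVol m M), q x := by
  choose R C hR using fun c : M => exists_isGoodBall (m := m) (mem_extChartAt_target (I := 𝓡 m) c)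
  obtain ⟨t, -, ht⟩ := isCompact_univ.elim_nhds_subcover
    (fun c => Φ[c] '' closedBall (extChartAt (𝓡 m) c c) (R c))
    fun c _ => by simpa using (hR c).image_mem_nhds (hR c).pos
  rw [← Measure.restrict_univ (μ := riemVol m M)]
  refine ae_restrict_of_ae_restrict_of_subset ht ?_
  rw [ae_restrict_biUnion_finset_iff]
  intro c _
  exact (hR c).ae_of_ae_volume (ae_restrict_of_ae_restrict_of_subset (hR c).subset (h c))

/-- Good balls exist around every point of the chart target, so the exceptional set is locally null,
and hence null. -/
theorem ae_chart_of_ae {q : M → Prop} (h : ∀ᵐ x ∂(riemVol m M), q x) (c : M) :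
    ∀ᵐ z ∂(volume.restrict (extChartAt (𝓡 m) c).target), q (Φ[c] z) := by
  rw [ae_restrict_iff' (isOpen_target c).measurableSet, ae_iff]
  refine measure_null_of_locally_null _ fun z₁ hz₁ => ?_
  simp only [mem_ofPred_eq, Classical.not_imp] at hz₁
  obtain ⟨R, C, hR⟩ := exists_isGoodBall (m := m) hz₁.1
  refine ⟨_, inter_mem self_mem_nhdsWithin
    (mem_nhdsWithin_of_mem_nhds (closedBall_mem_nhds _ hR.pos)), ?_⟩
  have h1 := hR.ae_volume_of_ae h
  rw [ae_restrict_iff' measurableSet_closedBall, ae_iff] at h1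
  refine measure_mono_null (fun z hz => ?_) h1
  simp only [mem_ofPred_eq, Classical.not_imp, mem_inter_iff] at hz ⊢
  exact ⟨hz.2, hz.1.2⟩

end Volume

theorem biUnion_finset_eq_iUnion {ι α : Type*} (t : Finset ι) (f : ι → Set α) :
    ⋃ c ∈ t, f c = ⋃ c : t, f c := by
  ext; simp

/-! ### The norm of a multilinear map as a countable supremum. -/

section Multilinear

variable {E V F : Type*} [NormedAddCommGroup E] [NormedSpace ℝ E]
  [TopologicalSpace.SeparableSpace E] [NormedAddCommGroup V] [NormedSpace ℝ V]
  [NormedAddCommGroup F] [NormedSpace ℝ F]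

/-- The norm of a multilinear map as a countable supremum. -/
theorem enorm_multilinear_eq_iSup {k : ℕ} (L : ContinuousMultilinearMap ℝ (fun _ : Fin k => V) F)
    (A : E →L[ℝ] V) (hA : Function.Surjective A) :
    ‖L‖ₑ = ⨆ n : Fin k → ℕ, ‖L fun i => A (TopologicalSpace.denseSeq E (n i))‖ₑ /
      ∏ i, ‖A (TopologicalSpace.denseSeq E (n i))‖ₑ := by
  set d := TopologicalSpace.denseSeq E
  have hL : ∀ w : Fin k → V, ‖L w‖ₑ ≤ ‖L‖ₑ * ∏ i, ‖w i‖ₑ := fun w => by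
    have := ENNReal.ofReal_le_ofReal (L.le_opNorm w)
    rw [ENNReal.ofReal_mul (norm_nonneg _),
      ENNReal.ofReal_prod_of_nonneg fun _ _ => norm_nonneg _] at this
    simpa only [ofReal_norm] using this
  refine le_antisymm ?_ (iSup_le fun n => ENNReal.div_le_of_le_mul (hL _))
  set S := ⨆ n : Fin k → ℕ, ‖L fun i => A (d (n i))‖ₑ / ∏ i, ‖A (d (n i))‖ₑ with hS
  rcases eq_or_ne S ⊤ with hT | hT
  · rw [hT]; exact le_top
  have hdense : DenseRange (fun (n : Fin k → ℕ) i => d (n i)) :=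
    DenseRange.piMap fun _ => TopologicalSpace.denseRange_denseSeq E
  have hn : ∀ n : Fin k → ℕ,
      ‖L fun i => A (d (n i))‖ ≤ S.toReal * ∏ i, ‖A (d (n i))‖ := fun n => by
    have h1 : ‖L fun i => A (d (n i))‖ₑ / ∏ i, ‖A (d (n i))‖ₑ ≤ S :=
      le_iSup (fun n : Fin k → ℕ => ‖L fun i => A (d (n i))‖ₑ / ∏ i, ‖A (d (n i))‖ₑ) n
    -- If some argument vanishes, the quotient is 0/0 and carries no information, but then L also
    -- vanishes on the tuple.
    by_cases h0 : ∃ i, A (d (n i)) = 0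
    · obtain ⟨i, hi⟩ := h0
      rw [L.map_coord_zero i hi, norm_zero]
      positivity
    · push Not at h0
      have hpos : (∏ i, ‖A (d (n i))‖ₑ) ≠ 0 :=
        Finset.prod_ne_zero_iff.2 fun i _ => by simpa using h0 i
      have htop : (∏ i, ‖A (d (n i))‖ₑ) ≠ ⊤ := ENNReal.prod_ne_top fun i _ => enorm_ne_top
      rw [ENNReal.div_le_iff hpos htop] at h1
      have := ENNReal.toReal_mono (ENNReal.mul_ne_top hT htop) h1
      simpa [ENNReal.toReal_mul, ENNReal.toReal_prod] using this
  have hall : ∀ v : Fin k → E, ‖L fun i => A (v i)‖ ≤ S.toReal * ∏ i, ‖A (v i)‖ := by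
    intro v
    refine hdense.induction_on (p := fun v : Fin k → E =>
      ‖L fun i => A (v i)‖ ≤ S.toReal * ∏ i, ‖A (v i)‖) v ?_ hn
    refine isClosed_le ?_ ?_
    · exact (L.cont.comp (continuous_pi fun i => A.continuous.comp (continuous_apply i))).norm
    · exact continuous_const.mul (continuous_finsetProd _ fun i _ =>
        (A.continuous.comp (continuous_apply i)).norm)
  have hle : ‖L‖ ≤ S.toReal := by
    refine ContinuousMultilinearMap.opNorm_le_bound ENNReal.toReal_nonneg fun w => ?_
    choose v hv using fun i => hA (w i)
    have := hall v
    simpa only [hv] using this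
  rw [← ofReal_norm]
  exact ENNReal.ofReal_le_of_le_toReal hle

end Multilinear

/-! ### Tensor fields in charts: norms, measurability and transports. -/

section Tensor

variable {m : ℕ} {M : Type*} [EMetricSpace M] [ChartedSpace (EuclideanSpace ℝ (Fin m)) M]

local notation "𝔼" => EuclideanSpace ℝ (Fin m)
local notation "Φ[" c "]" => PartialEquiv.symm (extChartAt (𝓡 m) c)
local notation "TM" => (TangentSpace (𝓡 m) : M → Type _)

variable [IsManifold (𝓡 m) ∞ M] [RiemannianBundle (fun x : M => TangentSpace (𝓡 m) x)]
  [IsContMDiffRiemannianBundle (𝓡 m) ∞ (EuclideanSpace ℝ (Fin m))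
    (fun x : M => TangentSpace (𝓡 m) x)]
  [IsRiemannianManifold (𝓡 m) M] [MeasurableSpace M] [BorelSpace M]

variable {ν k : ℕ}

theorem TensorField.inChart_eq_sum (T : TensorField m M ν k) (c : M) (z : 𝔼) (v : Fin k → 𝔼) :
    T.inChart c z v = ∑ L : Fin k → Fin m, (∏ i, v i (L i)) •
      T.inChart c z (fun i => EuclideanSpace.single (L i) 1) := by
  have hv : ∀ i, paramDeriv c z (v i) =
      ∑ l, v i l • paramDeriv c z (EuclideanSpace.single l 1) := fun i => by
    have : v i = ∑ l, v i l • EuclideanSpace.single l (1 : ℝ) := by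
      ext q
      simp [Pi.single_apply]
    conv_lhs => rw [this]
    rw [_root_.map_sum]
    exact Finset.sum_congr rfl fun j _ => map_smul _ _ _
  unfold TensorField.inChart
  simp only [hv]
  rw [ContinuousMultilinearMap.map_sum]
  exact Finset.sum_congr rfl fun L _ => ContinuousMultilinearMap.map_smul_univ _ _ _

theorem TensorField.inChart_sub (T S : TensorField m M ν k) (c : M) (z : 𝔼) (v : Fin k → 𝔼) :
    (T - S).inChart c z v = T.inChart c z v - S.inChart c z v := rfl

theorem surjective_paramDeriv {c : M} {z : 𝔼} (hz : z ∈ (extChartAt (𝓡 m) c).target) :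
    Function.Surjective (paramDeriv c z) :=
  fun v => ⟨_, paramDeriv_continuousLinearMapAt hz v⟩

theorem continuousOn_norm_paramDeriv (c : M) (v : 𝔼) :
    ContinuousOn (fun z => ‖paramDeriv c z v‖) (extChartAt (𝓡 m) c).target := by
  refine ((contDiffOn_inner_paramDeriv c v v).continuousOn.sqrt).congr fun z _ => ?_
  simp only [real_inner_self_eq_norm_sq, Real.sqrt_sq (norm_nonneg _)]

theorem IsGoodBall.norm_inChart_le {c : M} {z₁ : 𝔼} {R : ℝ} {C : ℝ≥0} (h : IsGoodBall c z₁ R C)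
    (T : TensorField m M ν k) {z : 𝔼} (hz : z ∈ closedBall z₁ R) (v : Fin k → 𝔼) :
    ‖T.inChart c z v‖ ≤ C ^ k * (∏ i, ‖v i‖) * ‖T (Φ[c] z)‖ := by
  refine ((T (Φ[c] z)).le_opNorm _).trans ?_
  rw [mul_comm]
  gcongr
  calc ∏ i, ‖paramDeriv c z (v i)‖ ≤ ∏ i, (C * ‖v i‖) :=
        Finset.prod_le_prod (fun _ _ => norm_nonneg _) fun i _ => h.norm_le z hz (v i)
    _ = C ^ k * ∏ i, ‖v i‖ := by simp [Finset.prod_mul_distrib]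

theorem IsGoodBall.norm_le_sum {c : M} {z₁ : 𝔼} {R : ℝ} {C : ℝ≥0} (h : IsGoodBall c z₁ R C)
    {z : 𝔼} (hz : z ∈ closedBall z₁ R) (T : TensorField m M ν k) :
    ‖T (Φ[c] z)‖ ≤ C ^ k * ∑ L : Fin k → Fin m,
      ‖T.inChart c z (fun i => EuclideanSpace.single (L i) 1)‖ := by
  refine ContinuousMultilinearMap.opNorm_le_bound (by positivity) fun w => ?_
  choose v hv using fun i => surjective_paramDeriv (h.subset hz) (w i)
  have h1 : T (Φ[c] z) w = T.inChart c z v := by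
    unfold TensorField.inChart
    simp only [hv]
  rw [h1, T.inChart_eq_sum, Finset.mul_sum, Finset.sum_mul]
  refine (norm_sum_le _ _).trans (Finset.sum_le_sum fun L _ => ?_)
  rw [norm_smul, mul_right_comm, norm_prod]
  refine mul_le_mul_of_nonneg_right ?_ (norm_nonneg _)
  calc ∏ i, ‖v i (L i)‖ ≤ ∏ i, (C * ‖w i‖) := Finset.prod_le_prod (fun _ _ => norm_nonneg _)
        fun i _ => (PiLp.norm_apply_le (v i) (L i)).trans (by rw [← hv]; exact h.le_norm z hz (v i))
    _ = C ^ k * ∏ i, ‖w i‖ := by simp [Finset.prod_mul_distrib]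

/-- Measurability of a tensor field: its components in charts are measurable. -/
def TensorField.IsMeas (T : TensorField m M ν k) : Prop :=
  ∀ (c : M) (v : Fin k → 𝔼), AEStronglyMeasurable (fun z => T.inChart c z v)
    (volume.restrict (extChartAt (𝓡 m) c).target)

theorem TensorField.IsMeas.sub {T S : TensorField m M ν k} (hT : T.IsMeas) (hS : S.IsMeas) :
    (T - S).IsMeas := fun c v => (hT c v).sub (hS c v)

/-- The fibre and its norm vary with the point, so the operator norm is not a fixed continuous
function of the components. It is a countable supremum of quotients, each of them measurable. -/
theorem TensorField.IsMeas.aemeasurable_enorm_chart {T : TensorField m M ν k} (hT : T.IsMeas)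
    (c : M) : AEMeasurable (fun z => ‖T (Φ[c] z)‖ₑ)
      (volume.restrict (extChartAt (𝓡 m) c).target) := by
  have hm := (isOpen_target (m := m) c).measurableSet
  refine AEMeasurable.congr (f := fun z => ⨆ n : Fin k → ℕ,
    ‖T.inChart c z fun i => TopologicalSpace.denseSeq 𝔼 (n i)‖ₑ /
      ∏ i, ‖paramDeriv c z (TopologicalSpace.denseSeq 𝔼 (n i))‖ₑ) ?_ ?_
  · refine AEMeasurable.iSup fun n => (hT c _).enorm.div ?_
    refine Finset.aemeasurable_fun_prod _ fun i _ => ?_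
    have := ((continuousOn_norm_paramDeriv c (TopologicalSpace.denseSeq 𝔼 (n i))).aemeasurable
      (μ := volume) hm).ennreal_ofReal
    simpa only [ofReal_norm] using this
  · filter_upwards [ae_restrict_mem hm] with z hz
    exact (enorm_multilinear_eq_iSup (T (Φ[c] z)) (paramDeriv c z) (surjective_paramDeriv hz)).symm

/-- On the image of the ball f is the composition of its chart expression with `ballChart`, whose
image measure is absolutely continuous with respect to Lebesgue measure. -/
theorem IsGoodBall.aemeasurable_of_chart {c : M} {z₁ : 𝔼} {R : ℝ} {C : ℝ≥0}
    (h : IsGoodBall c z₁ R C) {f : M → ℝ≥0∞}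
    (hf : AEMeasurable (fun z => f (Φ[c] z)) (volume.restrict (closedBall z₁ R))) :
    AEMeasurable f ((riemVol m M).restrict (Φ[c] '' closedBall z₁ R)) := by
  have hac : Measure.map (ballChart c z₁ R) ((riemVol m M).restrict (Φ[c] '' closedBall z₁ R)) ≪
      volume.restrict (closedBall z₁ R) :=
    h.map_ballChart_le.absolutelyContinuous.trans Measure.smul_absolutelyContinuous
  refine ((hf.mono_ac hac).comp_measurable h.measurable_ballChart).congr ?_
  filter_upwards [ae_restrict_mem h.isClosed_image.measurableSet] with x hx
  simp only [Function.comp_apply]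
  rw [ballChart_eq hx, (h.mapsTo_extChartAt hx).2]

theorem IsGoodBall.aemeasurable_of_chart_prod [CompactSpace M]
    {c : M} {z₁ : 𝔼} {R : ℝ} {C : ℝ≥0}
    (h : IsGoodBall c z₁ R C) {f : M × M → ℝ≥0∞}
    (hf : AEMeasurable (fun z : 𝔼 × 𝔼 => f (Φ[c] z.1, Φ[c] z.2))
      ((volume.restrict (closedBall z₁ R)).prod (volume.restrict (closedBall z₁ R)))) :
    AEMeasurable f (((riemVol m M).prod (riemVol m M)).restrict
      ((Φ[c] '' closedBall z₁ R) ×ˢ (Φ[c] '' closedBall z₁ R))) := by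
  have := isFiniteMeasure_riemVol (m := m) (M := M)
  have hac : Measure.map (ballChart c z₁ R) ((riemVol m M).restrict (Φ[c] '' closedBall z₁ R)) ≪
      volume.restrict (closedBall z₁ R) :=
    h.map_ballChart_le.absolutelyContinuous.trans Measure.smul_absolutelyContinuous
  have hm := h.measurable_ballChart
  have hac2 := hac.prod hac
  rw [Measure.map_prod_map _ _ hm hm] at hac2
  rw [← Measure.prod_restrict]
  refine ((hf.mono_ac hac2).comp_measurable (hm.prodMap hm)).congr ?_
  rw [Measure.prod_restrict]
  filter_upwards [ae_restrict_mem
    (h.isClosed_image.measurableSet.prod h.isClosed_image.measurableSet)] with x hx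
  simp only [Function.comp_apply, Prod.map]
  rw [ballChart_eq hx.1, ballChart_eq hx.2, (h.mapsTo_extChartAt hx.1).2,
    (h.mapsTo_extChartAt hx.2).2]

variable [CompactSpace M]

theorem TensorField.IsMeas.aemeasurable_enorm {T : TensorField m M ν k} (hT : T.IsMeas) :
    AEMeasurable (fun x => ‖T x‖ₑ) (riemVol m M) := by
  choose R C hR using fun c : M => exists_isGoodBall (m := m) (mem_extChartAt_target (I := 𝓡 m) c)
  obtain ⟨t, -, ht⟩ := isCompact_univ.elim_nhds_subcover
    (fun c => Φ[c] '' closedBall (extChartAt (𝓡 m) c c) (R c))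
    fun c _ => by simpa using (hR c).image_mem_nhds (hR c).pos
  rw [← Measure.restrict_univ (μ := riemVol m M)]
  rw [biUnion_finset_eq_iUnion] at ht
  refine AEMeasurable.mono_set ht ?_
  rw [aemeasurable_iUnion_iff]
  rintro ⟨c, hc⟩
  exact (hR c).aemeasurable_of_chart
    ((hT.aemeasurable_enorm_chart c).mono_set (hR c).subset)

variable {P : ∀ x y : M, TangentSpace (𝓡 m) x →L[ℝ] TangentSpace (𝓡 m) y}

/-- Near a diagonal point, a transport is close to the identity in a chart. -/
theorem IsTransport.exists_chart (hP : IsTransport P) (c : M) {η : ℝ} (hη : 0 < η) :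
    ∃ r > 0, ∃ A : 𝔼 × 𝔼 → 𝔼 →L[ℝ] 𝔼,
      closedBall (extChartAt (𝓡 m) c c) r ⊆ (extChartAt (𝓡 m) c).target ∧
      ContinuousOn A
        (closedBall (extChartAt (𝓡 m) c c) r ×ˢ closedBall (extChartAt (𝓡 m) c c) r) ∧
      ∀ z ∈ closedBall (extChartAt (𝓡 m) c c) r, ∀ w ∈ closedBall (extChartAt (𝓡 m) c c) r,
        (∀ v, P (Φ[c] z) (Φ[c] w) (paramDeriv c z v) = paramDeriv c w (A (z, w) v)) ∧
        ‖A (z, w) - ContinuousLinearMap.id ℝ 𝔼‖ ≤ η := by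
  set z₁ := extChartAt (𝓡 m) c c with hz₁
  have hz₁t : z₁ ∈ (extChartAt (𝓡 m) c).target := mem_extChartAt_target (I := 𝓡 m) c
  set B : M × M → 𝔼 →L[ℝ] 𝔼 := fun q => ContinuousLinearMap.inCoordinates 𝔼 TM 𝔼 TM c q.1 c q.2
    (P q.1 q.2) with hB
  set A : 𝔼 × 𝔼 → 𝔼 →L[ℝ] 𝔼 := fun z => B (Φ[c] z.1, Φ[c] z.2) with hA
  -- Being C¹ at (c, c) forces C¹ in a neighbourhood; only continuity of the coordinate matrix is
  -- kept.
  have hBc : ∀ᶠ q in 𝓝 (c, c), ContinuousAt B q :=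
    ((contMDiffAt_iff_contMDiffAt_nhds (by simp)).1 (hP.contMDiffAt c)).mono
      fun q hq => hq.continuousAt
  have hΦc : Φ[c] z₁ = c := extChartAt_to_inv c
  have hΦ : ∀ z ∈ (extChartAt (𝓡 m) c).target, ContinuousAt Φ[c] z := fun z hz =>
    continuousAt_extChartAt_symm'' hz
  have hΦ2 : ContinuousAt (fun z : 𝔼 × 𝔼 => (Φ[c] z.1, Φ[c] z.2)) (z₁, z₁) :=
    (hΦ z₁ hz₁t).prodMap (hΦ z₁ hz₁t)
  have hkey : ∀ z ∈ (extChartAt (𝓡 m) c).target, ∀ w ∈ (extChartAt (𝓡 m) c).target, ∀ v,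
      P (Φ[c] z) (Φ[c] w) (paramDeriv c z v) = paramDeriv c w (A (z, w) v) := by
    intro z hz w hw v
    have h1 : A (z, w) v = (trivializationAt 𝔼 TM c).continuousLinearMapAt ℝ (Φ[c] w)
        (P (Φ[c] z) (Φ[c] w) (paramDeriv c z v)) := by
      rw [paramDeriv_eq_symmL hz]; rfl
    rw [h1, paramDeriv_continuousLinearMapAt hw]
  have hA1 : A (z₁, z₁) = ContinuousLinearMap.id ℝ 𝔼 := by
    ext1 v
    have h1 := hkey z₁ hz₁t z₁ hz₁t v
    rw [hP.diag] at h1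
    have h2 := congrArg (fun x => (trivializationAt 𝔼 TM c).continuousLinearMapAt ℝ (Φ[c] z₁) x) h1
    simp only [continuousLinearMapAt_paramDeriv hz₁t] at h2
    exact h2.symm
  have hAc : ∀ᶠ z in 𝓝 (z₁, z₁), ContinuousAt B (Φ[c] z.1, Φ[c] z.2) := by
    refine hΦ2.eventually ?_
    simp only [hΦc]; exact hBc
  have hA0 : ContinuousAt A (z₁, z₁) := ContinuousAt.comp (g := B) hAc.self_of_nhds hΦ2
  have hnorm : ∀ᶠ z in 𝓝 (z₁, z₁), ‖A z - ContinuousLinearMap.id ℝ 𝔼‖ < η := by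
    refine (hA0.sub continuousAt_const).norm.eventually_lt continuousAt_const ?_
    simp only [Pi.sub_apply, hA1]; simpa using hη
  have htar : ∀ᶠ z : 𝔼 × 𝔼 in 𝓝 (z₁, z₁), z.1 ∈ (extChartAt (𝓡 m) c).target :=
    continuousAt_fst.eventually ((isOpen_target c).eventually_mem hz₁t)
  obtain ⟨r, hr, hr'⟩ := Metric.nhds_basis_closedBall.mem_iff.1 (hAc.and (hnorm.and htar))
  rw [← closedBall_prod_same] at hr'
  have hsub : closedBall z₁ r ⊆ (extChartAt (𝓡 m) c).target := fun z hz =>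
    (hr' (show (z, z₁) ∈ _ from ⟨hz, mem_closedBall_self hr.le⟩)).2.2
  refine ⟨r, hr, A, hsub, ?_, fun z hz w hw => ⟨hkey z (hsub hz) w (hsub hw), ?_⟩⟩
  · rintro ⟨z, w⟩ ⟨hz, hw⟩
    refine ContinuousAt.continuousWithinAt ?_
    refine ContinuousAt.comp (g := B) (f := fun z : 𝔼 × 𝔼 => (Φ[c] z.1, Φ[c] z.2))
      (hr' (show (z, w) ∈ _ from ⟨hz, hw⟩)).1 ?_
    exact (hΦ z (hsub hz)).prodMap (hΦ w (hsub hw))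
  · exact (hr' (show (z, w) ∈ _ from ⟨hz, hw⟩)).2.1.le

/-- The size of the difference of a tensor field at two points, compared by a transport. -/
def diffNorm (P : ∀ x y : M, TangentSpace (𝓡 m) x →L[ℝ] TangentSpace (𝓡 m) y)
    (T : TensorField m M ν k) (q : M × M) : ℝ≥0∞ :=
  ‖T q.1 - (T q.2).compContinuousLinearMap (fun _ => P q.1 q.2)‖ₑ

/-- Lebesgue's number lemma: two points close enough to each other always lie in one common piece,
so that questions near the diagonal reduce to squares in a single chart. -/
theorem exists_finset_cover_diag {p : M → Set M} (hp : ∀ c, p c ∈ 𝓝 c) :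
    ∃ (t : Finset M) (δ : ℝ≥0∞), 0 < δ ∧
      ∀ q : M × M, edist q.1 q.2 < δ → ∃ c ∈ t, q ∈ p c ×ˢ p c := by
  obtain ⟨t, -, ht⟩ := isCompact_univ.elim_nhds_subcover (fun c => interior (p c))
    fun c _ => interior_mem_nhds.2 (hp c)
  rw [biUnion_finset_eq_iUnion] at ht
  obtain ⟨δ, hδ, h⟩ := lebesgue_number_lemma_of_emetric isCompact_univ
    (fun _ => isOpen_interior) ht
  refine ⟨t, δ, hδ, fun q hq => ?_⟩
  obtain ⟨⟨c, hc⟩, h⟩ := h q.1 (mem_univ _)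
  refine ⟨c, hc, interior_subset (h (Metric.mem_eball_self hδ)),
    interior_subset (h (by rwa [Metric.mem_eball, edist_comm]))⟩

/-- The difference of a measurable tensor field at two points is measurable near the diagonal. -/
theorem IsTransport.exists_aemeasurable_diffNorm (hP : IsTransport P) :
    ∃ δ : ℝ≥0∞, 0 < δ ∧ ∀ {ν k : ℕ} {T : TensorField m M ν k}, T.IsMeas →
      AEMeasurable (diffNorm P T)
        (((riemVol m M).prod (riemVol m M)).restrict {q | edist q.1 q.2 < δ}) := by
  choose r hr A hsub hAc hA using fun c : M => hP.exists_chart c one_pos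
  choose R C hR using fun c : M => exists_isGoodBall (m := m) (mem_extChartAt_target (I := 𝓡 m) c)
  have hR' : ∀ c, IsGoodBall c (extChartAt (𝓡 m) c c) (min (R c) (r c)) (C c) := fun c =>
    (hR c).mono (lt_min (hR c).pos (hr c)) (min_le_left _ _)
  obtain ⟨t, δ, hδ, h⟩ := exists_finset_cover_diag
    (p := fun c => Φ[c] '' closedBall (extChartAt (𝓡 m) c c) (min (R c) (r c)))
    fun c => by simpa using (hR' c).image_mem_nhds (hR' c).pos
  refine ⟨δ, hδ, fun {ν k T} hT => ?_⟩
  refine AEMeasurable.mono_set (t := ⋃ c ∈ t,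
    (Φ[c] '' closedBall (extChartAt (𝓡 m) c c) (min (R c) (r c))) ×ˢ
    (Φ[c] '' closedBall (extChartAt (𝓡 m) c c) (min (R c) (r c))))
    (fun q hq => by simpa only [mem_iUnion, exists_prop] using h q hq) ?_
  rw [biUnion_finset_eq_iUnion, aemeasurable_iUnion_iff]
  rintro ⟨c, hc⟩
  refine (hR' c).aemeasurable_of_chart_prod ?_
  set K := closedBall (extChartAt (𝓡 m) c c) (min (R c) (r c)) with hK
  have hKm : MeasurableSet K := measurableSet_closedBall
  have hKt : K ⊆ (extChartAt (𝓡 m) c).target := (hR' c).subset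
  have hKr : K ⊆ closedBall (extChartAt (𝓡 m) c c) (r c) :=
    closedBall_subset_closedBall (min_le_right _ _)
  have hfst : ∀ v, AEStronglyMeasurable (fun z : 𝔼 × 𝔼 => T.inChart c z.1 v)
      ((volume.restrict K).prod (volume.restrict K)) := fun v =>
    ((hT c v).mono_set hKt).comp_quasiMeasurePreserving Measure.quasiMeasurePreserving_fst
  have hsnd : ∀ v, AEStronglyMeasurable (fun z : 𝔼 × 𝔼 => T.inChart c z.2 v)
      ((volume.restrict K).prod (volume.restrict K)) := fun v =>
    ((hT c v).mono_set hKt).comp_quasiMeasurePreserving Measure.quasiMeasurePreserving_snd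
  have hAv : ∀ (v : 𝔼) (l : Fin m), AEStronglyMeasurable (fun z => A c z v l)
      ((volume.restrict K).prod (volume.restrict K)) := fun v l => by
    rw [Measure.prod_restrict]
    refine ContinuousOn.aestronglyMeasurable ?_ (hKm.prod hKm)
    have h1 : ContinuousOn (fun z => A c z v) (K ×ˢ K) :=
      ((hAc c).mono (prod_mono hKr hKr)).clm_apply continuousOn_const
    exact (EuclideanSpace.proj (𝕜 := ℝ) l).continuous.comp_continuousOn h1
  -- In coordinates the pull-back by P becomes a contraction with the continuous matrix A. Each
  -- numerator is then a finite sum of continuous coefficients times measurable components at one of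
  -- the two points.
  refine AEMeasurable.congr (f := fun z => ⨆ n : Fin k → ℕ,
    ‖T.inChart c z.1 (fun i => TopologicalSpace.denseSeq 𝔼 (n i)) -
      ∑ L : Fin k → Fin m, (∏ i, A c z (TopologicalSpace.denseSeq 𝔼 (n i)) (L i)) •
      T.inChart c z.2 (fun i => EuclideanSpace.single (L i) 1)‖ₑ /
      ∏ i, ‖paramDeriv c z.1 (TopologicalSpace.denseSeq 𝔼 (n i))‖ₑ) ?_ ?_
  · refine AEMeasurable.iSup fun n => AEMeasurable.div ?_ ?_
    · refine ((hfst _).sub ?_).enorm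
      refine Finset.aestronglyMeasurable_fun_sum _ fun L _ => ?_
      exact AEStronglyMeasurable.smul
        (Finset.aestronglyMeasurable_fun_prod (M := ℝ) _ fun i _ => hAv _ _) (hsnd _)
    · refine Finset.aemeasurable_fun_prod _ fun i _ => ?_
      have h1 := (((continuousOn_norm_paramDeriv c
        (TopologicalSpace.denseSeq 𝔼 (n i))).mono hKt).aemeasurable
        (μ := volume) hKm).ennreal_ofReal
      simp only [ofReal_norm] at h1
      exact h1.comp_quasiMeasurePreserving Measure.quasiMeasurePreserving_fst
  · rw [Measure.prod_restrict]
    filter_upwards [ae_restrict_mem (hKm.prod hKm)] with z hz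
    rw [diffNorm, enorm_multilinear_eq_iSup _ (paramDeriv c z.1) (surjective_paramDeriv (hKt hz.1))]
    congr! 4 with n
    have h2 := T.inChart_eq_sum c z.2 fun i => A c z (TopologicalSpace.denseSeq 𝔼 (n i))
    rw [← h2]
    have h3 : ∀ v, P (Φ[c] z.1) (Φ[c] z.2) (paramDeriv c z.1 v) = paramDeriv c z.2 (A c z v) :=
      (hA c z.1 (hKr hz.1) z.2 (hKr hz.2)).1
    simp only [TensorField.inChart, ← h3]
    rfl

end Tensor

/-! ### Hölder and convexity inequalities. -/

section Lintegral

variable {α : Type*} [MeasurableSpace α] {μ : Measure α}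

/-- Hölder's inequality against the constant 1. For a probability measure it is Jensen's inequality.
-/
theorem rpow_lintegral_le {p : ℝ} (hp : 1 ≤ p) {g : α → ℝ≥0∞} (hg : AEMeasurable g μ) :
    (∫⁻ a, g a ∂μ) ^ p ≤ μ univ ^ (p - 1) * ∫⁻ a, g a ^ p ∂μ := by
  rcases eq_or_lt_of_le hp with rfl | hp1
  · simp
  have hpq := Real.HolderConjugate.conjExponent hp1
  have h := ENNReal.lintegral_mul_le_Lp_mul_Lq μ hpq hg (aemeasurable_const (b := (1 : ℝ≥0∞)))
  simp only [Pi.mul_apply, mul_one, ENNReal.one_rpow, lintegral_const, one_mul] at h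
  have hp0 : 0 < p := by linarith
  calc (∫⁻ a, g a ∂μ) ^ p
      ≤ ((∫⁻ a, g a ^ p ∂μ) ^ (1 / p) * μ univ ^ (1 / p.conjExponent)) ^ p := by gcongr
    _ = (∫⁻ a, g a ^ p ∂μ) * μ univ ^ (p - 1) := by
        rw [ENNReal.mul_rpow_of_nonneg _ _ hp0.le, ← ENNReal.rpow_mul, ← ENNReal.rpow_mul]
        have h2 : 1 / p.conjExponent * p = p - 1 := by
          have h3 : 1 / p + 1 / p.conjExponent = 1 := by
            simpa [one_div] using hpq.inv_add_inv_eq_one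
          have h4 : 1 / p.conjExponent = 1 - 1 / p := by linarith
          rw [h4]
          field_simp
        rw [h2, one_div, inv_mul_cancel₀ hp0.ne', ENNReal.rpow_one]
    _ = _ := mul_comm _ _

theorem enorm_integral_rpow_le {G : Type*} [NormedAddCommGroup G] [NormedSpace ℝ G] {p : ℝ}
    (hp : 1 ≤ p) {g : α → G} (hg : AEStronglyMeasurable g μ) :
    ‖∫ a, g a ∂μ‖ₑ ^ p ≤ μ univ ^ (p - 1) * ∫⁻ a, ‖g a‖ₑ ^ p ∂μ :=
  (ENNReal.rpow_le_rpow (enorm_integral_le_lintegral_enorm g) (by linarith)).trans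
    (rpow_lintegral_le hp hg.enorm)

theorem enorm_add_rpow_le {G : Type*} [NormedAddCommGroup G] {p : ℝ} (hp : 1 ≤ p) (a b : G) :
    ‖a + b‖ₑ ^ p ≤ 2 ^ (p - 1) * (‖a‖ₑ ^ p + ‖b‖ₑ ^ p) :=
  (ENNReal.rpow_le_rpow (enorm_add_le a b) (by linarith)).trans
    (ENNReal.rpow_add_le_mul_rpow_add_rpow _ _ hp)

theorem enorm_sub_rpow_le {G : Type*} [NormedAddCommGroup G] {p : ℝ} (hp : 1 ≤ p) (a b : G) :
    ‖a - b‖ₑ ^ p ≤ 2 ^ (p - 1) * (‖a‖ₑ ^ p + ‖b‖ₑ ^ p) := by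
  simpa [sub_eq_add_neg, enorm_neg] using enorm_add_rpow_le hp a (-b)

end Lintegral

/-! ### Weak directional derivatives in Euclidean space. -/

section WeakDirDeriv

variable {m ν : ℕ} {Ω : Set (EuclideanSpace ℝ (Fin m))}

local notation "𝔼" => EuclideanSpace ℝ (Fin m)
local notation "𝔽" => EuclideanSpace ℝ (Fin ν)

theorem integrable_smul_of_tsupport_subset {f : EuclideanSpace ℝ (Fin m) → EuclideanSpace ℝ (Fin ν)}
    (hf : LocallyIntegrableOn f Ω)
    {ψ : 𝔼 → ℝ} (hψ : Continuous ψ) (hc : HasCompactSupport ψ) (hs : tsupport ψ ⊆ Ω) :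
    Integrable (fun z => ψ z • f z) := by
  have h1 : IntegrableOn (fun z => ψ z • f z) (tsupport ψ) :=
    (hf.integrableOn_compact_subset hs hc).continuousOn_smul hψ.continuousOn hc
  refine (integrableOn_iff_integrable_of_support_subset fun z hz => subset_tsupport ψ ?_).1 h1
  rw [Function.mem_support] at hz ⊢
  exact fun h => hz (by rw [h, zero_smul])

theorem continuous_fderiv_apply {ψ : 𝔼 → ℝ} (hψ : ContDiff ℝ ∞ ψ) (v : 𝔼) :
    Continuous fun z => fderiv ℝ ψ z v :=
  (hψ.continuous_fderiv (by simp)).clm_apply continuous_const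

theorem tsupport_fderiv_apply_subset' (ψ : 𝔼 → ℝ) (v : 𝔼) :
    tsupport (fun z => fderiv ℝ ψ z v) ⊆ tsupport ψ :=
  tsupport_fderiv_apply_subset ℝ v

theorem HasWeakDirDeriv.integrable_fderiv_smul
    {f : EuclideanSpace ℝ (Fin m) → EuclideanSpace ℝ (Fin ν)} (hf : LocallyIntegrableOn f Ω)
    {ψ : 𝔼 → ℝ} (hψ : ContDiff ℝ ∞ ψ) (hc : HasCompactSupport ψ) (hs : tsupport ψ ⊆ Ω) (v : 𝔼) :
    Integrable (fun z => fderiv ℝ ψ z v • f z) :=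
  integrable_smul_of_tsupport_subset hf (continuous_fderiv_apply hψ v)
    (hc.fderiv_apply ℝ v) ((tsupport_fderiv_apply_subset' ψ v).trans hs)

theorem HasWeakDirDeriv.sub {f f' h h' : EuclideanSpace ℝ (Fin m) → EuclideanSpace ℝ (Fin ν)}
    {v : 𝔼} (H : HasWeakDirDeriv Ω f v h)
    (H' : HasWeakDirDeriv Ω f' v h') : HasWeakDirDeriv Ω (f - f') v (h - h') := by
  refine ⟨H.1.sub H'.1, H.2.1.sub H'.2.1, fun ψ hψ hc hs => ?_⟩
  have i1 := HasWeakDirDeriv.integrable_fderiv_smul H.1 hψ hc hs v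
  have i2 := HasWeakDirDeriv.integrable_fderiv_smul H'.1 hψ hc hs v
  have i3 := integrable_smul_of_tsupport_subset H.2.1 hψ.continuous hc hs
  have i4 := integrable_smul_of_tsupport_subset H'.2.1 hψ.continuous hc hs
  simp only [Pi.sub_apply, smul_sub]
  rw [integral_sub i1 i2, integral_sub i3 i4, H.2.2 ψ hψ hc hs, H'.2.2 ψ hψ hc hs]
  abel

/-- Test functions and their derivatives vanish outside Ω, so the difference h - h' integrates to
zero against every test function. The fundamental lemma of the calculus of variations concludes. -/
theorem HasWeakDirDeriv.ae_eq {f f' h h' : EuclideanSpace ℝ (Fin m) → EuclideanSpace ℝ (Fin ν)}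
    {v : 𝔼} (hΩ : IsOpen Ω)
    (H : HasWeakDirDeriv Ω f v h) (H' : HasWeakDirDeriv Ω f' v h')
    (hff : f =ᵐ[volume.restrict Ω] f') : h =ᵐ[volume.restrict Ω] h' := by
  have H2 := H.sub H'
  have hff' : ∀ᵐ z, z ∈ Ω → f z = f' z := by
    rwa [EventuallyEq, ae_restrict_iff' hΩ.measurableSet] at hff
  have h0 := hΩ.ae_eq_zero_of_integral_contDiff_smul_eq_zero H2.2.1 fun ψ hψ hc hs => by
    have := H2.2.2 ψ hψ hc hs
    rw [← neg_eq_zero, ← this]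
    refine integral_eq_zero_of_ae ?_
    filter_upwards [hff'] with z hz
    by_cases hzs : z ∈ Ω
    · simp [hz hzs]
    · have : fderiv ℝ ψ z = 0 := by
        by_contra hne
        exact hzs (hs (support_fderiv_subset ℝ hne))
      simp [this]
  rw [EventuallyEq, ae_restrict_iff' hΩ.measurableSet]
  filter_upwards [h0] with z hz hzs
  exact sub_eq_zero.1 (hz hzs)

/-- Weak derivatives pass to limits in `L¹` on compact sets. -/
theorem HasWeakDirDeriv.of_tendsto {f h : EuclideanSpace ℝ (Fin m) → EuclideanSpace ℝ (Fin ν)}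
    {v : 𝔼} {F H : ℕ → EuclideanSpace ℝ (Fin m) → EuclideanSpace ℝ (Fin ν)}
    (hf : LocallyIntegrableOn f Ω) (hh : LocallyIntegrableOn h Ω)
    (hw : ∀ n, HasWeakDirDeriv Ω (F n) v (H n))
    (hF : ∀ K ⊆ Ω, IsCompact K → Tendsto (fun n => ∫⁻ z in K, ‖F n z - f z‖ₑ) atTop (𝓝 0))
    (hH : ∀ K ⊆ Ω, IsCompact K → Tendsto (fun n => ∫⁻ z in K, ‖H n z - h z‖ₑ) atTop (𝓝 0)) :
    HasWeakDirDeriv Ω f v h := by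
  refine ⟨hf, hh, fun ψ hψ hc hs => ?_⟩
  have key : ∀ (φ : 𝔼 → ℝ), Continuous φ → HasCompactSupport φ → tsupport φ ⊆ Ω →
      ∀ (g : 𝔼 → 𝔽) (G : ℕ → 𝔼 → 𝔽), LocallyIntegrableOn g Ω →
      (∀ n, LocallyIntegrableOn (G n) Ω) →
      (∀ K ⊆ Ω, IsCompact K → Tendsto (fun n => ∫⁻ z in K, ‖G n z - g z‖ₑ) atTop (𝓝 0)) →
      Tendsto (fun n => ∫ z, φ z • G n z) atTop (𝓝 (∫ z, φ z • g z)) := by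
    intro φ hφ hφc hφs g G hg hG hlim
    obtain ⟨B, hB⟩ := hφ.bounded_above_of_compact_support hφc
    refine tendsto_integral_of_L1 _
      (integrable_smul_of_tsupport_subset hg hφ hφc hφs).aestronglyMeasurable
      (Eventually.of_forall fun n => integrable_smul_of_tsupport_subset (hG n) hφ hφc hφs) ?_
    have h0 : Tendsto (fun n => ENNReal.ofReal B * ∫⁻ z in tsupport φ, ‖G n z - g z‖ₑ)
        atTop (𝓝 0) := by
      simpa using ENNReal.Tendsto.const_mul (hlim _ hφs hφc) (Or.inr ENNReal.ofReal_ne_top)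
    refine tendsto_of_tendsto_of_tendsto_of_le_of_le tendsto_const_nhds h0 (fun _ => zero_le)
      fun n => ?_
    rw [← lintegral_const_mul' _ _ ENNReal.ofReal_ne_top, ← lintegral_indicator
      (isClosed_tsupport φ).measurableSet]
    refine lintegral_mono fun z => ?_
    by_cases hz : z ∈ tsupport φ
    · rw [indicator_of_mem hz, ← smul_sub, enorm_smul]
      gcongr
      rw [← ofReal_norm]
      exact ENNReal.ofReal_le_ofReal (hB z)
    · simp [image_eq_zero_of_notMem_tsupport hz]
  have h1 := key _ (continuous_fderiv_apply hψ v) (hc.fderiv_apply ℝ v)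
    ((tsupport_fderiv_apply_subset' ψ v).trans hs) f F hf (fun n => (hw n).1) hF
  have h2 := key ψ hψ.continuous hc hs h H hh (fun n => (hw n).2.1) hH
  refine tendsto_nhds_unique h1 (h2.neg.congr fun n => ?_)
  rw [(hw n).2.2 ψ hψ hc hs]

end WeakDirDeriv

/-! ### Weak covariant derivatives: measurability, uniqueness, closedness. -/

section CovDeriv

variable {m : ℕ} {M : Type*} [EMetricSpace M] [ChartedSpace (EuclideanSpace ℝ (Fin m)) M]

local notation "𝔼" => EuclideanSpace ℝ (Fin m)
local notation "Φ[" c "]" => PartialEquiv.symm (extChartAt (𝓡 m) c)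
local notation "TM" => (TangentSpace (𝓡 m) : M → Type _)

variable [IsManifold (𝓡 m) ∞ M] [RiemannianBundle (fun x : M => TangentSpace (𝓡 m) x)]
  [IsContMDiffRiemannianBundle (𝓡 m) ∞ (EuclideanSpace ℝ (Fin m))
    (fun x : M => TangentSpace (𝓡 m) x)]
  [IsRiemannianManifold (𝓡 m) M] [MeasurableSpace M] [BorelSpace M]

variable {ν k : ℕ}

theorem eq_of_inChart_eq {c : M} {z : 𝔼} (hz : z ∈ (extChartAt (𝓡 m) c).target)
    {T S : TensorField m M ν k}
    (h : ∀ L : Fin k → Fin m, T.inChart c z (fun i => EuclideanSpace.single (L i) 1) =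
      S.inChart c z (fun i => EuclideanSpace.single (L i) 1)) : T (Φ[c] z) = S (Φ[c] z) := by
  ext1 w
  choose v hv using fun i => surjective_paramDeriv hz (w i)
  have h1 : T.inChart c z v = S.inChart c z v := by
    rw [T.inChart_eq_sum, S.inChart_eq_sum]
    simp only [h]
  simpa only [TensorField.inChart, hv] using h1

theorem TensorField.inChart_congr {T S : TensorField m M ν k} {c : M} {z : 𝔼}
    (h : T (Φ[c] z) = S (Φ[c] z)) (v : Fin k → 𝔼) : T.inChart c z v = S.inChart c z v := by
  rw [TensorField.inChart, TensorField.inChart, h]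

theorem TensorField.IsMeas.inChart_comp {T : TensorField m M ν k} (hT : T.IsMeas) (c : M)
    {w : 𝔼 → Fin k → 𝔼} (hw : ContinuousOn w (extChartAt (𝓡 m) c).target) :
    AEStronglyMeasurable (fun z => T.inChart c z (w z))
      (volume.restrict (extChartAt (𝓡 m) c).target) := by
  have h : (fun z => T.inChart c z (w z)) = fun z => ∑ L : Fin k → Fin m, (∏ i, w z i (L i)) •
      T.inChart c z (fun i => EuclideanSpace.single (L i) 1) :=
    funext fun z => T.inChart_eq_sum c z (w z)
  rw [h]
  refine Finset.aestronglyMeasurable_fun_sum _ fun L _ => AEStronglyMeasurable.smul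
    (Finset.aestronglyMeasurable_fun_prod (M := ℝ) _ fun i _ => ?_) ?_
  · refine ContinuousOn.aestronglyMeasurable ?_ (isOpen_target c).measurableSet
    exact (EuclideanSpace.proj (𝕜 := ℝ) (L i)).continuous.comp_continuousOn
      ((continuous_apply i).comp_continuousOn hw)
  · exact hT c _

theorem continuousOn_update_christoffelVec (c : M) (v₀ : 𝔼) (v : Fin k → 𝔼) (r : Fin k) :
    ContinuousOn (fun z => Function.update v r (christoffelVec c z v₀ (v r)))
      (extChartAt (𝓡 m) c).target := by
  refine continuousOn_pi.2 fun i => ?_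
  rcases eq_or_ne i r with rfl | hi
  · simpa only [Function.update_self] using continuousOn_christoffelVec c v₀ (v i)
  · simpa only [Function.update_of_ne hi] using continuousOn_const

theorem IsWeakCovDeriv.isMeas_left {T : TensorField m M ν k} {S : TensorField m M ν (k + 1)}
    (h : IsWeakCovDeriv T S) : T.IsMeas := fun c v => (h c 0 v).1.aestronglyMeasurable

/-- Only the sum of the components of S and the Christoffel terms is known to be measurable. The
Christoffel terms are measurable because T is and their arguments are continuous, so they can be
subtracted. -/
theorem IsWeakCovDeriv.isMeas_right {T : TensorField m M ν k} {S : TensorField m M ν (k + 1)}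
    (h : IsWeakCovDeriv T S) : S.IsMeas := fun c v => by
  have h1 := (h c (v 0) (Fin.tail v)).2.1.aestronglyMeasurable
  have h2 : AEStronglyMeasurable (fun z => ∑ r, T.inChart c z (Function.update (Fin.tail v) r
      (christoffelVec c z (v 0) (Fin.tail v r)))) (volume.restrict (extChartAt (𝓡 m) c).target) :=
    Finset.aestronglyMeasurable_fun_sum _ fun r _ =>
      h.isMeas_left.inChart_comp c (continuousOn_update_christoffelVec c _ _ r)
  refine (h1.sub h2).congr (Eventually.of_forall fun z => ?_)
  simp only [Pi.sub_apply, add_sub_cancel_right, Fin.cons_self_tail]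

theorem IsWeakCovDeriv.sub {T T' : TensorField m M ν k} {S S' : TensorField m M ν (k + 1)}
    (h : IsWeakCovDeriv T S) (h' : IsWeakCovDeriv T' S') : IsWeakCovDeriv (T - T') (S - S') := by
  intro c v₀ v
  convert! (h c v₀ v).sub (h' c v₀ v) using 1
  ext1 z
  simp only [TensorField.inChart_sub, Pi.sub_apply, Finset.sum_sub_distrib]
  abel

theorem zeroTensor_sub (u u' : M → EuclideanSpace ℝ (Fin ν)) :
    zeroTensor (m := m) (u - u') = zeroTensor u - zeroTensor u' := by
  ext x v
  rfl

theorem enorm_zeroTensor (u : M → EuclideanSpace ℝ (Fin ν)) (x : M) :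
    ‖zeroTensor (m := m) u x‖ₑ = ‖u x‖ₑ := by
  rw [← ofReal_norm, ← ofReal_norm, zeroTensor, ContinuousMultilinearMap.norm_constOfIsEmpty]

/-- `D 0, D 1, …, D k` are the successive weak covariant derivatives of `u`. -/
def IsWeakDerivChain (u : M → EuclideanSpace ℝ (Fin ν)) (k : ℕ) (D : ∀ j, TensorField m M ν j) :
    Prop :=
  D 0 = zeroTensor u ∧ ∀ j < k, IsWeakCovDeriv (D j) (D (j + 1))

theorem IsWeakDerivChain.isIter {u : M → EuclideanSpace ℝ (Fin ν)} {k : ℕ}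
    {D : ∀ j, TensorField m M ν j} (h : IsWeakDerivChain u k D) :
    ∀ {j : ℕ}, j ≤ k → IsIterWeakCovDeriv u j (D j)
  | 0, _ => h.1
  | _ + 1, hj => ⟨_, h.isIter (Nat.le_of_succ_le hj), h.2 _ hj⟩

/-- An iterated derivative hides its predecessors behind existential quantifiers. One family
containing all of them is what estimates involving several orders need. -/
theorem IsIterWeakCovDeriv.exists_chain {u : M → EuclideanSpace ℝ (Fin ν)} :
    ∀ {k : ℕ} {T : TensorField m M ν k}, IsIterWeakCovDeriv u k T →
      ∃ D, IsWeakDerivChain u k D ∧ D k = T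
  | 0, T, h => ⟨Function.update (fun _ => 0) 0 T, ⟨by
      rw [Function.update_self]; exact h, fun j hj => absurd hj (Nat.not_lt_zero j)⟩,
      by simp⟩
  | k + 1, S, h => by
    obtain ⟨T, hT, hS⟩ := h
    obtain ⟨D, ⟨hD0, hD⟩, rfl⟩ := hT.exists_chain
    refine ⟨Function.update D (k + 1) S, ⟨?_, fun j hj => ?_⟩, by simp⟩
    · rw [Function.update_of_ne (by omega), hD0]
    · rcases Nat.lt_succ_iff_lt_or_eq.1 hj with hj | rfl
      · rw [Function.update_of_ne (by omega), Function.update_of_ne (by omega)]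
        exact hD j hj
      · rw [Function.update_of_ne (by omega), Function.update_self]
        exact hS

theorem isMeas_zeroTensor [CompactSpace M] {u : M → EuclideanSpace ℝ (Fin ν)}
    (hu : AEStronglyMeasurable u (riemVol m M)) : (zeroTensor (m := m) u).IsMeas := fun c v => by
  have hΦ : AEMeasurable Φ[c] (volume.restrict (extChartAt (𝓡 m) c).target) :=
    (continuousOn_extChartAt_symm c).aemeasurable (isOpen_target c).measurableSet
  refine (hu.stronglyMeasurable_mk.measurable.comp_aemeasurable
    hΦ).aestronglyMeasurable.congr ?_
  filter_upwards [ae_chart_of_ae hu.ae_eq_mk c] with z hz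
  exact hz.symm

theorem IsWeakDerivChain.isMeas [CompactSpace M] {u : M → EuclideanSpace ℝ (Fin ν)} {k : ℕ}
    {D : ∀ j, TensorField m M ν j} (h : IsWeakDerivChain u k D)
    (hu : AEStronglyMeasurable u (riemVol m M)) : ∀ {j : ℕ}, j ≤ k → (D j).IsMeas
  | 0, _ => by rw [h.1]; exact isMeas_zeroTensor hu
  | _ + 1, hj => (h.2 _ hj).isMeas_right

/-- In each chart the Christoffel terms agree where T = T', so uniqueness of weak directional
derivatives gives equality of all components. -/
theorem IsWeakCovDeriv.ae_eq [CompactSpace M] {T T' : TensorField m M ν k}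
    {S S' : TensorField m M ν (k + 1)}
    (h : IsWeakCovDeriv T S) (h' : IsWeakCovDeriv T' S')
    (hTT : ∀ᵐ x ∂(riemVol m M), T x = T' x) : ∀ᵐ x ∂(riemVol m M), S x = S' x := by
  refine ae_of_forall_chart fun c => ?_
  have hc := ae_chart_of_ae hTT c
  have h1 : ∀ L : Fin (k + 1) → Fin m, ∀ᵐ z ∂(volume.restrict (extChartAt (𝓡 m) c).target),
      S.inChart c z (fun i => EuclideanSpace.single (L i) 1) =
      S'.inChart c z (fun i => EuclideanSpace.single (L i) 1) := fun L => by
    set v : Fin (k + 1) → 𝔼 := fun i => EuclideanSpace.single (L i) 1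
    have h2 := (h c (v 0) (Fin.tail v)).ae_eq (isOpen_target c) (h' c (v 0) (Fin.tail v))
      (hc.mono fun z hz => TensorField.inChart_congr hz _)
    filter_upwards [h2, hc] with z hz hz'
    simp only [TensorField.inChart_congr hz', Fin.cons_self_tail, add_left_inj] at hz
    exact hz
  filter_upwards [ae_all_iff.2 h1, ae_restrict_mem (isOpen_target c).measurableSet] with z hz hz'
  exact eq_of_inChart_eq hz' hz

theorem IsIterWeakCovDeriv.ae_eq [CompactSpace M] {u : M → EuclideanSpace ℝ (Fin ν)} :
    ∀ {k : ℕ} {T T' : TensorField m M ν k}, IsIterWeakCovDeriv u k T →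
      IsIterWeakCovDeriv u k T' → ∀ᵐ x ∂(riemVol m M), T x = T' x
  | 0, T, T', h, h' => by
    rw [IsIterWeakCovDeriv] at h h'
    rw [h, h']
    exact Eventually.of_forall fun _ => rfl
  | k + 1, S, S', h, h' => by
    obtain ⟨T, hT, hS⟩ := h
    obtain ⟨T', hT', hS'⟩ := h'
    exact hS.ae_eq hS' (hT.ae_eq hT')

theorem isIter_weakDeriv {u : M → EuclideanSpace ℝ (Fin ν)} {k : ℕ} {T : TensorField m M ν k}
    (h : IsIterWeakCovDeriv u k T) : IsIterWeakCovDeriv u k (weakDeriv (m := m) k u) := by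
  have hex : ∃ T : TensorField m M ν k, IsIterWeakCovDeriv u k T := ⟨T, h⟩
  rw [weakDeriv, dif_pos hex]
  exact hex.choose_spec

/-- The values of `weakDeriv` at different orders are chosen independently. Almost everywhere
uniqueness allows their replacement by the members of a single chain. -/
theorem weakDeriv_ae_eq [CompactSpace M] {u : M → EuclideanSpace ℝ (Fin ν)} {k : ℕ}
    {T : TensorField m M ν k} (h : IsIterWeakCovDeriv u k T) :
    ∀ᵐ x ∂(riemVol m M), weakDeriv (m := m) k u x = T x :=
  (isIter_weakDeriv h).ae_eq h

/-! ### Integrals over compact subsets of charts -/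

/-- Induction on compact sets from good balls, the bounds being stable under subsets and finite
unions. -/
theorem exists_bound_compact (c : M) {K : Set 𝔼} (hK : IsCompact K)
    (hKt : K ⊆ (extChartAt (𝓡 m) c).target) :
    ∃ C : ℝ≥0, (∀ z ∈ K, (∀ v : 𝔼, ‖paramDeriv c z v‖ ≤ C * ‖v‖) ∧
        ∀ v w : 𝔼, ‖christoffelVec c z v w‖ ≤ C * ‖v‖ * ‖w‖) ∧
      ∀ g : M → ℝ≥0∞, AEMeasurable g (riemVol m M) →
        ∫⁻ z in K, g (Φ[c] z) ≤ C * ∫⁻ x, g x ∂(riemVol m M) := by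
  refine IsCompact.induction_on (p := fun K : Set 𝔼 =>
    ∃ C : ℝ≥0, (∀ z ∈ K, (∀ v : 𝔼, ‖paramDeriv c z v‖ ≤ C * ‖v‖) ∧
        ∀ v w : 𝔼, ‖christoffelVec c z v w‖ ≤ C * ‖v‖ * ‖w‖) ∧
      ∀ g : M → ℝ≥0∞, AEMeasurable g (riemVol m M) →
        ∫⁻ z in K, g (Φ[c] z) ≤ C * ∫⁻ x, g x ∂(riemVol m M)) hK ?_ ?_ ?_ ?_
  · exact ⟨0, by simp, by simp⟩
  · rintro s t hst ⟨C, h1, h2⟩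
    exact ⟨C, fun z hz => h1 z (hst hz), fun g hg =>
      (lintegral_mono_set hst).trans (h2 g hg)⟩
  · rintro s t ⟨C, h1, h2⟩ ⟨C', h1', h2'⟩
    refine ⟨C + C', ?_, fun g hg => ?_⟩
    · rintro z (hz | hz)
      · refine ⟨fun v => ((h1 z hz).1 v).trans ?_, fun v w => ((h1 z hz).2 v w).trans ?_⟩ <;>
        · gcongr; simp
      · refine ⟨fun v => ((h1' z hz).1 v).trans ?_, fun v w => ((h1' z hz).2 v w).trans ?_⟩ <;>
        · gcongr; simp
    · refine (lintegral_union_le _ _ _).trans ?_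
      rw [ENNReal.coe_add, add_mul]
      exact add_le_add (h2 g hg) (h2' g hg)
  · intro z hz
    obtain ⟨R, C, hR⟩ := exists_isGoodBall (m := m) (hKt hz)
    have hC1 : (1 : ℝ) ≤ C := by exact_mod_cast hR.one_le
    -- The summand C bounds the frame and the Christoffel symbols, the summand Cᵐ the change of
    -- measure.
    refine ⟨_, mem_nhdsWithin_of_mem_nhds (closedBall_mem_nhds _ hR.pos), C + C ^ m,
      fun z hz => ⟨fun v => (hR.norm_le z hz v).trans ?_,
        fun v w => (hR.christoffel_le z hz v w).trans ?_⟩, fun g hg => ?_⟩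
    · gcongr; simp
    · gcongr; simp
    · refine (hR.lintegral_symm_le hg).trans ?_
      gcongr
      push_cast
      exact le_add_self

theorem norm_inChart_le_of_bound (T : TensorField m M ν k) {c : M} {z : 𝔼} {C : ℝ≥0}
    (hC : ∀ v : 𝔼, ‖paramDeriv c z v‖ ≤ C * ‖v‖) {B : ℝ≥0} {v : Fin k → 𝔼}
    (hv : ∀ i, ‖v i‖ ≤ B) : ‖T.inChart c z v‖ₑ ≤ ((C * B) ^ k : ℝ≥0) * ‖T (Φ[c] z)‖ₑ := by
  have h : ‖T.inChart c z v‖ ≤ ‖T (Φ[c] z)‖ * (C * B) ^ k := by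
    have := (T (Φ[c] z)).le_opNorm_mul_prod_of_le (m := fun i => paramDeriv c z (v i))
      (b := fun _ => (C * B : ℝ)) fun i => (hC (v i)).trans (by gcongr; exact hv i)
    rw [Finset.prod_const, Finset.card_univ, Fintype.card_fin] at this
    exact this
  rw [mul_comm] at h
  rw [← ofReal_norm, ← ofReal_norm, ← ENNReal.ofReal_coe_nnreal,
    ← ENNReal.ofReal_mul (by positivity)]
  exact ENNReal.ofReal_le_ofReal (by push_cast; exact h)

variable (m) in
/-- `∫_M |T|^p`. -/
def energy (p : ℝ) (T : TensorField m M ν k) : ℝ≥0∞ := ∫⁻ x, ‖T x‖ₑ ^ p ∂(riemVol m M)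

variable [CompactSpace M]

/-- `L¹` norms on compact subsets of charts are controlled by the `Lᵖ` norm. -/
theorem exists_lintegral_inChart_le (c : M) {K : Set 𝔼} (hK : IsCompact K)
    (hKt : K ⊆ (extChartAt (𝓡 m) c).target) {p : ℝ} (hp : 1 ≤ p) (B : ℝ≥0) (k : ℕ) :
    ∃ A : ℝ≥0, ∀ (T : TensorField m M ν k) (v : 𝔼 → Fin k → 𝔼), T.IsMeas →
      (∀ z ∈ K, ∀ i, ‖v z i‖ ≤ B) →
      ∫⁻ z in K, ‖T.inChart c z (v z)‖ₑ ≤ A * energy m p T ^ (1 / p) := by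
  obtain ⟨C, hC, hI⟩ := exists_bound_compact c hK hKt
  have := isFiniteMeasure_riemVol (m := m) (M := M)
  set Λ : ℝ≥0∞ := ((C * B) ^ k : ℝ≥0) * C * (riemVol m M univ ^ (p - 1)) ^ (1 / p) with hΛ
  have hΛt : Λ ≠ ⊤ := by
    have h1 : riemVol m M univ ^ (p - 1) ≠ ⊤ :=
      ENNReal.rpow_ne_top_of_nonneg (by linarith) (measure_ne_top _ _)
    have h2 : (riemVol m M univ ^ (p - 1)) ^ (1 / p) ≠ ⊤ :=
      ENNReal.rpow_ne_top_of_nonneg (by positivity) h1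
    exact ENNReal.mul_ne_top (ENNReal.mul_ne_top ENNReal.coe_ne_top ENNReal.coe_ne_top) h2
  refine ⟨Λ.toNNReal, fun T v hT hv => ?_⟩
  rw [ENNReal.coe_toNNReal hΛt]
  calc ∫⁻ z in K, ‖T.inChart c z (v z)‖ₑ
      ≤ ∫⁻ z in K, ((C * B) ^ k : ℝ≥0) * ‖T (Φ[c] z)‖ₑ :=
        setLIntegral_mono' hK.measurableSet fun z hz =>
          norm_inChart_le_of_bound T (hC z hz).1 (hv z hz)
    _ = ((C * B) ^ k : ℝ≥0) * ∫⁻ z in K, ‖T (Φ[c] z)‖ₑ :=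
        lintegral_const_mul' _ _ ENNReal.coe_ne_top
    _ ≤ ((C * B) ^ k : ℝ≥0) * (C * ∫⁻ x, ‖T x‖ₑ ∂(riemVol m M)) := by
        gcongr
        exact hI _ hT.aemeasurable_enorm
    _ ≤ ((C * B) ^ k : ℝ≥0) * (C * ((riemVol m M univ ^ (p - 1) * energy m p T) ^ (1 / p))) := by
        gcongr
        rw [one_div, ENNReal.le_rpow_inv_iff (by linarith)]
        exact rpow_lintegral_le hp hT.aemeasurable_enorm
    _ = Λ * energy m p T ^ (1 / p) := by
        rw [ENNReal.mul_rpow_of_nonneg _ _ (by positivity), hΛ]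
        ring

/-- The argument vectors `w` may vary with the point because Christoffel vectors do. -/
theorem locallyIntegrableOn_inChart {p : ℝ} (hp : 1 ≤ p) {T : TensorField m M ν k} (hT : T.IsMeas)
    (hTp : energy m p T < ⊤) (c : M) {w : 𝔼 → Fin k → 𝔼}
    (hw : ContinuousOn w (extChartAt (𝓡 m) c).target) :
    LocallyIntegrableOn (fun z => T.inChart c z (w z)) (extChartAt (𝓡 m) c).target := by
  rw [locallyIntegrableOn_iff (isOpen_target c).isLocallyClosed]
  intro K hKt hK
  obtain ⟨B, hB⟩ := hK.exists_bound_of_continuousOn (hw.mono hKt)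
  obtain ⟨A, hA⟩ := exists_lintegral_inChart_le (ν := ν) c hK hKt hp B.toNNReal k
  refine ⟨(hT.inChart_comp c hw).mono_set hKt, ?_⟩
  refine (hA T w hT fun z hz i => ?_).trans_lt ?_
  · exact (norm_le_pi_norm _ i).trans ((hB z hz).trans (Real.le_coe_toNNReal B))
  · exact ENNReal.mul_lt_top ENNReal.coe_lt_top
      (ENNReal.rpow_lt_top_of_nonneg (by positivity) hTp.ne)

/-- Weak covariant derivatives pass to `Lᵖ` limits. -/
theorem IsWeakCovDeriv.of_tendsto {p : ℝ} (hp : 1 ≤ p) {T : TensorField m M ν k}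
    {S : TensorField m M ν (k + 1)} {Tn : ℕ → TensorField m M ν k}
    {Sn : ℕ → TensorField m M ν (k + 1)} (h : ∀ n, IsWeakCovDeriv (Tn n) (Sn n))
    (hT : T.IsMeas) (hS : S.IsMeas) (hTp : energy m p T < ⊤) (hSp : energy m p S < ⊤)
    (hTn : Tendsto (fun n => energy m p (Tn n - T)) atTop (𝓝 0))
    (hSn : Tendsto (fun n => energy m p (Sn n - S)) atTop (𝓝 0)) : IsWeakCovDeriv T S := by
  intro c v₀ v
  have hup := fun r => continuousOn_update_christoffelVec c v₀ v r
  have hlT := fun r => locallyIntegrableOn_inChart hp hT hTp c (hup r)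
  -- Lᵖ convergence on M gives L¹ convergence of components on compact subsets of the chart, also
  -- for components along continuous vector fields. It is applied to the derivatives and to every
  -- Christoffel term.
  have hlim0 : ∀ {q : ℕ} {G : TensorField m M ν q} {Gn : ℕ → TensorField m M ν q} {w : 𝔼 → Fin q → 𝔼},
      ContinuousOn w (extChartAt (𝓡 m) c).target → G.IsMeas → (∀ n, (Gn n).IsMeas) →
      Tendsto (fun n => energy m p (Gn n - G)) atTop (𝓝 0) →
      ∀ K ⊆ (extChartAt (𝓡 m) c).target, IsCompact K →
      Tendsto (fun n => ∫⁻ z in K, ‖(Gn n - G).inChart c z (w z)‖ₑ) atTop (𝓝 0) := by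
    intro q G Gn w hw hG hGn hlim K hKt hK
    obtain ⟨B, hB⟩ := hK.exists_bound_of_continuousOn (hw.mono hKt)
    obtain ⟨A, hA⟩ := exists_lintegral_inChart_le (ν := ν) c hK hKt hp B.toNNReal q
    have h0 : Tendsto (fun n => (A : ℝ≥0∞) * energy m p (Gn n - G) ^ (1 / p)) atTop (𝓝 0) := by
      have h1 := (ENNReal.continuous_rpow_const (y := 1 / p)).tendsto 0 |>.comp hlim
      rw [ENNReal.zero_rpow_of_pos (by positivity)] at h1
      simpa using ENNReal.Tendsto.const_mul h1 (Or.inr (ENNReal.coe_ne_top (r := A)))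
    refine tendsto_of_tendsto_of_tendsto_of_le_of_le tendsto_const_nhds h0 (fun _ => zero_le)
      fun n => hA _ w ((hGn n).sub hG) fun z hz i =>
        (norm_le_pi_norm _ i).trans ((hB z hz).trans (Real.le_coe_toNNReal B))
  refine HasWeakDirDeriv.of_tendsto (F := fun n z => (Tn n).inChart c z v)
    (H := fun n z => (Sn n).inChart c z (Fin.cons v₀ v) +
        ∑ r, (Tn n).inChart c z (Function.update v r (christoffelVec c z v₀ (v r)))) ?_ ?_
    (fun n => h n c v₀ v) ?_ ?_
  · exact locallyIntegrableOn_inChart hp hT hTp c continuousOn_const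
  · refine (locallyIntegrableOn_inChart hp hS hSp c (w := fun _ => Fin.cons v₀ v)
      continuousOn_const).add ?_
    rw [locallyIntegrableOn_iff (isOpen_target c).isLocallyClosed]
    exact fun K hKt hK => integrable_finsetSum _ fun r _ =>
      (hlT r).integrableOn_compact_subset hKt hK
  · exact hlim0 (w := fun _ => v) continuousOn_const hT (fun n => (h n).isMeas_left) hTn
  · intro K hKt hK
    have h1 := hlim0 (w := fun _ => Fin.cons v₀ v) continuousOn_const hS
      (fun n => (h n).isMeas_right) hSn K hKt hK
    have h2 := tendsto_finsetSum Finset.univ fun r _ =>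
      hlim0 (hup r) hT (fun n => (h n).isMeas_left) hTn K hKt hK
    have h3 := h1.add h2
    simp only [Finset.sum_const_zero, add_zero] at h3
    refine tendsto_of_tendsto_of_tendsto_of_le_of_le tendsto_const_nhds h3 (fun _ => zero_le)
      fun n => ?_
    have hm : ∀ r, AEMeasurable (fun z => ‖(Tn n - T).inChart c z
        (Function.update v r (christoffelVec c z v₀ (v r)))‖ₑ) (volume.restrict K) := fun r =>
      (((h n).isMeas_left.sub hT).inChart_comp c (hup r)).enorm.mono_set hKt
    dsimp only
    rw [← lintegral_finsetSum' _ fun r _ => hm r,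
      ← lintegral_add_right' _ (Finset.aemeasurable_fun_sum _ fun r _ => hm r)]
    refine lintegral_mono fun z => ?_
    have h4 : (Sn n).inChart c z (Fin.cons v₀ v) +
        ∑ r, (Tn n).inChart c z (Function.update v r (christoffelVec c z v₀ (v r))) -
        (S.inChart c z (Fin.cons v₀ v) +
        ∑ r, T.inChart c z (Function.update v r (christoffelVec c z v₀ (v r)))) =
        (Sn n - S).inChart c z (Fin.cons v₀ v) +
        ∑ r, (Tn n - T).inChart c z (Function.update v r (christoffelVec c z v₀ (v r))) := by
      simp only [TensorField.inChart_sub, Finset.sum_sub_distrib]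
      abel
    rw [h4]
    exact (enorm_add_le _ _).trans (add_le_add le_rfl (enorm_sum_le _ _))

end CovDeriv

/-! ### Increments of a function with a weak derivative along segments. -/

section Translation

variable {m ν : ℕ} {Ω : Set (EuclideanSpace ℝ (Fin m))}

local notation "𝔼" => EuclideanSpace ℝ (Fin m)
local notation "𝔽" => EuclideanSpace ℝ (Fin ν)

/-- The restriction of the Lebesgue measure to `[0, 1]`. -/
abbrev unitMeasure : Measure ℝ := volume.restrict (Icc (0 : ℝ) 1)

instance : IsProbabilityMeasure unitMeasure := ⟨by simp⟩

/-- For each fixed t the map is a translation, and the parameter t runs through a probability space.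
-/
theorem measurePreserving_shear (h : EuclideanSpace ℝ (Fin m)) :
    MeasurePreserving (fun q : 𝔼 × ℝ => q.1 - q.2 • h) (volume.prod unitMeasure) volume := by
  have h1 : MeasurePreserving (fun q : ℝ × 𝔼 => (q.1, q.2 - q.1 • h))
      (unitMeasure.prod volume) (unitMeasure.prod volume) := by
    refine (MeasurePreserving.id _).skew_product (g := fun t z => z - t • h)
      (by unfold Function.uncurry; fun_prop) (Eventually.of_forall fun t => ?_)
    exact (measurePreserving_sub_right volume (t • h)).map_eq
  have h2 : MeasurePreserving (Prod.snd : ℝ × 𝔼 → 𝔼) (unitMeasure.prod volume) volume :=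
    measurePreserving_snd
  exact h2.comp (h1.comp Measure.measurePreserving_swap)

theorem hasDerivAt_comp_line {ψ : EuclideanSpace ℝ (Fin m) → ℝ} (hψ : ContDiff ℝ ∞ ψ) (z h : 𝔼)
    (t : ℝ) : HasDerivAt (fun t : ℝ => ψ (z + t • h)) (fderiv ℝ ψ (z + t • h) h) t := by
  have h1 : HasDerivAt (fun t : ℝ => z + t • h) h t := by
    simpa using ((hasDerivAt_id t).smul_const h).const_add z
  exact ((hψ.differentiable (by simp) _).hasFDerivAt).comp_hasDerivAt t h1

/-- The fundamental theorem of calculus along almost every segment parallel to `h`, for a function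
that has a weak derivative in the direction `h`. -/
theorem HasWeakDirDeriv.ae_sub_eq_integral
    {f g : EuclideanSpace ℝ (Fin m) → EuclideanSpace ℝ (Fin ν)} {h : 𝔼}
    (H : HasWeakDirDeriv Ω f h g) {U K : Set 𝔼} (hU : IsOpen U) (hK : IsCompact K) (hKΩ : K ⊆ Ω)
    (hUK : ∀ z ∈ U, ∀ t ∈ Icc (0 : ℝ) 1, z - t • h ∈ K) :
    ∀ᵐ z, z ∈ U → f z - f (z - h) = ∫ t, K.indicator g (z - t • h) ∂unitMeasure := by
  -- Cutting off to K makes both functions integrable on the whole space. It is not seen from U,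
  -- since the segments starting in U stay in K.
  set F := K.indicator f with hF
  set G := K.indicator g with hG
  have iF : Integrable F :=
    (H.1.integrableOn_compact_subset hKΩ hK).integrable_indicator hK.measurableSet
  have iG : Integrable G :=
    (H.2.1.integrableOn_compact_subset hKΩ hK).integrable_indicator hK.measurableSet
  have iFh : Integrable fun z => F (z - h) := iF.comp_sub_right h
  have hτ := measurePreserving_shear h
  have iGτ : Integrable (fun q : 𝔼 × ℝ => G (q.1 - q.2 • h)) (volume.prod unitMeasure) :=
    (hτ.integrable_comp iG.aestronglyMeasurable).2 iG
  have iI : Integrable fun z => ∫ t, G (z - t • h) ∂unitMeasure := iGτ.integral_prod_left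
  have key := hU.ae_eq_zero_of_integral_contDiff_smul_eq_zero
    (f := fun z => F z - F (z - h) - ∫ t, G (z - t • h) ∂unitMeasure) (μ := volume)
    (((iF.sub iFh).sub iI).locallyIntegrable.locallyIntegrableOn U) fun ψ hψ hc hs => ?_
  · filter_upwards [key] with z hz hzU
    have h0 := hUK z hzU 0 (by simp)
    have h1 := hUK z hzU 1 (by simp)
    rw [zero_smul, sub_zero] at h0
    rw [one_smul] at h1
    have h2 := sub_eq_zero.1 (hz hzU)
    rwa [hF, indicator_of_mem h0, indicator_of_mem h1] at h2
  obtain ⟨B, hB⟩ := hψ.continuous.bounded_above_of_compact_support hc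
  have hψF : ∀ {X : 𝔼 → 𝔽}, Integrable X → Integrable fun z => ψ z • X z := fun hX =>
    hX.bdd_smul B hψ.continuous.aestronglyMeasurable (Eventually.of_forall hB)
  set dψ : 𝔼 → ℝ := fun z => fderiv ℝ ψ z h with hdψ
  have hdc : Continuous dψ := continuous_fderiv_apply hψ h
  obtain ⟨B', hB'⟩ := hdc.bounded_above_of_compact_support (hc.fderiv_apply ℝ h)
  have hψt : ∀ t ∈ Icc (0 : ℝ) 1, ∀ z, z ∉ K → ψ (z + t • h) = 0 := fun t ht z hz => by
    by_contra hne
    exact hz (by simpa using hUK _ (hs (subset_tsupport ψ hne)) t ht)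
  have hts : ∀ t : ℝ, tsupport (fun z => ψ (z + t • h)) = (fun z => z + t • h) ⁻¹' tsupport ψ :=
    fun t => tsupport_comp_eq_preimage ψ (Homeomorph.addRight (t • h))
  -- The translate ψ(· + t h) is an admissible test function: its support is carried into K ⊆ Ω.
  have hweak : ∀ t ∈ Icc (0 : ℝ) 1,
      ∫ z, ψ z • G (z - t • h) = -∫ z, dψ (z + t • h) • F z := fun t ht => by
    have h1 := H.2.2 (fun z => ψ (z + t • h)) (hψ.comp (contDiff_id.add contDiff_const))
      (hc.comp_homeomorph (Homeomorph.addRight (t • h))) (by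
        rw [hts]
        intro z hz
        simpa using hKΩ (hUK _ (hs hz) t ht))
    have h2 : ∀ z, fderiv ℝ (fun z => ψ (z + t • h)) z h = dψ (z + t • h) := fun z => by
      rw [fderiv_comp_add_right]
    simp only [h2] at h1
    have h3 : ∀ z, dψ (z + t • h) • f z = dψ (z + t • h) • F z := fun z => by
      by_cases hz : z ∈ K
      · rw [hF, indicator_of_mem hz]
      · have : dψ (z + t • h) = 0 := by
          by_contra hne
          have := hUK _ (hs (tsupport_fderiv_apply_subset' ψ h (subset_tsupport _ hne))) t ht
          exact hz (by simpa using this)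
        rw [this, zero_smul, zero_smul]
    have h4 : ∀ z, ψ (z + t • h) • g z = ψ (z + t • h) • G z := fun z => by
      by_cases hz : z ∈ K
      · rw [hG, indicator_of_mem hz]
      · rw [hψt t ht z hz, zero_smul, zero_smul]
    simp only [h3, h4] at h1
    rw [h1, neg_neg, ← integral_sub_right_eq_self (fun z => ψ (z + t • h) • G z) (t • h)]
    simp only [sub_add_cancel]
  have iψG : Integrable (Function.uncurry fun (z : 𝔼) (t : ℝ) => ψ z • G (z - t • h))
      (volume.prod unitMeasure) :=
    iGτ.bdd_smul B (hψ.continuous.comp continuous_fst).aestronglyMeasurable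
      (Eventually.of_forall fun q => hB q.1)
  have iψF : Integrable (Function.uncurry fun (t : ℝ) (z : 𝔼) => dψ (z + t • h) • F z)
      (unitMeasure.prod volume) :=
    (iF.comp_snd unitMeasure).bdd_smul B' (hdc.comp (by fun_prop)).aestronglyMeasurable
      (Eventually.of_forall fun q => hB' _)
  have hFTC : ∀ z, ∫ t, dψ (z + t • h) ∂unitMeasure = ψ (z + h) - ψ z := fun z => by
    have h1 := intervalIntegral.integral_eq_sub_of_hasDerivAt (a := 0) (b := 1)
      (fun t _ => hasDerivAt_comp_line hψ z h t)
      (Continuous.intervalIntegrable (hdc.comp (by fun_prop : Continuous fun t : ℝ => z + t • h)) _ _)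
    rw [intervalIntegral.integral_of_le zero_le_one, ← integral_Icc_eq_integral_Ioc] at h1
    simpa using h1
  -- After Fubini, integrating the derivative of ψ along the segment in t leaves ψ(z + h) - ψ(z).
  -- Thus the identity holds when tested against every ψ.
  have e1 : ∫ z, ψ z • ∫ t, G (z - t • h) ∂unitMeasure =
      (∫ z, ψ z • F z) - ∫ z, ψ (z + h) • F z := by
    calc ∫ z, ψ z • ∫ t, G (z - t • h) ∂unitMeasure
        = ∫ z, ∫ t, ψ z • G (z - t • h) ∂unitMeasure := by simp only [integral_smul]
      _ = ∫ t, (∫ z, ψ z • G (z - t • h)) ∂unitMeasure := integral_integral_swap iψG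
      _ = ∫ t, -(∫ z, dψ (z + t • h) • F z) ∂unitMeasure :=
          setIntegral_congr_fun measurableSet_Icc hweak
      _ = -∫ z, ∫ t, dψ (z + t • h) • F z ∂unitMeasure := by
          rw [integral_neg, integral_integral_swap iψF]
      _ = -∫ z, (ψ (z + h) - ψ z) • F z := by simp only [integral_smul_const, hFTC]
      _ = _ := by
          simp only [sub_smul]
          rw [integral_sub, neg_sub]
          · exact iF.bdd_smul B (hψ.continuous.comp (by fun_prop)).aestronglyMeasurable
              (Eventually.of_forall fun q => hB _)
          · exact hψF iF
  have e2 : ∫ z, ψ z • F (z - h) = ∫ z, ψ (z + h) • F z := by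
    rw [← integral_sub_right_eq_self (fun z => ψ (z + h) • F z) h]
    simp only [sub_add_cancel]
  have i1 : Integrable fun z => ψ z • F z - ψ z • F (z - h) := (hψF iF).sub (hψF iFh)
  simp only [smul_sub]
  rw [integral_sub i1 (hψF iI), integral_sub (hψF iF) (hψF iFh), e1, e2,
    sub_self]

/-- The increments of a function are controlled by its weak derivative. -/
theorem HasWeakDirDeriv.lintegral_sub_rpow_le
    {f g : EuclideanSpace ℝ (Fin m) → EuclideanSpace ℝ (Fin ν)} {h : 𝔼}
    (H : HasWeakDirDeriv Ω f h g) {U K : Set 𝔼} (hU : IsOpen U) (hK : IsCompact K) (hKΩ : K ⊆ Ω)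
    (hUK : ∀ z ∈ U, ∀ t ∈ Icc (0 : ℝ) 1, z - t • h ∈ K) {p : ℝ} (hp : 1 ≤ p) :
    ∫⁻ z in U, ‖f z - f (z - h)‖ₑ ^ p ≤ ∫⁻ z in K, ‖g z‖ₑ ^ p := by
  have iG : Integrable (K.indicator g) :=
    (H.2.1.integrableOn_compact_subset hKΩ hK).integrable_indicator hK.measurableSet
  have hτ := measurePreserving_shear h
  have hm : AEStronglyMeasurable (fun q : 𝔼 × ℝ => K.indicator g (q.1 - q.2 • h))
      (volume.prod unitMeasure) :=
    iG.aestronglyMeasurable.comp_measurePreserving hτ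
  calc ∫⁻ z in U, ‖f z - f (z - h)‖ₑ ^ p
      ≤ ∫⁻ z, ∫⁻ t, ‖K.indicator g (z - t • h)‖ₑ ^ p ∂unitMeasure := by
        -- Jensen's inequality on the segment; the shear then removes the average over t.
        refine (setLIntegral_mono_ae' hU.measurableSet ?_).trans (setLIntegral_le_lintegral U _)
        filter_upwards [H.ae_sub_eq_integral hU hK hKΩ hUK, hm.prodMk_left] with z hz hz' hzU
        rw [hz hzU]
        simpa using enorm_integral_rpow_le hp hz'
    _ = ∫⁻ q, ‖K.indicator g (q.1 - q.2 • h)‖ₑ ^ p ∂(volume.prod unitMeasure) :=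
        (lintegral_prod _ (hm.enorm.pow_const p)).symm
    _ = ∫⁻ z, ‖K.indicator g z‖ₑ ^ p := by
        have h1 : AEMeasurable (fun z => ‖K.indicator g z‖ₑ ^ p)
            (Measure.map (fun q : 𝔼 × ℝ => q.1 - q.2 • h) (volume.prod unitMeasure)) := by
          rw [hτ.map_eq]
          exact iG.aestronglyMeasurable.enorm.pow_const p
        rw [← lintegral_map' h1 hτ.aemeasurable, hτ.map_eq]
    _ = ∫⁻ z in K, ‖g z‖ₑ ^ p := by
        rw [← lintegral_indicator hK.measurableSet]
        refine lintegral_congr fun z => ?_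
        by_cases hz : z ∈ K
        · simp [hz]
        · simp [hz, ENNReal.zero_rpow_of_pos (by linarith : 0 < p)]

end Translation

/-! ### Mollification of functions and of weak covariant derivatives. -/

section Mollify

variable {m ν : ℕ}

local notation "𝔼" => EuclideanSpace ℝ (Fin m)
local notation "𝔽" => EuclideanSpace ℝ (Fin ν)

variable (m) in
-- The essential point is that C does not depend on δ. This is why the constant in front of the
-- Gagliardo energy will not depend on the width of the neighbourhood of the diagonal.
theorem exists_mollifier : ∃ C : ℝ, 0 ≤ C ∧ ∀ δ > 0, ∃ φ : 𝔼 → ℝ, ContDiff ℝ ∞ φ ∧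
    (∀ x, 0 ≤ φ x) ∧ tsupport φ ⊆ closedBall 0 δ ∧ ∫ x, φ x = 1 ∧ ∀ x, φ x ≤ C / δ ^ m := by
  -- The ratio 2 of the outer and inner radii of the bump gives the factor 2ᵐ.
  refine ⟨2 ^ m / (volume : Measure 𝔼).real (ball 0 1), by positivity, fun δ hδ => ?_⟩
  let b : ContDiffBump (0 : 𝔼) := ⟨δ / 2, δ, by linarith, by linarith⟩
  refine ⟨b.normed volume, b.contDiff_normed, b.nonneg_normed, b.tsupport_normed_eq.le,
    b.integral_normed, fun x => ?_⟩
  refine (b.normed_le_div_measure_closedBall_rOut volume 2 ?_ x).trans (le_of_eq ?_)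
  · show δ ≤ 2 * (δ / 2); linarith
  · rw [Measure.addHaar_real_closedBall _ _ b.rOut_pos.le, finrank_euclideanSpace,
      Fintype.card_fin, div_div, mul_comm (δ ^ m)]

theorem enorm_integral_smul_le {ψ : EuclideanSpace ℝ (Fin m) → ℝ} {B : ℝ≥0} {K : Set 𝔼}
    (hK : MeasurableSet K) (hB : ∀ z, ‖ψ z‖ ≤ B) (hψ : ∀ z, z ∉ K → ψ z = 0) (f : 𝔼 → 𝔽) :
    ‖∫ z, ψ z • f z‖ₑ ≤ B * ∫⁻ z in K, ‖f z‖ₑ := by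
  refine (enorm_integral_le_lintegral_enorm _).trans ?_
  rw [← lintegral_const_mul' _ _ ENNReal.coe_ne_top, ← lintegral_indicator hK]
  refine lintegral_mono fun z => ?_
  by_cases hz : z ∈ K
  · rw [indicator_of_mem hz, enorm_smul]
    gcongr
    rw [← ofReal_norm, ← ENNReal.ofReal_coe_nnreal]
    exact ENNReal.ofReal_le_ofReal (hB z)
  · simp [hψ z hz]

/-- As φ(z - ·) has mass one, f(z) is the mean of f(z) - f(w) plus the mollification of f at z.
Jensen's inequality for this probability density bounds the first part. -/
theorem enorm_rpow_le_mollify {φ : EuclideanSpace ℝ (Fin m) → ℝ} (hφ : Continuous φ)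
    (h0 : ∀ x, 0 ≤ φ x) {δ : ℝ}
    (hs : tsupport φ ⊆ closedBall 0 δ) (h1 : ∫ x, φ x = 1) {p : ℝ} (hp : 1 ≤ p)
    {f : EuclideanSpace ℝ (Fin m) → EuclideanSpace ℝ (Fin ν)} {z : 𝔼}
    (hf : IntegrableOn f (closedBall z δ)) :
    ‖f z‖ₑ ^ p ≤ 2 ^ (p - 1) * ((∫⁻ w, ENNReal.ofReal (φ (z - w)) * ‖f z - f w‖ₑ ^ p) +
      ‖∫ w, φ (z - w) • f w‖ₑ ^ p) := by
  have hc : HasCompactSupport φ := (isCompact_closedBall 0 δ).of_isClosed_subset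
    (isClosed_tsupport φ) hs
  set χ : 𝔼 → ℝ := fun w => φ (z - w) with hχ
  have hχc : Continuous χ := hφ.comp (continuous_const.sub continuous_id)
  have hχ0 : ∀ w, w ∉ closedBall z δ → χ w = 0 := fun w hw => by
    by_contra hne
    have := hs (subset_tsupport φ hne)
    rw [mem_closedBall_zero_iff, ← dist_eq_norm] at this
    exact hw (by rwa [mem_closedBall, dist_comm])
  have hχ1 : ∫ w, χ w = 1 := by rw [hχ, integral_sub_left_eq_self φ volume z, h1]
  have iχ : Integrable χ := by
    by_contra h
    rw [integral_undef h] at hχ1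
    exact zero_ne_one hχ1
  have hχl : ∫⁻ w, ENNReal.ofReal (χ w) = 1 := by
    rw [← ofReal_integral_eq_lintegral_ofReal iχ (Eventually.of_forall fun w => h0 _), hχ1,
      ENNReal.ofReal_one]
  obtain ⟨B, hB⟩ := hφ.bounded_above_of_compact_support hc
  set F := (closedBall z δ).indicator f with hF
  have iF : Integrable F := hf.integrable_indicator measurableSet_closedBall
  have hχF : ∀ w, χ w • f w = χ w • F w := fun w => by
    by_cases hw : w ∈ closedBall z δ
    · rw [hF, indicator_of_mem hw]
    · rw [hχ0 w hw, zero_smul, zero_smul]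
  have iχf : Integrable fun w => χ w • f w := by
    simp only [hχF]
    exact iF.bdd_smul B hχc.aestronglyMeasurable (Eventually.of_forall fun w => hB _)
  have e1 : f z = (∫ w, χ w • (f z - f w)) + ∫ w, χ w • f w := by
    simp only [smul_sub]
    rw [integral_sub (iχ.smul_const _) iχf, integral_smul_const, hχ1, one_smul, sub_add_cancel]
  set κ : Measure 𝔼 := volume.withDensity fun w => ENNReal.ofReal (χ w) with hκ
  have hκ1 : κ univ = 1 := by rw [hκ, withDensity_apply _ .univ, Measure.restrict_univ, hχl]
  have hχm : Measurable fun w => ENNReal.ofReal (χ w) := hχc.measurable.ennreal_ofReal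
  have hκl : ∀ g : 𝔼 → ℝ≥0∞, ∫⁻ w, g w ∂κ = ∫⁻ w, ENNReal.ofReal (χ w) * g w := fun g =>
    lintegral_withDensity_eq_lintegral_mul_non_measurable _ hχm
      (Eventually.of_forall fun _ => ENNReal.ofReal_lt_top) g
  have hFm : AEMeasurable (fun w => ‖f z - F w‖ₑ) κ :=
    ((aestronglyMeasurable_const.sub iF.aestronglyMeasurable).enorm).mono_ac
      (withDensity_absolutelyContinuous _ _)
  have hχe : ∀ (q : ℝ) w, ENNReal.ofReal (χ w) * ‖f z - f w‖ₑ ^ q =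
      ENNReal.ofReal (χ w) * ‖f z - F w‖ₑ ^ q := fun q w => by
    by_cases hw : w ∈ closedBall z δ
    · rw [hF, indicator_of_mem hw]
    · rw [hχ0 w hw, ENNReal.ofReal_zero, zero_mul, zero_mul]
  have e2 : ‖∫ w, χ w • (f z - f w)‖ₑ ^ p ≤ ∫⁻ w, ENNReal.ofReal (χ w) * ‖f z - f w‖ₑ ^ p := by
    have h2 : ‖∫ w, χ w • (f z - f w)‖ₑ ≤ ∫⁻ w, ‖f z - F w‖ₑ ∂κ := by
      refine (enorm_integral_le_lintegral_enorm _).trans (le_of_eq ?_)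
      rw [hκl]
      refine lintegral_congr fun w => ?_
      have := hχe 1 w
      simp only [ENNReal.rpow_one] at this
      rw [enorm_smul, ← this, Real.enorm_eq_ofReal (h0 _)]
    refine (ENNReal.rpow_le_rpow h2 (by linarith)).trans ((rpow_lintegral_le hp hFm).trans ?_)
    rw [hκ1, ENNReal.one_rpow, one_mul, hκl]
    simp only [hχe, le_refl]
  calc ‖f z‖ₑ ^ p = ‖(∫ w, χ w • (f z - f w)) + ∫ w, χ w • f w‖ₑ ^ p := by rw [← e1]
    _ ≤ _ := enorm_add_rpow_le hp _ _
    _ ≤ _ := by gcongr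

end Mollify

section CovDerivMollify

variable {m : ℕ} {M : Type*} [EMetricSpace M] [ChartedSpace (EuclideanSpace ℝ (Fin m)) M]

local notation "𝔼" => EuclideanSpace ℝ (Fin m)
local notation "Φ[" c "]" => PartialEquiv.symm (extChartAt (𝓡 m) c)
local notation "TM" => (TangentSpace (𝓡 m) : M → Type _)

variable [IsManifold (𝓡 m) ∞ M] [RiemannianBundle (fun x : M => TangentSpace (𝓡 m) x)]
  [IsContMDiffRiemannianBundle (𝓡 m) ∞ (EuclideanSpace ℝ (Fin m))
    (fun x : M => TangentSpace (𝓡 m) x)]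
  [IsRiemannianManifold (𝓡 m) M] [MeasurableSpace M] [BorelSpace M]

variable {ν k : ℕ} [CompactSpace M]

theorem exists_lintegral_inChart_le' (c : M) {K : Set 𝔼} (hK : IsCompact K)
    (hKt : K ⊆ (extChartAt (𝓡 m) c).target) {p : ℝ} (hp : 1 ≤ p) {w : 𝔼 → Fin k → 𝔼}
    (hw : ContinuousOn w (extChartAt (𝓡 m) c).target) :
    ∃ A : ℝ≥0, ∀ T : TensorField m M ν k, T.IsMeas →
      ∫⁻ z in K, ‖T.inChart c z (w z)‖ₑ ≤ A * energy m p T ^ (1 / p) := by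
  obtain ⟨B, hB⟩ := hK.exists_bound_of_continuousOn (hw.mono hKt)
  obtain ⟨A, hA⟩ := exists_lintegral_inChart_le (ν := ν) c hK hKt hp B.toNNReal k
  exact ⟨A, fun T hT => hA T w hT fun z hz i =>
    (norm_le_pi_norm _ i).trans ((hB z hz).trans (Real.le_coe_toNNReal B))⟩

/-- A mollified weak covariant derivative is controlled by the field itself. -/
theorem exists_mollify_le (ν : ℕ) (c : M) {z₁ : 𝔼} {R r δ : ℝ}
    (hKt : closedBall z₁ R ⊆ (extChartAt (𝓡 m) c).target) (hr : r + δ ≤ R) {p : ℝ} (hp : 1 ≤ p)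
    {φ : EuclideanSpace ℝ (Fin m) → ℝ} (hφ : ContDiff ℝ ∞ φ) (hs : tsupport φ ⊆ closedBall 0 δ)
    (v : Fin (k + 1) → 𝔼) :
    ∃ A : ℝ≥0, ∀ (T : TensorField m M ν k) (S : TensorField m M ν (k + 1)), IsWeakCovDeriv T S →
      energy m p T < ⊤ → ∀ z ∈ closedBall z₁ r,
        ‖∫ w, φ (z - w) • S.inChart c w v‖ₑ ^ p ≤ A * energy m p T := by
  have hc : HasCompactSupport φ := (isCompact_closedBall 0 δ).of_isClosed_subset
    (isClosed_tsupport φ) hs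
  set K := closedBall z₁ R with hKdef
  have hK : IsCompact K := isCompact_closedBall z₁ R
  obtain ⟨B, hB⟩ := hφ.continuous.bounded_above_of_compact_support hc
  obtain ⟨B', hB'⟩ := (continuous_fderiv_apply hφ (v 0)).bounded_above_of_compact_support
    (hc.fderiv_apply ℝ (v 0))
  have hup := fun q => continuousOn_update_christoffelVec c (v 0) (Fin.tail v) q
  obtain ⟨A₀, hA₀⟩ := exists_lintegral_inChart_le' (ν := ν) c hK hKt hp (w := fun _ => Fin.tail v)
    continuousOn_const
  choose A hA using fun q => exists_lintegral_inChart_le' (ν := ν) c hK hKt hp (hup q)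
  -- The term with A₀ comes from the derivative falling on φ, the terms with A q from the
  -- Christoffel terms. The constant depends on φ, and hence on δ.
  refine ⟨(B'.toNNReal * A₀ + ∑ q, B.toNNReal * A q) ^ p, fun T S h hT z hz => ?_⟩
  have hTm := h.isMeas_left
  set ψ : 𝔼 → ℝ := fun w => φ (z - w) with hψ
  have hψs : ContDiff ℝ ∞ ψ := hφ.comp (contDiff_const.sub contDiff_id)
  have hψt : tsupport ψ = (fun w => z - w) ⁻¹' tsupport φ :=
    tsupport_comp_eq_preimage φ (Homeomorph.subLeft z)
  have hψc : HasCompactSupport ψ := hc.comp_homeomorph (Homeomorph.subLeft z)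
  have hψK : tsupport ψ ⊆ K := by
    rw [hψt]
    intro w hw
    have h1 := hs hw
    rw [mem_closedBall_zero_iff, ← dist_eq_norm, dist_comm] at h1
    rw [mem_closedBall] at hz ⊢
    linarith [dist_triangle w z z₁]
  have hdψ : ∀ w, fderiv ℝ ψ w (v 0) = -fderiv ℝ φ (z - w) (v 0) := fun w => by
    have h1 : HasFDerivAt ψ _ w := ((hφ.differentiable (by simp) (z - w)).hasFDerivAt).comp w
      ((hasFDerivAt_id w).const_sub z)
    rw [h1.fderiv]
    simp
  have hK0 : ∀ w, w ∉ K → ψ w = 0 := fun w hw =>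
    image_eq_zero_of_notMem_tsupport fun h => hw (hψK h)
  have hK0' : ∀ w, w ∉ K → fderiv ℝ ψ w (v 0) = 0 := fun w hw =>
    image_eq_zero_of_notMem_tsupport (f := fun w => fderiv ℝ ψ w (v 0)) fun h =>
      hw (hψK (tsupport_fderiv_apply_subset' ψ (v 0) h))
  have hw := (h c (v 0) (Fin.tail v)).2.2 ψ hψs hψc (hψK.trans hKt)
  have hi1 := integrable_smul_of_tsupport_subset (h c (v 0) (Fin.tail v)).2.1 hψs.continuous hψc
    (hψK.trans hKt)
  have hi2 : ∀ q, Integrable fun w => ψ w • T.inChart c w (Function.update (Fin.tail v) q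
      (christoffelVec c w (v 0) (Fin.tail v q))) := fun q =>
    integrable_smul_of_tsupport_subset (locallyIntegrableOn_inChart hp hTm hT c (hup q))
      hψs.continuous hψc (hψK.trans hKt)
  -- Integration by parts against ψ = φ(z - ·): only T appears on the right, and no derivative of
  -- it.
  have e1 : ∫ w, ψ w • S.inChart c w v = -(∫ w, fderiv ℝ ψ w (v 0) • T.inChart c w (Fin.tail v)) -
      ∑ q, ∫ w, ψ w • T.inChart c w (Function.update (Fin.tail v) q
        (christoffelVec c w (v 0) (Fin.tail v q))) := by
    rw [hw, neg_neg, ← integral_finsetSum _ fun q _ => hi2 q,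
      ← integral_sub hi1 (integrable_finsetSum _ fun q _ => hi2 q)]
    refine integral_congr_ae (Eventually.of_forall fun w => ?_)
    simp only [smul_add, Finset.smul_sum, add_sub_cancel_right, Fin.cons_self_tail]
  have e2 : ‖∫ w, ψ w • S.inChart c w v‖ₑ ≤
      (B'.toNNReal * A₀ + ∑ q, B.toNNReal * A q : ℝ≥0) * energy m p T ^ (1 / p) := by
    rw [e1]
    refine (enorm_sub_le).trans ?_
    rw [enorm_neg]
    push_cast
    rw [add_mul, Finset.sum_mul]
    refine add_le_add ?_ ((enorm_sum_le _ _).trans (Finset.sum_le_sum fun q _ => ?_))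
    · refine (enorm_integral_smul_le (B := B'.toNNReal) hK.measurableSet (fun w => ?_) hK0' _).trans ?_
      · rw [hdψ, norm_neg]
        exact (hB' _).trans (Real.le_coe_toNNReal B')
      · rw [mul_assoc]
        gcongr
        exact hA₀ T hTm
    · refine (enorm_integral_smul_le (B := B.toNNReal) hK.measurableSet (fun w => ?_) hK0 _).trans ?_
      · exact (hB _).trans (Real.le_coe_toNNReal B)
      · rw [mul_assoc]
        gcongr
        exact hA q T hTm
  refine (ENNReal.rpow_le_rpow e2 (by linarith)).trans (le_of_eq ?_)
  rw [ENNReal.mul_rpow_of_nonneg _ _ (by linarith), ← ENNReal.rpow_mul, one_div,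
    inv_mul_cancel₀ (by linarith), ENNReal.rpow_one, ENNReal.coe_rpow_of_nonneg _ (by linarith)]

end CovDerivMollify

section MollifyDifference

variable {m ν : ℕ}

local notation "𝔼" => EuclideanSpace ℝ (Fin m)
local notation "𝔽" => EuclideanSpace ℝ (Fin ν)

/-- With h = z - w and Tonelli, the left side is the φ-average over h of the increment integrals;
each of these is at most B and φ has mass one. -/
theorem lintegral_mollify_sub_le {φ : EuclideanSpace ℝ (Fin m) → ℝ} (hφ : Continuous φ)
    (h0 : ∀ x, 0 ≤ φ x) {δ : ℝ} (hs : tsupport φ ⊆ closedBall 0 δ) (h1 : ∫ x, φ x = 1) {p : ℝ}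
    {V K : Set 𝔼} (hV : MeasurableSet V) (hK : MeasurableSet K) (hVK : V ⊆ K)
    (hVδ : ∀ z ∈ V, ∀ h ∈ closedBall (0 : 𝔼) δ, z - h ∈ K)
    {f : EuclideanSpace ℝ (Fin m) → EuclideanSpace ℝ (Fin ν)}
    (hf : AEStronglyMeasurable f (volume.restrict K)) {B : ℝ≥0∞}
    (hB : ∀ h ∈ closedBall (0 : 𝔼) δ, ∫⁻ z in V, ‖f z - f (z - h)‖ₑ ^ p ≤ B) :
    ∫⁻ z in V, ∫⁻ w, ENNReal.ofReal (φ (z - w)) * ‖f z - f w‖ₑ ^ p ≤ B := by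
  set F := K.indicator f with hF
  have hFm : AEStronglyMeasurable F := (aestronglyMeasurable_indicator_iff hK).2 hf
  have hφ0 : ∀ h, h ∉ closedBall (0 : 𝔼) δ → φ h = 0 := fun h hh =>
    image_eq_zero_of_notMem_tsupport fun h' => hh (hs h')
  have hFf : ∀ z ∈ V, ∀ h ∈ closedBall (0 : 𝔼) δ, F z - F (z - h) = f z - f (z - h) :=
    fun z hz h hh => by
      rw [hF, indicator_of_mem (hVK hz), indicator_of_mem (hVδ z hz h hh)]
  have iφ : Integrable φ := by
    by_contra h
    rw [integral_undef h] at h1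
    exact zero_ne_one h1
  have hφl : ∫⁻ h, ENNReal.ofReal (φ h) = 1 := by
    rw [← ofReal_integral_eq_lintegral_ofReal iφ (Eventually.of_forall h0), h1,
      ENNReal.ofReal_one]
  have hmeas : AEMeasurable (Function.uncurry fun z h : 𝔼 =>
      ENNReal.ofReal (φ h) * ‖F z - F (z - h)‖ₑ ^ p) ((volume.restrict V).prod volume) := by
    have h2 : AEMeasurable (Function.uncurry fun z h : 𝔼 =>
        ENNReal.ofReal (φ h) * ‖F z - F (z - h)‖ₑ ^ p) (volume.prod volume) := by
      refine AEMeasurable.mul (hφ.measurable.comp measurable_snd).ennreal_ofReal.aemeasurable ?_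
      refine AEMeasurable.pow_const (AEStronglyMeasurable.enorm ?_) p
      exact (hFm.comp_quasiMeasurePreserving Measure.quasiMeasurePreserving_fst).sub
        (hFm.comp_quasiMeasurePreserving (quasiMeasurePreserving_sub volume volume))
    exact h2.mono_ac (Measure.restrict_le_self.absolutelyContinuous.prod
      Measure.AbsolutelyContinuous.rfl)
  calc ∫⁻ z in V, ∫⁻ w, ENNReal.ofReal (φ (z - w)) * ‖f z - f w‖ₑ ^ p
      = ∫⁻ z in V, ∫⁻ h, ENNReal.ofReal (φ h) * ‖F z - F (z - h)‖ₑ ^ p := by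
        refine setLIntegral_congr_fun hV fun z hz => ?_
        rw [← lintegral_sub_left_eq_self _ z]
        refine lintegral_congr fun w => ?_
        rw [sub_sub_cancel]
        by_cases hw : w ∈ closedBall (0 : 𝔼) δ
        · rw [hFf z hz _ hw]
        · rw [hφ0 _ hw, ENNReal.ofReal_zero, zero_mul, zero_mul]
    _ = ∫⁻ h, ∫⁻ z in V, ENNReal.ofReal (φ h) * ‖F z - F (z - h)‖ₑ ^ p :=
        lintegral_lintegral_swap hmeas
    _ ≤ ∫⁻ h, ENNReal.ofReal (φ h) * B := by
        refine lintegral_mono fun h => ?_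
        rw [lintegral_const_mul' _ _ ENNReal.ofReal_ne_top]
        by_cases hh : h ∈ closedBall (0 : 𝔼) δ
        · gcongr
          refine le_trans (le_of_eq ?_) (hB h hh)
          exact setLIntegral_congr_fun hV fun z hz => by rw [hFf z hz h hh]
        · rw [hφ0 h hh, ENNReal.ofReal_zero, zero_mul, zero_mul]
    _ = B := by
        rw [lintegral_mul_const _ hφ.measurable.ennreal_ofReal, hφl, one_mul]

end MollifyDifference

/-! ### Local estimates of a derivative by its oscillation. -/

section LocalEstimate

variable {m : ℕ} {M : Type*} [EMetricSpace M] [ChartedSpace (EuclideanSpace ℝ (Fin m)) M]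

local notation "𝔼" => EuclideanSpace ℝ (Fin m)
local notation "Φ[" c "]" => PartialEquiv.symm (extChartAt (𝓡 m) c)
local notation "TM" => (TangentSpace (𝓡 m) : M → Type _)

variable [IsManifold (𝓡 m) ∞ M] [RiemannianBundle (fun x : M => TangentSpace (𝓡 m) x)]
  [IsContMDiffRiemannianBundle (𝓡 m) ∞ (EuclideanSpace ℝ (Fin m))
    (fun x : M => TangentSpace (𝓡 m) x)]
  [IsRiemannianManifold (𝓡 m) M] [MeasurableSpace M] [BorelSpace M]

variable {ν k : ℕ}

/-- The coordinate frame with multi-index `L`. -/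
abbrev coordFrame (L : Fin k → Fin m) : Fin k → 𝔼 := fun i => EuclideanSpace.single (L i) 1

theorem norm_coordFrame (L : Fin k → Fin m) (i : Fin k) : ‖coordFrame L i‖ = 1 := by
  simp [coordFrame]

theorem IsGoodBall.enorm_le_sum {c : M} {z₁ : 𝔼} {R : ℝ} {C : ℝ≥0} (h : IsGoodBall c z₁ R C)
    {z : 𝔼} (hz : z ∈ closedBall z₁ R) (T : TensorField m M ν k) :
    ‖T (Φ[c] z)‖ₑ ≤ (C ^ k : ℝ≥0) * ∑ L : Fin k → Fin m, ‖T.inChart c z (coordFrame L)‖ₑ := by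
  have h1 := ENNReal.ofReal_le_ofReal (h.norm_le_sum hz T)
  rw [ENNReal.ofReal_mul (by positivity), ENNReal.ofReal_sum_of_nonneg fun _ _ => norm_nonneg _]
    at h1
  simp only [ofReal_norm] at h1
  rw [← NNReal.coe_pow, ENNReal.ofReal_coe_nnreal] at h1
  rw [← ofReal_norm]
  exact h1

theorem IsGoodBall.enorm_inChart_le {c : M} {z₁ : 𝔼} {R : ℝ} {C : ℝ≥0} (h : IsGoodBall c z₁ R C)
    (T : TensorField m M ν k) {z : 𝔼} (hz : z ∈ closedBall z₁ R) {v : Fin k → 𝔼} {b : ℝ≥0}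
    (hv : ∏ i, ‖v i‖ ≤ b) : ‖T.inChart c z v‖ₑ ≤ (C ^ k * b : ℝ≥0) * ‖T (Φ[c] z)‖ₑ := by
  have h1 : ‖T.inChart c z v‖ ≤ (C ^ k * b : ℝ≥0) * ‖T (Φ[c] z)‖ := by
    refine (h.norm_inChart_le T hz v).trans ?_
    push_cast
    gcongr
  rw [← ofReal_norm, ← ofReal_norm, ← ENNReal.ofReal_coe_nnreal,
    ← ENNReal.ofReal_mul (by positivity)]
  exact ENNReal.ofReal_le_ofReal h1

theorem prod_norm_update_coordFrame (L : Fin k → Fin m) (q : Fin k) (x : 𝔼) :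
    ∏ i, ‖Function.update (coordFrame L) q x i‖ = ‖x‖ := by
  have : ∀ i, ‖Function.update (coordFrame L) q x i‖ = if i = q then ‖x‖ else 1 := fun i => by
    rw [Function.update_apply]
    split_ifs
    · rfl
    · exact norm_coordFrame L i
  simp only [this, Finset.prod_ite_eq', Finset.mem_univ, if_true]

/-- The mean oscillation of a component of a tensor field at the scale of a mollifier. -/
def oscillation (p : ℝ) (φ : EuclideanSpace ℝ (Fin m) → ℝ) (c : M) (V : Set 𝔼)
    (S : TensorField m M ν k) (L : Fin k → Fin m) : ℝ≥0∞ :=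
  ∫⁻ z in V, ∫⁻ w, ENNReal.ofReal (φ (z - w)) *
    ‖S.inChart c z (coordFrame L) - S.inChart c w (coordFrame L)‖ₑ ^ p

variable [CompactSpace M]

/-- The constant Λ in front of the oscillation is fixed before δ and φ, while A depends on them. It
remains to make the oscillation small, at the price of a large A in front of the lower order term.
-/
theorem IsGoodBall.exists_lintegral_le_oscillation {c : M} {z₁ : 𝔼} {R : ℝ} {C : ℝ≥0}
    (h : IsGoodBall c z₁ R C) {p : ℝ} (hp : 1 ≤ p) (ν k : ℕ) :
    ∃ Λ : ℝ≥0, ∀ {δ : ℝ}, δ ≤ R / 4 → ∀ {φ : EuclideanSpace ℝ (Fin m) → ℝ}, ContDiff ℝ ∞ φ →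
      (∀ x, 0 ≤ φ x) → tsupport φ ⊆ closedBall 0 δ → ∫ x, φ x = 1 →
      ∃ A : ℝ≥0, ∀ (T : TensorField m M ν k) (S : TensorField m M ν (k + 1)),
        IsWeakCovDeriv T S → energy m p T < ⊤ → energy m p S < ⊤ →
        ∫⁻ x in Φ[c] '' closedBall z₁ (R / 2), ‖S x‖ₑ ^ p ∂(riemVol m M) ≤
          Λ * ∑ L, oscillation p φ c (closedBall z₁ (R / 2)) S L + A * energy m p T := by
  have hp0 : 0 < p := by linarith
  have hR := h.pos
  set V := closedBall z₁ (R / 2) with hV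
  have hVK : V ⊆ closedBall z₁ R := closedBall_subset_closedBall (by linarith)
  have hVm : MeasurableSet V := measurableSet_closedBall
  set N : ℝ≥0∞ := (Fintype.card (Fin (k + 1) → Fin m) : ℝ≥0∞) ^ (p - 1) with hN
  have hNt : N ≠ ⊤ := ENNReal.rpow_ne_top_of_nonneg (by linarith) (ENNReal.natCast_ne_top _)
  set Λ : ℝ≥0∞ := (C : ℝ≥0∞) ^ m * (((C ^ (k + 1) : ℝ≥0) : ℝ≥0∞) ^ p * N) * 2 ^ (p - 1) with hΛ
  have hΛt : Λ ≠ ⊤ := ENNReal.mul_ne_top (ENNReal.mul_ne_top (by finiteness) (ENNReal.mul_ne_top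
    (ENNReal.rpow_ne_top_of_nonneg hp0.le ENNReal.coe_ne_top) hNt))
    (ENNReal.rpow_ne_top_of_nonneg (by linarith) (by simp))
  refine ⟨Λ.toNNReal, fun {δ} hδ {φ} hφ h0 hs h1 => ?_⟩
  rw [ENNReal.coe_toNNReal hΛt]
  choose A hA using fun L : Fin (k + 1) → Fin m => exists_mollify_le ν c (r := R / 2) h.subset
    (by linarith) hp hφ hs (coordFrame L)
  have hVt : volume V ≠ ⊤ := measure_closedBall_lt_top.ne
  have hAt : Λ * ∑ L, (A L : ℝ≥0∞) * volume V ≠ ⊤ := ENNReal.mul_ne_top hΛt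
    (ENNReal.sum_ne_top.2 fun L _ => ENNReal.mul_ne_top ENNReal.coe_ne_top hVt)
  refine ⟨(Λ * ∑ L, (A L : ℝ≥0∞) * volume V).toNNReal, fun T S hTS hT hS => ?_⟩
  rw [ENNReal.coe_toNNReal hAt]
  have hSm := hTS.isMeas_right
  have hloc : ∀ L, LocallyIntegrableOn (fun z => S.inChart c z (coordFrame L))
      (extChartAt (𝓡 m) c).target := fun L =>
    locallyIntegrableOn_inChart hp hSm hS c continuousOn_const
  have hcomp : ∀ L, ∫⁻ z in V, ‖S.inChart c z (coordFrame L)‖ₑ ^ p ≤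
      2 ^ (p - 1) * (oscillation p φ c V S L + A L * volume V * energy m p T) := fun L => by
    calc ∫⁻ z in V, ‖S.inChart c z (coordFrame L)‖ₑ ^ p
        ≤ ∫⁻ z in V, 2 ^ (p - 1) * ((∫⁻ w, ENNReal.ofReal (φ (z - w)) *
            ‖S.inChart c z (coordFrame L) - S.inChart c w (coordFrame L)‖ₑ ^ p) +
            A L * energy m p T) := by
          refine setLIntegral_mono' hVm fun z hz => ?_
          have hzδ : closedBall z δ ⊆ closedBall z₁ R := by
            refine closedBall_subset_closedBall' ?_
            rw [mem_closedBall] at hz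
            linarith
          refine (enorm_rpow_le_mollify hφ.continuous h0 hs h1 hp
            ((hloc L).integrableOn_compact_subset (hzδ.trans h.subset)
              (isCompact_closedBall z δ))).trans ?_
          gcongr
          exact hA L T S hTS hT z hz
      _ = _ := by
          rw [lintegral_const_mul' _ _ (ENNReal.rpow_ne_top_of_nonneg (by linarith) (by simp)),
            lintegral_add_right _ measurable_const, setLIntegral_const, oscillation]
          ring
  calc ∫⁻ x in Φ[c] '' V, ‖S x‖ₑ ^ p ∂(riemVol m M)
      ≤ (C : ℝ≥0∞) ^ m * ∫⁻ z in V, ‖S (Φ[c] z)‖ₑ ^ p := h.lintegral_image_le hVK hVm _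
    _ ≤ (C : ℝ≥0∞) ^ m * ∫⁻ z in V, ((C ^ (k + 1) : ℝ≥0) : ℝ≥0∞) ^ p *
          (N * ∑ L : Fin (k + 1) → Fin m, ‖S.inChart c z (coordFrame L)‖ₑ ^ p) := by
        gcongr _ * ?_
        refine setLIntegral_mono' hVm fun z hz => ?_
        refine (ENNReal.rpow_le_rpow (h.enorm_le_sum (hVK hz) S) hp0.le).trans ?_
        rw [ENNReal.mul_rpow_of_nonneg _ _ hp0.le]
        gcongr
        exact ENNReal.rpow_sum_le_const_mul_sum_rpow Finset.univ
          (fun L : Fin (k + 1) → Fin m => ‖S.inChart c z (coordFrame L)‖ₑ) hp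
    _ = (C : ℝ≥0∞) ^ m * (((C ^ (k + 1) : ℝ≥0) : ℝ≥0∞) ^ p * N) *
          ∑ L : Fin (k + 1) → Fin m, ∫⁻ z in V, ‖S.inChart c z (coordFrame L)‖ₑ ^ p := by
        rw [lintegral_const_mul' _ _ (ENNReal.rpow_ne_top_of_nonneg hp0.le ENNReal.coe_ne_top),
          lintegral_const_mul' _ _ hNt, lintegral_finsetSum']
        · ring
        · exact fun L _ =>
            ((hSm c _).mono_set (hVK.trans h.subset)).enorm.pow_const p
    _ ≤ (C : ℝ≥0∞) ^ m * (((C ^ (k + 1) : ℝ≥0) : ℝ≥0∞) ^ p * N) *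
          ∑ L : Fin (k + 1) → Fin m,
            2 ^ (p - 1) * (oscillation p φ c V S L + A L * volume V * energy m p T) := by
        gcongr with L
        exact hcomp L
    _ = _ := by
        rw [← Finset.mul_sum, Finset.sum_add_distrib, ← Finset.sum_mul, hΛ]
        ring

/-- The oscillation of a tensor field is controlled by its weak derivative. -/
theorem IsGoodBall.oscillation_le {c : M} {z₁ : 𝔼} {R : ℝ} {C : ℝ≥0}
    (h : IsGoodBall c z₁ R C) {p : ℝ} (hp : 1 ≤ p) {δ : ℝ≥0} (hδ : δ ≤ R / 4)
    {φ : EuclideanSpace ℝ (Fin m) → ℝ} (hφ : ContDiff ℝ ∞ φ) (h0 : ∀ x, 0 ≤ φ x)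
    (hs : tsupport φ ⊆ closedBall 0 δ) (h1 : ∫ x, φ x = 1)
    {S : TensorField m M ν (k + 1)} {Q : TensorField m M ν (k + 2)} (hSQ : IsWeakCovDeriv S Q)
    (L : Fin (k + 1) → Fin m) :
    oscillation p φ c (closedBall z₁ (R / 2)) S L ≤
      (((k + 1) * C ^ (k + 2) * δ : ℝ≥0) : ℝ≥0∞) ^ p * 2 ^ (p - 1) * C ^ m *
        (energy m p Q + energy m p S) := by
  have hp0 : 0 < p := by linarith
  have hR := h.pos
  have hSm := hSQ.isMeas_left
  have hQm := hSQ.isMeas_right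
  set D : ℝ≥0 := (k + 1) * C ^ (k + 2) * δ with hD
  refine lintegral_mollify_sub_le hφ.continuous h0 hs h1 measurableSet_closedBall
    (measurableSet_closedBall (x := z₁) (ε := R)) (closedBall_subset_closedBall (by linarith))
    (fun z hz x hx => ?_) ((hSm c _).mono_set h.subset) fun x hx => ?_
  · rw [mem_closedBall_iff_norm] at hz ⊢
    rw [mem_closedBall_zero_iff] at hx
    calc ‖z - x - z₁‖ = ‖(z - z₁) - x‖ := by congr 1; abel
      _ ≤ ‖z - z₁‖ + ‖x‖ := norm_sub_le _ _
      _ ≤ R := by linarith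
  rw [mem_closedBall_zero_iff] at hx
  have hw := hSQ c x (coordFrame L)
  -- The increment estimate needs an open set. The ball of radius 3R/4 contains the closed ball of
  -- radius R/2, and steps of length at most R/4 do not leave the ball of radius R.
  have hUK : ∀ z ∈ ball z₁ (3 * R / 4), ∀ t ∈ Icc (0 : ℝ) 1, z - t • x ∈ closedBall z₁ R := by
    intro z hz t ht
    rw [mem_ball_iff_norm] at hz
    rw [mem_closedBall_iff_norm]
    calc ‖z - t • x - z₁‖ = ‖(z - z₁) - t • x‖ := by congr 1; abel
      _ ≤ ‖z - z₁‖ + ‖t • x‖ := norm_sub_le _ _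
      _ ≤ ‖z - z₁‖ + 1 * ‖x‖ := by
          rw [norm_smul, Real.norm_of_nonneg ht.1]
          gcongr
          exact ht.2
      _ ≤ R := by linarith
  refine (lintegral_mono_set (closedBall_subset_ball (by linarith))).trans
    ((hw.lintegral_sub_rpow_le isOpen_ball (isCompact_closedBall z₁ R) h.subset hUK hp).trans ?_)
  have hbound : ∀ z ∈ closedBall z₁ R, ‖Q.inChart c z (Fin.cons x (coordFrame L)) +
      ∑ r, S.inChart c z (Function.update (coordFrame L) r
        (christoffelVec c z x (coordFrame L r)))‖ₑ ^ p ≤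
      (D : ℝ≥0∞) ^ p * 2 ^ (p - 1) * (‖Q (Φ[c] z)‖ₑ ^ p + ‖S (Φ[c] z)‖ₑ ^ p) := by
    intro z hz
    have hQ1 : ‖Q.inChart c z (Fin.cons x (coordFrame L))‖ₑ ≤ D * ‖Q (Φ[c] z)‖ₑ := by
      refine (h.enorm_inChart_le Q hz (b := δ) ?_).trans ?_
      · rw [Fin.prod_univ_succ]
        simp only [Fin.cons_zero, Fin.cons_succ, norm_coordFrame, Finset.prod_const_one, mul_one]
        exact hx
      · gcongr
        rw [hD, mul_assoc]
        exact le_mul_of_one_le_left' (by simp)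
    -- Replacing one frame vector by a Christoffel vector costs a factor C δ. There are k + 1 slots,
    -- whence the factor k + 1 in D.
    have hS1 : ∀ r, ‖S.inChart c z (Function.update (coordFrame L) r
        (christoffelVec c z x (coordFrame L r)))‖ₑ ≤ (C ^ (k + 1) * (C * δ) : ℝ≥0) *
        ‖S (Φ[c] z)‖ₑ := fun r => by
      refine h.enorm_inChart_le S hz ?_
      rw [prod_norm_update_coordFrame]
      refine (h.christoffel_le z hz _ _).trans ?_
      rw [norm_coordFrame, mul_one]
      push_cast
      gcongr
    have hsum : ‖Q.inChart c z (Fin.cons x (coordFrame L)) +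
      ∑ r, S.inChart c z (Function.update (coordFrame L) r
        (christoffelVec c z x (coordFrame L r)))‖ₑ ≤ D * (‖Q (Φ[c] z)‖ₑ + ‖S (Φ[c] z)‖ₑ) := by
      rw [mul_add]
      refine (enorm_add_le _ _).trans (add_le_add hQ1 ((enorm_sum_le _ _).trans
        ((Finset.sum_le_sum fun r _ => hS1 r).trans (le_of_eq ?_))))
      rw [Finset.sum_const, Finset.card_univ, Fintype.card_fin, nsmul_eq_mul, ← mul_assoc]
      congr 1
      rw [hD]
      push_cast
      ring
    refine (ENNReal.rpow_le_rpow hsum hp0.le).trans ?_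
    rw [ENNReal.mul_rpow_of_nonneg _ _ hp0.le, mul_assoc]
    gcongr
    exact ENNReal.rpow_add_le_mul_rpow_add_rpow _ _ hp
  refine (setLIntegral_mono' measurableSet_closedBall hbound).trans ?_
  have hc : (D : ℝ≥0∞) ^ p * 2 ^ (p - 1) ≠ ⊤ := ENNReal.mul_ne_top
    (ENNReal.rpow_ne_top_of_nonneg hp0.le ENNReal.coe_ne_top)
    (ENNReal.rpow_ne_top_of_nonneg (by linarith) (by simp))
  rw [lintegral_const_mul' _ _ hc, mul_assoc _ ((C : ℝ≥0∞) ^ m)]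
  gcongr
  have hmQ := hQm.aemeasurable_enorm.pow_const p
  have hmS := hSm.aemeasurable_enorm.pow_const p
  refine (h.lintegral_symm_le (hmQ.add hmS)).trans (le_of_eq ?_)
  congr 1
  exact lintegral_add_left' hmQ _

end LocalEstimate

theorem exists_pos_mul_rpow_le {c η : ℝ≥0∞} (hc : c ≠ ⊤) (hη : 0 < η) (D : ℝ≥0) {p r : ℝ}
    (hp : 0 < p) (hr : 0 < r) : ∃ δ : ℝ≥0, 0 < δ ∧ (δ : ℝ) ≤ r ∧ c * ((D * δ : ℝ≥0) : ℝ≥0∞) ^ p ≤ η := by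
  have h1 : Tendsto (fun δ : ℝ≥0 => ((D * δ : ℝ≥0) : ℝ≥0∞)) (𝓝 0) (𝓝 0) := by
    have : Continuous fun δ : ℝ≥0 => ((D * δ : ℝ≥0) : ℝ≥0∞) :=
      ENNReal.continuous_coe.comp (continuous_const.mul continuous_id)
    simpa using this.tendsto 0
  have h2 : Tendsto (fun δ : ℝ≥0 => c * ((D * δ : ℝ≥0) : ℝ≥0∞) ^ p) (𝓝 0) (𝓝 0) := by
    have h3 := (ENNReal.continuous_rpow_const (y := p)).tendsto 0 |>.comp h1
    rw [ENNReal.zero_rpow_of_pos hp] at h3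
    simpa using ENNReal.Tendsto.const_mul h3 (Or.inr hc)
  have h4 : ∀ᶠ δ : ℝ≥0 in 𝓝 0, (δ : ℝ) < r :=
    NNReal.continuous_coe.continuousAt.eventually_lt continuousAt_const (by simpa using hr)
  have h5 : ∀ᶠ δ : ℝ≥0 in 𝓝[>] 0, 0 < δ ∧ (δ : ℝ) < r ∧ c * ((D * δ : ℝ≥0) : ℝ≥0∞) ^ p < η :=
    (eventually_mem_nhdsWithin).and (nhdsWithin_le_nhds (h4.and (h2.eventually_lt_const hη)))
  obtain ⟨δ, h6, h7, h8⟩ := h5.exists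
  exact ⟨δ, h6, h7.le, h8.le⟩

/-! ### Interpolation on M, and transports compared with the identity in a chart. -/

section GlobalEstimate

variable {m : ℕ} {M : Type*} [EMetricSpace M] [ChartedSpace (EuclideanSpace ℝ (Fin m)) M]

local notation "𝔼" => EuclideanSpace ℝ (Fin m)
local notation "Φ[" c "]" => PartialEquiv.symm (extChartAt (𝓡 m) c)
local notation "TM" => (TangentSpace (𝓡 m) : M → Type _)

variable [IsManifold (𝓡 m) ∞ M] [RiemannianBundle (fun x : M => TangentSpace (𝓡 m) x)]
  [IsContMDiffRiemannianBundle (𝓡 m) ∞ (EuclideanSpace ℝ (Fin m))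
    (fun x : M => TangentSpace (𝓡 m) x)]
  [IsRiemannianManifold (𝓡 m) M] [MeasurableSpace M] [BorelSpace M]

variable {ν k : ℕ} [CompactSpace M]
variable {P : ∀ x y : M, TangentSpace (𝓡 m) x →L[ℝ] TangentSpace (𝓡 m) y}

/-- The oscillation is bounded by δᵖ times the energies of Q and S. The width δ is chosen to bring
this coefficient below η; A is the resulting cost. -/
theorem IsGoodBall.exists_lintegral_le_interpolation {c : M} {z₁ : 𝔼} {R : ℝ} {C : ℝ≥0}
    (h : IsGoodBall c z₁ R C) {p : ℝ} (hp : 1 ≤ p) (ν k : ℕ) {η : ℝ≥0∞} (hη : 0 < η) :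
    ∃ A : ℝ≥0, ∀ (T : TensorField m M ν k) (S : TensorField m M ν (k + 1))
      (Q : TensorField m M ν (k + 2)), IsWeakCovDeriv T S → IsWeakCovDeriv S Q →
      energy m p T < ⊤ → energy m p S < ⊤ →
      ∫⁻ x in Φ[c] '' closedBall z₁ (R / 2), ‖S x‖ₑ ^ p ∂(riemVol m M) ≤
        η * (energy m p Q + energy m p S) + A * energy m p T := by
  have hR := h.pos
  obtain ⟨Λ, hΛ⟩ := h.exists_lintegral_le_oscillation hp ν k
  obtain ⟨δ, hδ, hδR, hδη⟩ := exists_pos_mul_rpow_le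
    (c := (Λ : ℝ≥0∞) * (Fintype.card (Fin (k + 1) → Fin m) : ℝ≥0∞) * 2 ^ (p - 1) * (C : ℝ≥0∞) ^ m)
    (η := η) (ENNReal.mul_ne_top (ENNReal.mul_ne_top (by finiteness)
      (ENNReal.rpow_ne_top_of_nonneg (by linarith) (by simp))) (by finiteness)) hη
    ((k + 1) * C ^ (k + 2)) (p := p) (r := R / 4) (by linarith) (by linarith)
  obtain ⟨C', -, hC'⟩ := exists_mollifier m
  obtain ⟨φ, hφ, h0, hs, h1, -⟩ := hC' δ hδ
  obtain ⟨A, hA⟩ := hΛ hδR hφ h0 hs h1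
  refine ⟨A, fun T S Q hTS hSQ hT hS => (hA T S hTS hT hS).trans (add_le_add ?_ le_rfl)⟩
  calc (Λ : ℝ≥0∞) * ∑ L, oscillation p φ c (closedBall z₁ (R / 2)) S L
      ≤ Λ * ∑ _L : Fin (k + 1) → Fin m,
          (((k + 1) * C ^ (k + 2) * δ : ℝ≥0) : ℝ≥0∞) ^ p * 2 ^ (p - 1) * C ^ m *
          (energy m p Q + energy m p S) := by
        gcongr with L
        exact h.oscillation_le hp hδR hφ h0 hs h1 hSQ L
    _ = (Λ : ℝ≥0∞) * (Fintype.card (Fin (k + 1) → Fin m) : ℝ≥0∞) * 2 ^ (p - 1) *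
          (C : ℝ≥0∞) ^ m * (((k + 1) * C ^ (k + 2) * δ : ℝ≥0) : ℝ≥0∞) ^ p *
          (energy m p Q + energy m p S) := by
        rw [Finset.sum_const, Finset.card_univ, nsmul_eq_mul]
        ring
    _ ≤ η * (energy m p Q + energy m p S) := by gcongr

variable (m M) in
/-- Integrals over `M` from integrals over pieces of charts. -/
theorem exists_finset_lintegral_le {p : M → Set M} (hp : ∀ c, p c ∈ 𝓝 c) :
    ∃ t : Finset M, ∀ g : M → ℝ≥0∞,
      ∫⁻ x, g x ∂(riemVol m M) ≤ ∑ c ∈ t, ∫⁻ x in p c, g x ∂(riemVol m M) := by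
  obtain ⟨t, -, ht⟩ := isCompact_univ.elim_nhds_subcover p fun c _ => hp c
  refine ⟨t, fun g => ?_⟩
  rw [biUnion_finset_eq_iUnion] at ht
  rw [← setLIntegral_univ, ← Finset.sum_coe_sort]
  refine (lintegral_mono_set ht).trans ((lintegral_iUnion_le _ _).trans ?_)
  rw [tsum_fintype]

/-- Interpolation between successive weak covariant derivatives. -/
theorem exists_energy_le_interpolation (ν k : ℕ) {p : ℝ} (hp : 1 ≤ p) {η : ℝ≥0∞} (hη : 0 < η) :
    ∃ A : ℝ≥0, ∀ (T : TensorField m M ν k) (S : TensorField m M ν (k + 1))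
      (Q : TensorField m M ν (k + 2)), IsWeakCovDeriv T S → IsWeakCovDeriv S Q →
      energy m p T < ⊤ → energy m p S < ⊤ →
      energy m p S ≤ η * (energy m p Q + energy m p S) + A * energy m p T := by
  choose R C hR using fun c : M => exists_isGoodBall (m := m) (mem_extChartAt_target (I := 𝓡 m) c)
  obtain ⟨t, ht⟩ := exists_finset_lintegral_le m M
    (p := fun c => Φ[c] '' closedBall (extChartAt (𝓡 m) c c) (R c / 2))
    fun c => by simpa using (hR c).image_mem_nhds (half_pos (hR c).pos)
  -- The smallness is shared among the pieces of the cover; the added 1 avoids division by zero for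
  -- an empty cover.
  have hη' : 0 < η / (t.card + 1 : ℕ) := ENNReal.div_pos hη.ne' (ENNReal.natCast_ne_top _)
  choose A hA using fun c : M => (hR c).exists_lintegral_le_interpolation hp ν k hη'
  refine ⟨∑ c ∈ t, A c, fun T S Q hTS hSQ hT hS => (ht _).trans ?_⟩
  refine (Finset.sum_le_sum fun c _ => hA c T S Q hTS hSQ hT hS).trans ?_
  rw [Finset.sum_add_distrib, Finset.sum_const, nsmul_eq_mul, ← Finset.sum_mul, ← mul_assoc]
  push_cast
  gcongr
  refine (mul_le_mul_left (b := (t.card : ℝ≥0∞)) (c := (t.card + 1 : ℝ≥0∞)) (by simp) _).trans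
    (le_of_eq ?_)
  exact ENNReal.mul_div_cancel (by simp) (by finiteness)

/-- The ball is chosen once for all η, unlike in `IsTransport.exists_chart`; only the distance δ
depends on η. The matrix of P is uniformly continuous on a compact square and is the identity on the
diagonal. -/
theorem IsTransport.exists_isGoodBall (hP : IsTransport P) (c : M) :
    ∃ R C, IsGoodBall c (extChartAt (𝓡 m) c c) R C ∧ ∀ η : ℝ, 0 < η → ∃ δ > 0,
      ∀ z ∈ closedBall (extChartAt (𝓡 m) c c) R, ∀ w ∈ closedBall (extChartAt (𝓡 m) c c) R,
        dist z w ≤ δ → ∃ B : 𝔼 →L[ℝ] 𝔼, ‖B - ContinuousLinearMap.id ℝ 𝔼‖ ≤ η ∧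
          ∀ v, P (Φ[c] z) (Φ[c] w) (paramDeriv c z v) = paramDeriv c w (B v) := by
  obtain ⟨r, hr, A, hsub, hAc, hA⟩ := hP.exists_chart c one_pos
  obtain ⟨R, C, hR⟩ := FracSobolev.exists_isGoodBall (m := m) (mem_extChartAt_target (I := 𝓡 m) c)
  refine ⟨min R r, C, hR.mono (lt_min hR.pos hr) (min_le_left _ _), fun η hη => ?_⟩
  set K := closedBall (extChartAt (𝓡 m) c c) r with hK
  have hsubK : closedBall (extChartAt (𝓡 m) c c) (min R r) ⊆ K :=
    closedBall_subset_closedBall (min_le_right _ _)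
  have hKc : IsCompact (K ×ˢ K) := (isCompact_closedBall _ _).prod (isCompact_closedBall _ _)
  obtain ⟨δ, hδ, hAδ⟩ := Metric.uniformContinuousOn_iff.1
    (hKc.uniformContinuousOn_of_continuous hAc) η hη
  refine ⟨δ / 2, half_pos hδ, fun z hz w hw hzw => ⟨A (z, w), ?_, (hA z (hsubK hz) w (hsubK hw)).1⟩⟩
  have hid : A (z, z) = ContinuousLinearMap.id ℝ 𝔼 := by
    ext1 v
    have h1 := (hA z (hsubK hz) z (hsubK hz)).1 v
    rw [hP.diag] at h1
    have h2 := congrArg (fun x => (trivializationAt 𝔼 TM c).continuousLinearMapAt ℝ (Φ[c] z) x) h1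
    simp only [continuousLinearMapAt_paramDeriv (hsub (hsubK hz))] at h2
    exact h2.symm
  rw [← hid, ← dist_eq_norm]
  refine (hAδ (z, w) ⟨hsubK hz, hsubK hw⟩ (z, z) ⟨hsubK hz, hsubK hz⟩ ?_).le
  rw [Prod.dist_eq, dist_self, max_eq_right dist_nonneg, dist_comm]
  linarith

/-- The difference of components is the transported difference evaluated on the frame at z, plus the
effect of replacing the frame vectors at w by their images under B. The latter is a Lipschitz
estimate for a multilinear map with k slots and arguments of norm at most 2C. For k = 0 the factor k
removes it. -/
theorem IsGoodBall.enorm_inChart_sub_le {c : M} {z₁ : 𝔼} {R : ℝ} {C : ℝ≥0}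
    (h : IsGoodBall c z₁ R C) {z w : 𝔼} (hz : z ∈ closedBall z₁ R) (hw : w ∈ closedBall z₁ R)
    {B : EuclideanSpace ℝ (Fin m) →L[ℝ] EuclideanSpace ℝ (Fin m)} {η : ℝ≥0} (hη : η ≤ 1)
    (hB : ‖B - ContinuousLinearMap.id ℝ 𝔼‖ ≤ η)
    (hPB : ∀ v, P (Φ[c] z) (Φ[c] w) (paramDeriv c z v) = paramDeriv c w (B v))
    (S : TensorField m M ν k) (L : Fin k → Fin m) :
    ‖S.inChart c z (coordFrame L) - S.inChart c w (coordFrame L)‖ₑ ≤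
      (C ^ k : ℝ≥0) * diffNorm P S (Φ[c] z, Φ[c] w) +
      (k * (2 * C) ^ (k - 1) * C * η : ℝ≥0) * ‖S (Φ[c] w)‖ₑ := by
  have hBv : ∀ i, ‖B (coordFrame L i) - coordFrame L i‖ ≤ η := fun i => by
    have := (B - ContinuousLinearMap.id ℝ 𝔼).le_of_opNorm_le hB (coordFrame L i)
    rwa [norm_coordFrame, mul_one] at this
  have hη' : (η : ℝ) ≤ 1 := by exact_mod_cast hη
  set X := S (Φ[c] z) - (S (Φ[c] w)).compContinuousLinearMap fun _ => P (Φ[c] z) (Φ[c] w) with hX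
  have e1 : S.inChart c z (coordFrame L) - S.inChart c w (coordFrame L) =
      X (fun i => paramDeriv c z (coordFrame L i)) +
      (S (Φ[c] w) (fun i => paramDeriv c w (B (coordFrame L i))) -
        S (Φ[c] w) (fun i => paramDeriv c w (coordFrame L i))) := by
    rw [hX, sub_apply, ContinuousMultilinearMap.compContinuousLinearMap_apply]
    simp only [hPB, TensorField.inChart]
    abel
  have e2 : ‖X (fun i => paramDeriv c z (coordFrame L i))‖ ≤ C ^ k * ‖X‖ := by
    have := X.le_opNorm_mul_prod_of_le (m := fun i => paramDeriv c z (coordFrame L i))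
      (b := fun _ => (C : ℝ)) fun i => (h.norm_le z hz _).trans (by rw [norm_coordFrame, mul_one])
    rw [Finset.prod_const, Finset.card_univ, Fintype.card_fin, mul_comm] at this
    exact this
  have e3 : ‖S (Φ[c] w) (fun i => paramDeriv c w (B (coordFrame L i))) -
      S (Φ[c] w) (fun i => paramDeriv c w (coordFrame L i))‖ ≤
      k * (2 * C) ^ (k - 1) * C * η * ‖S (Φ[c] w)‖ := by
    have h1 := (S (Φ[c] w)).norm_image_sub_le (fun i => paramDeriv c w (B (coordFrame L i)))
      (fun i => paramDeriv c w (coordFrame L i))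
    rw [Fintype.card_fin] at h1
    have h2 : ‖fun i => paramDeriv c w (B (coordFrame L i))‖ ≤ 2 * C := by
      refine (pi_norm_le_iff_of_nonneg (by positivity)).2 fun i => (h.norm_le w hw _).trans ?_
      have : ‖B (coordFrame L i)‖ ≤ 2 := by
        calc ‖B (coordFrame L i)‖ = ‖(B (coordFrame L i) - coordFrame L i) + coordFrame L i‖ := by
              rw [sub_add_cancel]
          _ ≤ η + 1 := (norm_add_le _ _).trans (add_le_add (hBv i) (norm_coordFrame L i).le)
          _ ≤ 2 := by linarith
      rw [mul_comm 2]
      gcongr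
    have h3 : ‖fun i => paramDeriv c w (coordFrame L i)‖ ≤ 2 * C := by
      refine (pi_norm_le_iff_of_nonneg (by positivity)).2 fun i => (h.norm_le w hw _).trans ?_
      rw [norm_coordFrame, mul_one]
      linarith [C.coe_nonneg]
    have h4 : ‖(fun i => paramDeriv c w (B (coordFrame L i))) -
        fun i => paramDeriv c w (coordFrame L i)‖ ≤ C * η := by
      refine (pi_norm_le_iff_of_nonneg (by positivity)).2 fun i => ?_
      rw [Pi.sub_apply, ← map_sub]
      refine (h.norm_le w hw _).trans ?_
      gcongr
      exact hBv i
    refine h1.trans ?_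
    calc ‖S (Φ[c] w)‖ * k * max ‖fun i => paramDeriv c w (B (coordFrame L i))‖
          ‖fun i => paramDeriv c w (coordFrame L i)‖ ^ (k - 1) *
          ‖(fun i => paramDeriv c w (B (coordFrame L i))) -
            fun i => paramDeriv c w (coordFrame L i)‖
        ≤ ‖S (Φ[c] w)‖ * k * (2 * C) ^ (k - 1) * (C * η) := by
          gcongr
          exact max_le h2 h3
      _ = _ := by ring
  have e4 : ‖S.inChart c z (coordFrame L) - S.inChart c w (coordFrame L)‖ ≤
      (C ^ k : ℝ≥0) * ‖X‖ + (k * (2 * C) ^ (k - 1) * C * η : ℝ≥0) * ‖S (Φ[c] w)‖ := by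
    rw [e1]
    push_cast
    exact (norm_add_le _ _).trans (add_le_add e2 e3)
  have e5 : diffNorm P S (Φ[c] z, Φ[c] w) = ENNReal.ofReal ‖X‖ := (ofReal_norm X).symm
  rw [e5, ← ofReal_norm, ← ofReal_norm, ← ENNReal.ofReal_coe_nnreal, ← ENNReal.ofReal_coe_nnreal,
    ← ENNReal.ofReal_mul (by positivity), ← ENNReal.ofReal_mul (by positivity),
    ← ENNReal.ofReal_add (by positivity) (by positivity)]
  exact ENNReal.ofReal_le_ofReal e4

end GlobalEstimate

/-! ### Control of the oscillation by the Gagliardo energy. -/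

section Gagliardo

variable {m : ℕ} {M : Type*} [EMetricSpace M] [ChartedSpace (EuclideanSpace ℝ (Fin m)) M]

local notation "𝔼" => EuclideanSpace ℝ (Fin m)
local notation "Φ[" c "]" => PartialEquiv.symm (extChartAt (𝓡 m) c)
local notation "TM" => (TangentSpace (𝓡 m) : M → Type _)

variable [IsManifold (𝓡 m) ∞ M] [RiemannianBundle (fun x : M => TangentSpace (𝓡 m) x)]
  [IsContMDiffRiemannianBundle (𝓡 m) ∞ (EuclideanSpace ℝ (Fin m))
    (fun x : M => TangentSpace (𝓡 m) x)]
  [IsRiemannianManifold (𝓡 m) M] [MeasurableSpace M] [BorelSpace M]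

variable {ν k : ℕ} [CompactSpace M]
variable {P : ∀ x y : M, TangentSpace (𝓡 m) x →L[ℝ] TangentSpace (𝓡 m) y}

/-- The integrand of the Gagliardo energy. -/
def gagDensity (P : ∀ x y : M, TangentSpace (𝓡 m) x →L[ℝ] TangentSpace (𝓡 m) y) (σ p : ℝ)
    (T : TensorField m M ν k) (q : M × M) : ℝ≥0∞ :=
  diffNorm P T q ^ p / edist q.1 q.2 ^ ((m : ℝ) + σ * p)

theorem gagliardo_eq (σ p : ℝ) (A : Set (M × M)) (T : TensorField m M ν k) :
    gagliardo P σ p A T = ∫⁻ q in A, gagDensity P σ p T q ∂((riemVol m M).prod (riemVol m M)) :=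
  rfl

/-- The pairs of points at distance less than `ρ`. -/
abbrev nearDiag (M : Type*) [EMetricSpace M] (ρ : ℝ≥0∞) : Set (M × M) :=
  {q : M × M | edist q.1 q.2 < ρ}

variable (M) in
theorem measurableSet_nearDiag (ρ : ℝ≥0∞) : MeasurableSet (nearDiag M ρ) := by
  have := secondCountableTopology (M := M)
  exact measurableSet_lt measurable_edist measurable_const

/-- Transports are regular only near the diagonal and need not be measurable elsewhere. Every
argument that needs a measurable density is therefore carried out on pairs at distance less than
this δ. -/
theorem IsTransport.exists_aemeasurable_gagDensity (hP : IsTransport P) :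
    ∃ δ : ℝ≥0∞, 0 < δ ∧ ∀ {ν k : ℕ} {T : TensorField m M ν k} {σ p : ℝ}, T.IsMeas →
      ∀ {ρ : ℝ≥0∞}, ρ ≤ δ → AEMeasurable (gagDensity P σ p T)
        (((riemVol m M).prod (riemVol m M)).restrict (nearDiag M ρ)) := by
  have := secondCountableTopology (M := M)
  obtain ⟨δ, hδ, h⟩ := hP.exists_aemeasurable_diffNorm
  refine ⟨δ, hδ, fun {ν k T σ p} hT {ρ} hρ => ?_⟩
  refine AEMeasurable.div (((h hT).mono_set fun q hq => lt_of_lt_of_le hq hρ).pow_const p) ?_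
  exact (measurable_edist.pow_const _).aemeasurable

theorem IsGoodBall.lintegral_prod_le {c : M} {z₁ : 𝔼} {R : ℝ} {C : ℝ≥0}
    (h : IsGoodBall c z₁ R C) {g : M × M → ℝ≥0∞}
    (hg : AEMeasurable g ((riemVol m M).prod (riemVol m M))) :
    ∫⁻ z in closedBall z₁ R, ∫⁻ w in closedBall z₁ R, g (Φ[c] w, Φ[c] z) ≤
      (C : ℝ≥0∞) ^ m * C ^ m * ∫⁻ q, g q ∂((riemVol m M).prod (riemVol m M)) := by
  have := isFiniteMeasure_riemVol (m := m) (M := M)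
  set K := closedBall z₁ R with hK
  set κ := Measure.map (ballParam c z₁ R) (volume.restrict K) with hκ
  have hm := h.measurable_ballParam
  have hle : κ ≤ ((C : ℝ≥0∞) ^ m) • riemVol m M := h.map_ballParam_le
  have : IsFiniteMeasure κ := by
    have : IsFiniteMeasure (volume.restrict K) :=
      ⟨by rw [Measure.restrict_apply_univ]; exact measure_closedBall_lt_top⟩
    exact Measure.isFiniteMeasure_map _ _
  have hac : κ ≪ riemVol m M := hle.absolutelyContinuous.trans Measure.smul_absolutelyContinuous
  have hgκ : AEMeasurable g (κ.prod κ) := hg.mono_ac (hac.prod hac)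
  have hmap : Measure.map (Prod.map (ballParam c z₁ R) (ballParam c z₁ R))
      ((volume.restrict K).prod (volume.restrict K)) = κ.prod κ :=
    (Measure.map_prod_map _ _ hm hm).symm
  calc ∫⁻ z in K, ∫⁻ w in K, g (Φ[c] w, Φ[c] z)
      = ∫⁻ z in K, ∫⁻ w in K, g (ballParam c z₁ R w, ballParam c z₁ R z) := by
        refine setLIntegral_congr_fun measurableSet_closedBall fun z hz =>
          setLIntegral_congr_fun measurableSet_closedBall fun w hw => ?_
        simp only [ballParam_eq hz, ballParam_eq hw]
    _ = ∫⁻ q, g q ∂(κ.prod κ) := by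
        rw [← hmap, lintegral_map' (by rwa [hmap]) (hm.prodMap hm).aemeasurable,
          lintegral_prod_symm]
        · rfl
        · refine AEMeasurable.comp_measurable ?_ (hm.prodMap hm)
          rwa [hmap]
    _ ≤ ∫⁻ q, g q ∂((((C : ℝ≥0∞) ^ m) • riemVol m M).prod (((C : ℝ≥0∞) ^ m) • riemVol m M)) :=
        lintegral_mono' (Measure.prod_mono hle hle) le_rfl
    _ = _ := by
        rw [Measure.prod_smul_left, Measure.prod_smul_right, smul_smul, lintegral_smul_measure,
          smul_eq_mul]

/-- The height of the mollifier is dominated by the singular kernel: δ⁻ᵐ ≤ δ^(-α) because δ ≤ 1 and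
m ≤ α, and δ^(-α) ≤ C^α d^(-α) because d ≤ C δ. -/
theorem IsGoodBall.ofReal_le_edist_rpow {c : M} {z₁ : 𝔼} {R : ℝ} {C : ℝ≥0}
    (h : IsGoodBall c z₁ R C) {δ : ℝ≥0} (hδ : 0 < δ) (hδ1 : δ ≤ 1) {b B : ℝ} (hb : b ≤ B / δ ^ m)
    {α : ℝ} (hα : m ≤ α) {x y : M} (hd : edist x y ≤ C * δ) :
    ENNReal.ofReal b ≤ ENNReal.ofReal B * (C : ℝ≥0∞) ^ α * (edist x y ^ α)⁻¹ := by
  have hα0 : 0 ≤ α := (Nat.cast_nonneg m).trans hα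
  have hC0 : (C : ℝ≥0∞) ^ α ≠ 0 := by
    have : (C : ℝ≥0∞) ≠ 0 := by
      simpa using (zero_lt_one.trans_le h.one_le).ne'
    simp [ENNReal.rpow_eq_zero_iff, this]
  have hCt : (C : ℝ≥0∞) ^ α ≠ ⊤ := ENNReal.rpow_ne_top_of_nonneg hα0 ENNReal.coe_ne_top
  have h1 : edist x y ^ α ≤ (C : ℝ≥0∞) ^ α * (δ : ℝ≥0∞) ^ α := by
    rw [← ENNReal.mul_rpow_of_nonneg _ _ hα0]
    exact ENNReal.rpow_le_rpow hd hα0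
  have h2 : ((δ : ℝ≥0∞) ^ α)⁻¹ ≤ (C : ℝ≥0∞) ^ α * (edist x y ^ α)⁻¹ := by
    calc ((δ : ℝ≥0∞) ^ α)⁻¹ = (C : ℝ≥0∞) ^ α * ((C : ℝ≥0∞) ^ α * (δ : ℝ≥0∞) ^ α)⁻¹ := by
          rw [ENNReal.mul_inv (Or.inl hC0) (Or.inl hCt), ← mul_assoc,
            ENNReal.mul_inv_cancel hC0 hCt, one_mul]
      _ ≤ _ := by gcongr
  have h3 : ENNReal.ofReal (B / δ ^ m) ≤ ENNReal.ofReal B * ((δ : ℝ≥0∞) ^ α)⁻¹ := by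
    have hδm : (0 : ℝ) < (δ : ℝ) ^ m := by positivity
    rw [ENNReal.ofReal_div_of_pos hδm, div_eq_mul_inv, ENNReal.ofReal_pow δ.coe_nonneg,
      ENNReal.ofReal_coe_nnreal, ← ENNReal.rpow_natCast]
    refine mul_le_mul_right (ENNReal.inv_le_inv.2 ?_) _
    exact ENNReal.rpow_le_rpow_of_exponent_ge (ENNReal.coe_le_one_iff.2 hδ1) hα
  refine (ENNReal.ofReal_le_ofReal hb).trans (h3.trans ?_)
  rw [mul_assoc]
  gcongr

/-- The oscillation of a tensor field is controlled by its Gagliardo energy near the diagonal. -/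
theorem IsGoodBall.oscillation_le_gagliardo {c : M} {z₁ : 𝔼} {R : ℝ} {C : ℝ≥0}
    (h : IsGoodBall c z₁ R C) {σ p : ℝ} (hσ : 0 < σ) (hp : 1 ≤ p) {δ : ℝ≥0} (hδ : 0 < δ)
    (hδ1 : δ ≤ 1) (hδR : δ ≤ R / 4)
    {φ : EuclideanSpace ℝ (Fin m) → ℝ} (hφ : ContDiff ℝ ∞ φ) (h0 : ∀ x, 0 ≤ φ x)
    (hs : tsupport φ ⊆ closedBall 0 δ) (h1 : ∫ x, φ x = 1) {B : ℝ}
    (hφB : ∀ x, φ x ≤ B / δ ^ m) {η : ℝ≥0} (hη : η ≤ 1)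
    (hPδ : ∀ z ∈ closedBall z₁ R, ∀ w ∈ closedBall z₁ R,
        dist z w ≤ δ → ∃ B : 𝔼 →L[ℝ] 𝔼, ‖B - ContinuousLinearMap.id ℝ 𝔼‖ ≤ η ∧
          ∀ v, P (Φ[c] z) (Φ[c] w) (paramDeriv c z v) = paramDeriv c w (B v))
    {S : TensorField m M ν k} (hS : S.IsMeas) {ρ : ℝ≥0∞} (hρ : C * δ < ρ)
    (hm : AEMeasurable (gagDensity P σ p S)
        (((riemVol m M).prod (riemVol m M)).restrict (nearDiag M ρ))) (L : Fin k → Fin m) :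
    oscillation p φ c (closedBall z₁ (R / 2)) S L ≤
      2 ^ (p - 1) * (((C ^ k : ℝ≥0) : ℝ≥0∞) ^ p *
        (ENNReal.ofReal B * (C : ℝ≥0∞) ^ ((m : ℝ) + σ * p)) *
        ((C : ℝ≥0∞) ^ m * C ^ m) * gagliardo P σ p (nearDiag M ρ) S +
        ((k * (2 * C) ^ (k - 1) * C * η : ℝ≥0) : ℝ≥0∞) ^ p * C ^ m * energy m p S) := by
  have hp0 : 0 < p := by linarith
  have hR := h.pos
  have hα : (m : ℝ) ≤ m + σ * p := le_add_of_nonneg_right (by positivity)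
  have h2t : (2 : ℝ≥0∞) ^ (p - 1) ≠ ⊤ := ENNReal.rpow_ne_top_of_nonneg (by linarith) (by simp)
  set D : ℝ≥0 := k * (2 * C) ^ (k - 1) * C * η with hD
  have hDt : (D : ℝ≥0∞) ^ p ≠ ⊤ := ENNReal.rpow_ne_top_of_nonneg hp0.le ENNReal.coe_ne_top
  set E : ℝ≥0∞ := ((C ^ k : ℝ≥0) : ℝ≥0∞) ^ p *
        (ENNReal.ofReal B * (C : ℝ≥0∞) ^ ((m : ℝ) + σ * p)) with hE
  have hEt : E ≠ ⊤ := ENNReal.mul_ne_top (ENNReal.rpow_ne_top_of_nonneg hp0.le ENNReal.coe_ne_top)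
    (ENNReal.mul_ne_top ENNReal.ofReal_ne_top
      (ENNReal.rpow_ne_top_of_nonneg (by positivity) ENNReal.coe_ne_top))
  set V := closedBall z₁ (R / 2) with hV
  set K := closedBall z₁ R with hK
  have hVK : V ⊆ K := closedBall_subset_closedBall (by linarith)
  -- Extending the density by zero makes it measurable on the whole product, so that
  -- `IsGoodBall.lintegral_prod_le` applies.
  set g : M × M → ℝ≥0∞ := (nearDiag M ρ).indicator (gagDensity P σ p S) with hg
  have hgm : AEMeasurable g ((riemVol m M).prod (riemVol m M)) :=
    (aemeasurable_indicator_iff (measurableSet_nearDiag M ρ)).2 hm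
  have iφ : Integrable φ := by
    by_contra h
    rw [integral_undef h] at h1
    exact zero_ne_one h1
  have hφl : ∫⁻ h, ENNReal.ofReal (φ h) = 1 := by
    rw [← ofReal_integral_eq_lintegral_ofReal iφ (Eventually.of_forall h0), h1,
      ENNReal.ofReal_one]
  have hpt : ∀ z ∈ V, ∀ w, ENNReal.ofReal (φ (z - w)) *
      ‖S.inChart c z (coordFrame L) - S.inChart c w (coordFrame L)‖ₑ ^ p ≤
      2 ^ (p - 1) * (E * K.indicator (fun w => g (Φ[c] w, Φ[c] z)) w +
        ENNReal.ofReal (φ (z - w)) * ((D : ℝ≥0∞) ^ p * ‖S (Φ[c] z)‖ₑ ^ p)) := by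
    intro z hz w
    by_cases hw : z - w ∈ closedBall (0 : 𝔼) δ
    swap
    · rw [image_eq_zero_of_notMem_tsupport fun h' => hw (hs h'), ENNReal.ofReal_zero, zero_mul]
      exact zero_le
    rw [mem_closedBall_zero_iff, ← dist_eq_norm, dist_comm] at hw
    have hwK : w ∈ K := by
      rw [mem_closedBall] at hz ⊢
      linarith [dist_triangle w z z₁]
    have hzK := hVK hz
    -- The two points are exchanged on purpose: the error term then contains S at z only, and the
    -- integral of φ(z - w) over w equals one.
    obtain ⟨X, hX, hPX⟩ := hPδ w hwK z hzK hw
    have h3 := h.enorm_inChart_sub_le hwK hzK hη hX hPX S L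
    have hd : edist (Φ[c] w) (Φ[c] z) ≤ C * δ := by
      refine (h.edist_le w hwK z hzK).trans ?_
      gcongr
      rw [edist_dist, ← ENNReal.ofReal_coe_nnreal]
      exact ENNReal.ofReal_le_ofReal hw
    rw [indicator_of_mem hwK, hg, indicator_of_mem (show (Φ[c] w, Φ[c] z) ∈ nearDiag M ρ from
      lt_of_le_of_lt hd hρ), gagDensity]
    have h4 := h.ofReal_le_edist_rpow hδ hδ1 (hφB (z - w)) hα hd
    rw [enorm_sub_rev]
    have h5 : ‖S.inChart c w (coordFrame L) - S.inChart c z (coordFrame L)‖ₑ ^ p ≤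
        2 ^ (p - 1) * (((C ^ k : ℝ≥0) : ℝ≥0∞) ^ p * diffNorm P S (Φ[c] w, Φ[c] z) ^ p +
          (D : ℝ≥0∞) ^ p * ‖S (Φ[c] z)‖ₑ ^ p) := by
      refine (ENNReal.rpow_le_rpow h3 hp0.le).trans
        ((ENNReal.rpow_add_le_mul_rpow_add_rpow _ _ hp).trans (le_of_eq ?_))
      rw [ENNReal.mul_rpow_of_nonneg _ _ hp0.le, ENNReal.mul_rpow_of_nonneg _ _ hp0.le]
    calc ENNReal.ofReal (φ (z - w)) *
          ‖S.inChart c w (coordFrame L) - S.inChart c z (coordFrame L)‖ₑ ^ p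
        ≤ ENNReal.ofReal (φ (z - w)) * (2 ^ (p - 1) *
          (((C ^ k : ℝ≥0) : ℝ≥0∞) ^ p * diffNorm P S (Φ[c] w, Φ[c] z) ^ p +
          (D : ℝ≥0∞) ^ p * ‖S (Φ[c] z)‖ₑ ^ p)) := by gcongr
      _ = 2 ^ (p - 1) * (((C ^ k : ℝ≥0) : ℝ≥0∞) ^ p * diffNorm P S (Φ[c] w, Φ[c] z) ^ p *
          ENNReal.ofReal (φ (z - w)) +
          ENNReal.ofReal (φ (z - w)) * ((D : ℝ≥0∞) ^ p * ‖S (Φ[c] z)‖ₑ ^ p)) := by ring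
      _ ≤ 2 ^ (p - 1) * (((C ^ k : ℝ≥0) : ℝ≥0∞) ^ p * diffNorm P S (Φ[c] w, Φ[c] z) ^ p *
          (ENNReal.ofReal B * (C : ℝ≥0∞) ^ ((m : ℝ) + σ * p) *
            (edist (Φ[c] w) (Φ[c] z) ^ ((m : ℝ) + σ * p))⁻¹) +
          ENNReal.ofReal (φ (z - w)) * ((D : ℝ≥0∞) ^ p * ‖S (Φ[c] z)‖ₑ ^ p)) := by gcongr
      _ = _ := by
          rw [hE, div_eq_mul_inv]
          ring
  have hz1 : ∀ z ∈ V, ∫⁻ w, ENNReal.ofReal (φ (z - w)) *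
      ‖S.inChart c z (coordFrame L) - S.inChart c w (coordFrame L)‖ₑ ^ p ≤
      2 ^ (p - 1) * (E * (∫⁻ w in K, g (Φ[c] w, Φ[c] z)) +
        (D : ℝ≥0∞) ^ p * ‖S (Φ[c] z)‖ₑ ^ p) := fun z hz => by
    refine (lintegral_mono (hpt z hz)).trans (le_of_eq ?_)
    have hmw : Measurable fun w => ENNReal.ofReal (φ (z - w)) :=
      (hφ.continuous.measurable.comp (measurable_const.sub measurable_id)).ennreal_ofReal
    rw [lintegral_const_mul' _ _ h2t, lintegral_add_right _ (hmw.mul_const _),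
      lintegral_const_mul' _ _ hEt, lintegral_indicator measurableSet_closedBall,
      lintegral_mul_const _ hmw, lintegral_sub_left_eq_self (fun w => ENNReal.ofReal (φ w)) z, hφl,
      one_mul]
  have hSV : AEMeasurable (fun z => (D : ℝ≥0∞) ^ p * ‖S (Φ[c] z)‖ₑ ^ p) (volume.restrict V) :=
    (((hS.aemeasurable_enorm_chart c).mono_set (hVK.trans h.subset)).pow_const p).const_mul _
  refine (setLIntegral_mono' measurableSet_closedBall hz1).trans ?_
  rw [lintegral_const_mul' _ _ h2t, lintegral_add_right' _ hSV, lintegral_const_mul' _ _ hEt,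
    lintegral_const_mul' _ _ hDt]
  refine mul_le_mul_right (add_le_add ?_ ?_) _
  · rw [mul_assoc E]
    refine mul_le_mul_right ((lintegral_mono_set hVK).trans ((h.lintegral_prod_le hgm).trans ?_)) _
    rw [hg, lintegral_indicator (measurableSet_nearDiag M ρ), gagliardo_eq]
  · rw [mul_assoc ((D : ℝ≥0∞) ^ p)]
    refine mul_le_mul_right ((lintegral_mono_set hVK).trans ?_) _
    exact h.lintegral_symm_le (hS.aemeasurable_enorm.pow_const p)

end Gagliardo

/-- Absorption of a small multiple of the left side; it fails for x = ⊤, and this is why finite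
energies are assumed in the estimates below. -/
theorem le_two_mul_of_le_add_half {x a : ℝ≥0∞} (hx : x ≠ ⊤) (h : x ≤ a + 2⁻¹ * x) : x ≤ 2 * a := by
  have h1 : 2⁻¹ * x + 2⁻¹ * x = x := by
    rw [← add_mul, ENNReal.inv_two_add_inv_two, one_mul]
  have h2 : 2⁻¹ * x ≤ a := by
    have h3 : 2⁻¹ * x ≠ ⊤ := ENNReal.mul_ne_top (by simp) hx
    refine ENNReal.le_of_add_le_add_right h3 ?_
    rw [h1]
    exact h
  calc x = 2 * (2⁻¹ * x) := by rw [two_mul, h1]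
    _ ≤ 2 * a := by gcongr

theorem inv_four_add_inv_four : (4⁻¹ + 4⁻¹ : ℝ≥0∞) = 2⁻¹ := by
  rw [← two_mul, show (4 : ℝ≥0∞) = 2 * 2 by norm_num, ENNReal.mul_inv (by simp) (by simp),
    ← mul_assoc, ENNReal.mul_inv_cancel (by simp) (by simp), one_mul]

theorem exists_pos_mul_le (A : ℝ≥0) : ∃ ε : ℝ≥0∞, 0 < ε ∧ A * ε ≤ 4⁻¹ := by
  refine ⟨4⁻¹ / (A + 1), ENNReal.div_pos (by simp) (by finiteness), ?_⟩
  calc (A : ℝ≥0∞) * (4⁻¹ / (A + 1)) ≤ (A + 1) * (4⁻¹ / (A + 1)) := by gcongr; simp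
    _ = 4⁻¹ := ENNReal.mul_div_cancel (by simp) (by finiteness)

/-! ### The coercivity estimate for all derivatives up to order k. -/

section Chain

variable {m : ℕ} {M : Type*} [EMetricSpace M] [ChartedSpace (EuclideanSpace ℝ (Fin m)) M]

local notation "𝔼" => EuclideanSpace ℝ (Fin m)
local notation "Φ[" c "]" => PartialEquiv.symm (extChartAt (𝓡 m) c)
local notation "TM" => (TangentSpace (𝓡 m) : M → Type _)

variable [IsManifold (𝓡 m) ∞ M] [RiemannianBundle (fun x : M => TangentSpace (𝓡 m) x)]
  [IsContMDiffRiemannianBundle (𝓡 m) ∞ (EuclideanSpace ℝ (Fin m))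
    (fun x : M => TangentSpace (𝓡 m) x)]
  [IsRiemannianManifold (𝓡 m) M] [MeasurableSpace M] [BorelSpace M]

variable {ν k : ℕ} [CompactSpace M]
variable {P : ∀ x y : M, TangentSpace (𝓡 m) x →L[ℝ] TangentSpace (𝓡 m) y}

/-- The order of quantifiers is the point: C₀ precedes η and ρ. Shrinking δ below ρ affects only A,
because the bound of the mollifier by the singular kernel has a constant independent of δ. -/
theorem IsTransport.exists_lintegral_le_gagliardo (hP : IsTransport P) {σ p : ℝ} (hσ : 0 < σ)
    (hp : 1 ≤ p) (ν k : ℕ) (c : M) :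
    ∃ R C, IsGoodBall c (extChartAt (𝓡 m) c c) R C ∧ ∃ C₀ : ℝ≥0, ∀ η : ℝ≥0∞, 0 < η →
      ∀ ρ : ℝ≥0∞, 0 < ρ → ∃ A : ℝ≥0, ∀ (T : TensorField m M ν k) (S : TensorField m M ν (k + 1)),
        IsWeakCovDeriv T S → energy m p T < ⊤ → energy m p S < ⊤ →
        ∫⁻ x in Φ[c] '' closedBall (extChartAt (𝓡 m) c c) (R / 2), ‖S x‖ₑ ^ p ∂(riemVol m M) ≤
          C₀ * gagliardo P σ p (nearDiag M ρ) S + η * energy m p S + A * energy m p T := by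
  have hp0 : 0 < p := by linarith
  obtain ⟨R, C, h, hB⟩ := hP.exists_isGoodBall c
  refine ⟨R, C, h, ?_⟩
  have hR := h.pos
  obtain ⟨δm, hδm, hmeas⟩ := hP.exists_aemeasurable_gagDensity
  obtain ⟨Λ, hΛ⟩ := h.exists_lintegral_le_oscillation hp ν k
  obtain ⟨B, hB0, hmol⟩ := exists_mollifier m
  have h2t : (2 : ℝ≥0∞) ^ (p - 1) ≠ ⊤ := ENNReal.rpow_ne_top_of_nonneg (by linarith) (by simp)
  set N : ℝ≥0∞ := (Fintype.card (Fin (k + 1) → Fin m) : ℝ≥0∞) with hN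
  set E : ℝ≥0∞ := ((C ^ (k + 1) : ℝ≥0) : ℝ≥0∞) ^ p *
    (ENNReal.ofReal B * (C : ℝ≥0∞) ^ ((m : ℝ) + σ * p)) * ((C : ℝ≥0∞) ^ m * C ^ m) with hE
  have hEt : E ≠ ⊤ := ENNReal.mul_ne_top (ENNReal.mul_ne_top
    (ENNReal.rpow_ne_top_of_nonneg hp0.le ENNReal.coe_ne_top)
    (ENNReal.mul_ne_top ENNReal.ofReal_ne_top
      (ENNReal.rpow_ne_top_of_nonneg (by positivity) ENNReal.coe_ne_top))) (by finiteness)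
  have hC₀t : Λ * N * 2 ^ (p - 1) * E ≠ ⊤ :=
    ENNReal.mul_ne_top (ENNReal.mul_ne_top (by finiteness) h2t) hEt
  refine ⟨(Λ * N * 2 ^ (p - 1) * E).toNNReal, fun η hη ρ hρ => ?_⟩
  rw [ENNReal.coe_toNNReal hC₀t]
  -- η₀ is the admitted deviation of the transport from the identity, so small that its total
  -- contribution stays below η times the energy of S.
  obtain ⟨η₀, hη₀, hη₀1, hη₀η⟩ := exists_pos_mul_rpow_le
    (c := (Λ : ℝ≥0∞) * N * 2 ^ (p - 1) * (C : ℝ≥0∞) ^ m) (η := η)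
    (ENNReal.mul_ne_top (ENNReal.mul_ne_top (by finiteness) h2t) (by finiteness)) hη
    ((k + 1 : ℕ) * (2 * C) ^ (k + 1 - 1) * C) hp0 one_pos
  obtain ⟨δ₀, hδ₀, hPδ⟩ := hB η₀ hη₀
  -- The constraints on δ come in turn from the comparison of kernels, the room inside the chart
  -- ball, the closeness of the transport to the identity, and the need for all pairs used to lie in
  -- both the ρ-neighbourhood of the diagonal and the region of measurability.
  obtain ⟨δ, hδ, hδ1, hδR, hδδ₀, hδρ⟩ : ∃ δ : ℝ≥0, 0 < δ ∧ δ < 1 ∧ (δ : ℝ) < R / 4 ∧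
      (δ : ℝ) < δ₀ ∧ (C : ℝ≥0∞) * δ < min ρ δm := by
    have h1 : ∀ r : ℝ, 0 < r → ∀ᶠ δ : ℝ≥0 in 𝓝 0, (δ : ℝ) < r := fun r hr =>
      NNReal.continuous_coe.continuousAt.eventually_lt continuousAt_const (by simpa using hr)
    have h2 : ∀ᶠ δ : ℝ≥0 in 𝓝 0, (C : ℝ≥0∞) * δ < min ρ δm := by
      have h3 : Continuous fun δ : ℝ≥0 => ((C * δ : ℝ≥0) : ℝ≥0∞) :=
        ENNReal.continuous_coe.comp (continuous_const.mul continuous_id)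
      have h4 := h3.tendsto 0
      rw [mul_zero, ENNReal.coe_zero] at h4
      simpa using h4.eventually_lt_const (lt_min hρ hδm)
    have h5 : ∀ᶠ δ : ℝ≥0 in 𝓝[>] 0, 0 < δ ∧ (δ : ℝ) < 1 ∧ (δ : ℝ) < R / 4 ∧
      (δ : ℝ) < δ₀ ∧ (C : ℝ≥0∞) * δ < min ρ δm :=
      eventually_mem_nhdsWithin.and (nhdsWithin_le_nhds ((h1 1 one_pos).and
        ((h1 (R / 4) (by linarith)).and ((h1 δ₀ hδ₀).and h2))))
    obtain ⟨δ, a1, a2, a3, a4, a5⟩ := h5.exists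
    exact ⟨δ, a1, by exact_mod_cast a2, a3, a4, a5⟩
  obtain ⟨φ, hφ, h0, hs, h1, hφB⟩ := hmol δ (by exact_mod_cast hδ)
  obtain ⟨A, hA⟩ := hΛ hδR.le hφ h0 hs h1
  refine ⟨A, fun T S hTS hT hS => (hA T S hTS hT hS).trans (add_le_add ?_ le_rfl)⟩
  have hSm := hTS.isMeas_right
  have hmono : gagliardo P σ p (nearDiag M (min ρ δm)) S ≤ gagliardo P σ p (nearDiag M ρ) S :=
    lintegral_mono_set fun q (hq : edist q.1 q.2 < min ρ δm) => hq.trans_le (min_le_left _ _)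
  have hosc := h.oscillation_le_gagliardo hσ hp hδ hδ1.le hδR.le hφ h0 hs h1 hφB
    (by exact_mod_cast hη₀1) (fun z hz w hw hzw => hPδ z hz w hw (hzw.trans hδδ₀.le)) hSm hδρ
    (hmeas hSm (min_le_right _ _))
  calc (Λ : ℝ≥0∞) * ∑ L, oscillation p φ c (closedBall (extChartAt (𝓡 m) c c) (R / 2)) S L
      ≤ Λ * ∑ _L : Fin (k + 1) → Fin m, 2 ^ (p - 1) * (E *
          gagliardo P σ p (nearDiag M (min ρ δm)) S +
          (((k + 1 : ℕ) * (2 * C) ^ (k + 1 - 1) * C * η₀ : ℝ≥0) : ℝ≥0∞) ^ p * C ^ m *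
          energy m p S) := by
        gcongr with L
        exact hosc L
    _ = Λ * N * 2 ^ (p - 1) * E * gagliardo P σ p (nearDiag M (min ρ δm)) S +
          (Λ * N * 2 ^ (p - 1) * C ^ m *
          (((k + 1 : ℕ) * (2 * C) ^ (k + 1 - 1) * C * η₀ : ℝ≥0) : ℝ≥0∞) ^ p) * energy m p S := by
        rw [Finset.sum_const, Finset.card_univ, nsmul_eq_mul]
        ring
    _ ≤ _ := add_le_add (mul_le_mul_right hmono _) (mul_le_mul_left hη₀η _)

theorem IsTransport.exists_energy_le_gagliardo (hP : IsTransport P) {σ p : ℝ} (hσ : 0 < σ)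
    (hp : 1 ≤ p) (ν k : ℕ) :
    ∃ C₀ : ℝ≥0, ∀ η : ℝ≥0∞, 0 < η → ∀ ρ : ℝ≥0∞, 0 < ρ → ∃ A : ℝ≥0,
      ∀ (T : TensorField m M ν k) (S : TensorField m M ν (k + 1)),
        IsWeakCovDeriv T S → energy m p T < ⊤ → energy m p S < ⊤ →
        energy m p S ≤
          C₀ * gagliardo P σ p (nearDiag M ρ) S + η * energy m p S + A * energy m p T := by
  choose R C hR C₀ hC₀ using hP.exists_lintegral_le_gagliardo hσ hp ν k
  obtain ⟨t, ht⟩ := exists_finset_lintegral_le m M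
    (p := fun c => Φ[c] '' closedBall (extChartAt (𝓡 m) c c) (R c / 2))
    fun c => by simpa using (hR c).image_mem_nhds (half_pos (hR c).pos)
  refine ⟨∑ c ∈ t, C₀ c, fun η hη ρ hρ => ?_⟩
  have hη' : 0 < η / (t.card + 1 : ℕ) := ENNReal.div_pos hη.ne' (ENNReal.natCast_ne_top _)
  choose A hA using fun c => hC₀ c _ hη' ρ hρ
  refine ⟨∑ c ∈ t, A c, fun T S hTS hT hS => (ht _).trans ?_⟩
  refine (Finset.sum_le_sum fun c _ => hA c T S hTS hT hS).trans ?_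
  rw [Finset.sum_add_distrib, Finset.sum_add_distrib, Finset.sum_const, nsmul_eq_mul,
    ← Finset.sum_mul, ← Finset.sum_mul, ← mul_assoc]
  push_cast
  gcongr
  refine (mul_le_mul_left (b := (t.card : ℝ≥0∞)) (c := (t.card + 1 : ℝ≥0∞)) (by simp) _).trans
    (le_of_eq ?_)
  exact ENNReal.mul_div_cancel (by simp) (by finiteness)

/-- By induction on j: interpolate the order j + 1 between j and j + 2, insert the bound for order j
with a small ε', and absorb two quarters of the energy of order j + 1. -/
theorem exists_energy_le_succ (ν : ℕ) {p : ℝ} (hp : 1 ≤ p) (j : ℕ) : ∀ ε : ℝ≥0∞, 0 < ε →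
    ∃ A : ℝ≥0, ∀ D : ∀ i, TensorField m M ν i, (∀ i < j + 1, IsWeakCovDeriv (D i) (D (i + 1))) →
      (∀ i ≤ j, energy m p (D i) < ⊤) →
      energy m p (D j) ≤ ε * energy m p (D (j + 1)) + A * energy m p (D 0) := by
  induction j with
  | zero => exact fun ε _ => ⟨1, fun D _ _ => by simp⟩
  | succ j ih =>
    intro ε hε
    obtain ⟨A, hA⟩ := exists_energy_le_interpolation (m := m) (M := M) ν j hp
      (η := min (ε / 2) 4⁻¹) (lt_min (ENNReal.half_pos hε.ne') (by simp))
    obtain ⟨ε', hε', hAε'⟩ := exists_pos_mul_le A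
    obtain ⟨A', hA'⟩ := ih ε' hε'
    refine ⟨2 * (A * A'), fun D hD hfin => ?_⟩
    have h1 := hA (D j) (D (j + 1)) (D (j + 2)) (hD j (by omega)) (hD (j + 1) (by omega))
      (hfin j (by omega)) (hfin (j + 1) le_rfl)
    have h2 := hA' D (fun i hi => hD i (by omega)) (fun i hi => hfin i (by omega))
    set x := energy m p (D (j + 1))
    set y := energy m p (D (j + 2))
    set a := energy m p (D 0)
    have h3 : x ≤ (ε / 2 * y + A * A' * a) + 2⁻¹ * x := by
      calc x ≤ min (ε / 2) 4⁻¹ * (y + x) + A * energy m p (D j) := h1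
        _ ≤ min (ε / 2) 4⁻¹ * (y + x) + A * (ε' * x + A' * a) := by gcongr
        _ = min (ε / 2) 4⁻¹ * y + min (ε / 2) 4⁻¹ * x + (A * ε') * x + A * A' * a := by ring
        _ ≤ ε / 2 * y + 4⁻¹ * x + 4⁻¹ * x + A * A' * a := by
            gcongr
            · exact min_le_left _ _
            · exact min_le_right _ _
        _ = (ε / 2 * y + A * A' * a) + (4⁻¹ + 4⁻¹) * x := by ring
        _ = _ := by rw [inv_four_add_inv_four]
    refine (le_two_mul_of_le_add_half (hfin (j + 1) le_rfl).ne h3).trans (le_of_eq ?_)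
    rw [mul_add, ← mul_assoc, ENNReal.mul_div_cancel (by simp) (by simp)]
    push_cast
    ring

/-- All derivatives up to the order `k` are controlled by the function itself and by the Gagliardo
energy near the diagonal of the `k`-th derivative. -/
theorem IsTransport.exists_energy_le (hP : IsTransport P) {σ p : ℝ} (hσ : 0 < σ)
    (hp : 1 ≤ p) (ν k : ℕ) :
    ∃ C₀ : ℝ≥0, ∀ ρ : ℝ≥0∞, 0 < ρ → ∃ A : ℝ≥0,
      ∀ D : ∀ i, TensorField m M ν i, (∀ i < k, IsWeakCovDeriv (D i) (D (i + 1))) →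
        (∀ i ≤ k, energy m p (D i) < ⊤) → ∀ i ≤ k,
        energy m p (D i) ≤ C₀ * gagliardo P σ p (nearDiag M ρ) (D k) + A * energy m p (D 0) := by
  rcases k with _ | j
  · refine ⟨0, fun ρ _ => ⟨1, fun D _ _ i hi => ?_⟩⟩
    obtain rfl := Nat.le_zero.1 hi
    simp
  obtain ⟨C₀, hC₀⟩ := hP.exists_energy_le_gagliardo hσ hp ν j
  choose A₁ hA₁ using fun i => exists_energy_le_succ (m := m) (M := M) ν hp i 1 one_pos
  refine ⟨2 * C₀, fun ρ hρ => ?_⟩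
  obtain ⟨A, hA⟩ := hC₀ 4⁻¹ (by simp) ρ hρ
  obtain ⟨ε', hε', hAε'⟩ := exists_pos_mul_le A
  obtain ⟨A', hA'⟩ := exists_energy_le_succ (m := m) (M := M) ν hp j ε' hε'
  refine ⟨2 * (A * A') + ∑ i ∈ Finset.range (j + 1), A₁ i, fun D hD hfin => ?_⟩
  -- The top order is bounded by the Gagliardo energy and the order j; the latter is interpolated
  -- between the orders j + 1 and 0, and two quarters of the top energy are absorbed.
  have htop : energy m p (D (j + 1)) ≤ (2 * C₀ : ℝ≥0) * gagliardo P σ p (nearDiag M ρ) (D (j + 1)) +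
      (2 * (A * A') : ℝ≥0) * energy m p (D 0) := by
    have h1 := hA (D j) (D (j + 1)) (hD j (by omega)) (hfin j (by omega)) (hfin (j + 1) le_rfl)
    have h2 := hA' D hD (fun i hi => hfin i (by omega))
    set x := energy m p (D (j + 1))
    set g := gagliardo P σ p (nearDiag M ρ) (D (j + 1))
    set a := energy m p (D 0)
    have h3 : x ≤ (C₀ * g + A * A' * a) + 2⁻¹ * x := by
      calc x ≤ C₀ * g + 4⁻¹ * x + A * energy m p (D j) := h1
        _ ≤ C₀ * g + 4⁻¹ * x + A * (ε' * x + A' * a) := by gcongr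
        _ = C₀ * g + 4⁻¹ * x + (A * ε') * x + A * A' * a := by ring
        _ ≤ C₀ * g + 4⁻¹ * x + 4⁻¹ * x + A * A' * a := by gcongr
        _ = (C₀ * g + A * A' * a) + (4⁻¹ + 4⁻¹) * x := by ring
        _ = _ := by rw [inv_four_add_inv_four]
    refine (le_two_mul_of_le_add_half (hfin (j + 1) le_rfl).ne h3).trans (le_of_eq ?_)
    push_cast
    ring
  -- Lower orders follow by descending one order at a time with ε = 1, so the coefficient of the top
  -- energy stays one.
  have hdown : ∀ n ≤ j + 1, energy m p (D (j + 1 - n)) ≤ energy m p (D (j + 1)) +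
      (∑ i ∈ Finset.Ico (j + 1 - n) (j + 1), A₁ i : ℝ≥0) * energy m p (D 0) := by
    intro n
    induction n with
    | zero => exact fun _ => by simp
    | succ n ih =>
      intro hn
      have h1 := hA₁ (j + 1 - (n + 1)) D (fun i hi => hD i (by omega))
        (fun i hi => hfin i (by omega))
      have h2 : j + 1 - (n + 1) + 1 = j + 1 - n := by omega
      rw [Finset.sum_eq_sum_Ico_succ_bot (by omega), h2]
      rw [h2, one_mul] at h1
      refine h1.trans ((add_le_add (ih (by omega)) le_rfl).trans (le_of_eq ?_))
      push_cast
      ring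
  intro i hi
  have h1 := hdown (j + 1 - i) (by omega)
  rw [Nat.sub_sub_self hi] at h1
  have h2 : ∑ i ∈ Finset.Ico i (j + 1), A₁ i ≤ ∑ i ∈ Finset.range (j + 1), A₁ i := by
    rw [Finset.range_eq_Ico]
    exact Finset.sum_le_sum_of_subset (Finset.Ico_subset_Ico_left (Nat.zero_le _))
  refine h1.trans ((add_le_add htop (mul_le_mul_left (ENNReal.coe_le_coe.2 h2) _)).trans
    (le_of_eq ?_))
  push_cast
  ring

end Chain

theorem tendsto_rpow_inv_zero_iff {α : Type*} {p : ℝ} {l : Filter α} {f : α → ℝ≥0∞} (hp : 0 < p) :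
    Tendsto (fun a => f a ^ (1 / p)) l (𝓝 0) ↔ Tendsto f l (𝓝 0) := by
  have key : ∀ {q : ℝ} {g : α → ℝ≥0∞}, 0 < q → Tendsto g l (𝓝 0) →
      Tendsto (fun a => g a ^ q) l (𝓝 0) := fun {q g} hq hg => by
    have h := (ENNReal.continuous_rpow_const (y := q)).tendsto 0 |>.comp hg
    rwa [ENNReal.zero_rpow_of_pos hq] at h
  refine ⟨fun h => ?_, key (by positivity)⟩
  refine (key hp h).congr fun a => ?_
  rw [← ENNReal.rpow_mul, one_div, inv_mul_cancel₀ hp.ne', ENNReal.rpow_one]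

/-! ### Properties of the Lᵖ and Gagliardo energies. -/

section Energy

variable {m : ℕ} {M : Type*} [EMetricSpace M] [ChartedSpace (EuclideanSpace ℝ (Fin m)) M]

local notation "𝔼" => EuclideanSpace ℝ (Fin m)
local notation "Φ[" c "]" => PartialEquiv.symm (extChartAt (𝓡 m) c)
local notation "TM" => (TangentSpace (𝓡 m) : M → Type _)

variable [IsManifold (𝓡 m) ∞ M] [RiemannianBundle (fun x : M => TangentSpace (𝓡 m) x)]
  [IsContMDiffRiemannianBundle (𝓡 m) ∞ (EuclideanSpace ℝ (Fin m))
    (fun x : M => TangentSpace (𝓡 m) x)]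
  [IsRiemannianManifold (𝓡 m) M] [MeasurableSpace M] [BorelSpace M]

variable {ν k : ℕ} {p σ : ℝ}

theorem lpNorm_eq (T : TensorField m M ν k) : lpNorm p T = energy m p T ^ (1 / p) := rfl

theorem eLpNorm_eq_energy (hp : 1 ≤ p) (v : M → EuclideanSpace ℝ (Fin ν)) :
    eLpNorm v (ENNReal.ofReal p) (riemVol m M) = energy m p (zeroTensor (m := m) v) ^ (1 / p) := by
  have hp0 : 0 < p := by linarith
  rw [eLpNorm_eq_lintegral_rpow_enorm_toReal (by simpa using hp0) ENNReal.ofReal_ne_top,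
    ENNReal.toReal_ofReal hp0.le, energy]
  simp only [enorm_zeroTensor]

theorem energy_congr {T S : TensorField m M ν k} (h : ∀ᵐ x ∂(riemVol m M), T x = S x) :
    energy m p T = energy m p S :=
  lintegral_congr_ae (h.mono fun x hx => by simp only [hx])

theorem energy_le_of_enorm_le {k₁ k₂ : ℕ} (hp : 1 ≤ p) {T : TensorField m M ν k}
    {T₁ : TensorField m M ν k₁} {T₂ : TensorField m M ν k₂}
    (h₁ : AEMeasurable (fun x => ‖T₁ x‖ₑ) (riemVol m M))
    (h : ∀ x, ‖T x‖ₑ ≤ ‖T₁ x‖ₑ + ‖T₂ x‖ₑ) :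
    energy m p T ≤ 2 ^ (p - 1) * (energy m p T₁ + energy m p T₂) := by
  have h2t : (2 : ℝ≥0∞) ^ (p - 1) ≠ ⊤ := ENNReal.rpow_ne_top_of_nonneg (by linarith) (by simp)
  rw [energy, energy, energy, ← lintegral_add_left' (h₁.pow_const p),
    ← lintegral_const_mul' _ _ h2t]
  exact lintegral_mono fun x => (ENNReal.rpow_le_rpow (h x) (by linarith)).trans
    (ENNReal.rpow_add_le_mul_rpow_add_rpow _ _ hp)

variable [CompactSpace M]
variable {P : ∀ x y : M, TangentSpace (𝓡 m) x →L[ℝ] TangentSpace (𝓡 m) y}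

theorem ae_prod_of_ae {q : M → Prop} (h : ∀ᵐ x ∂(riemVol m M), q x) :
    ∀ᵐ z ∂((riemVol m M).prod (riemVol m M)), q z.1 ∧ q z.2 := by
  have := isFiniteMeasure_riemVol (m := m) (M := M)
  exact (Measure.quasiMeasurePreserving_fst.ae h).and (Measure.quasiMeasurePreserving_snd.ae h)

theorem gagliardo_congr {T S : TensorField m M ν k} (h : ∀ᵐ x ∂(riemVol m M), T x = S x)
    (A : Set (M × M)) : gagliardo P σ p A T = gagliardo P σ p A S := by
  refine lintegral_congr_ae (ae_restrict_of_ae ((ae_prod_of_ae h).mono fun q hq => ?_))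
  simp only [hq.1, hq.2]

theorem comp_sub {x y : M} (T S : ContinuousMultilinearMap ℝ
    (fun _ : Fin k => TangentSpace (𝓡 m) y) (EuclideanSpace ℝ (Fin ν)))
    (f : TangentSpace (𝓡 m) x →L[ℝ] TangentSpace (𝓡 m) y) :
    (T - S).compContinuousLinearMap (fun _ => f) =
      T.compContinuousLinearMap (fun _ => f) - S.compContinuousLinearMap (fun _ => f) := by
  ext v
  rfl

theorem diffNorm_sub_le (T S : TensorField m M ν k) (q : M × M) :
    diffNorm P (T - S) q ≤ diffNorm P T q + diffNorm P S q := by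
  rw [diffNorm, Pi.sub_apply, Pi.sub_apply, comp_sub, sub_sub_sub_comm]
  have h (a b : ContinuousMultilinearMap ℝ (fun _ : Fin k => TangentSpace (𝓡 m) q.1)
      (EuclideanSpace ℝ (Fin ν))) : ‖a - b‖ₑ ≤ ‖a‖ₑ + ‖b‖ₑ := enorm_sub_le
  exact h _ _

theorem diffNorm_sub_comm (T S : TensorField m M ν k) (q : M × M) :
    diffNorm P (T - S) q = diffNorm P (S - T) q := by
  rw [diffNorm, diffNorm, Pi.sub_apply, Pi.sub_apply, Pi.sub_apply, Pi.sub_apply, comp_sub,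
    comp_sub, sub_sub_sub_comm, ← enorm_neg, sub_sub_sub_comm]
  congr 1
  abel

theorem diffNorm_le_add (T S : TensorField m M ν k) (q : M × M) :
    diffNorm P T q ≤ diffNorm P (T - S) q + diffNorm P S q := by
  have h : T q.1 - (T q.2).compContinuousLinearMap (fun _ => P q.1 q.2) =
      ((T - S) q.1 - ((T - S) q.2).compContinuousLinearMap (fun _ => P q.1 q.2)) +
      (S q.1 - (S q.2).compContinuousLinearMap (fun _ => P q.1 q.2)) := by
    rw [Pi.sub_apply, Pi.sub_apply, comp_sub]
    abel
  have h' (a b : ContinuousMultilinearMap ℝ (fun _ : Fin k => TangentSpace (𝓡 m) q.1)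
      (EuclideanSpace ℝ (Fin ν))) : ‖a + b‖ₑ ≤ ‖a‖ₑ + ‖b‖ₑ := by
    rw [← ofReal_norm, ← ofReal_norm, ← ofReal_norm,
      ← ENNReal.ofReal_add (norm_nonneg _) (norm_nonneg _)]
    exact ENNReal.ofReal_le_ofReal (norm_add_le a b)
  rw [diffNorm, h]
  exact h' _ _

theorem gagliardo_le_of_diffNorm_le (hp : 1 ≤ p) {A : Set (M × M)}
    {T T₁ T₂ : TensorField m M ν k}
    (h₁ : AEMeasurable (gagDensity P σ p T₁) (((riemVol m M).prod (riemVol m M)).restrict A))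
    (h : ∀ q, diffNorm P T q ≤ diffNorm P T₁ q + diffNorm P T₂ q) :
    gagliardo P σ p A T ≤ 2 ^ (p - 1) * (gagliardo P σ p A T₁ + gagliardo P σ p A T₂) := by
  have h2t : (2 : ℝ≥0∞) ^ (p - 1) ≠ ⊤ := ENNReal.rpow_ne_top_of_nonneg (by linarith) (by simp)
  rw [gagliardo_eq, gagliardo_eq, gagliardo_eq, ← lintegral_add_left' h₁,
    ← lintegral_const_mul' _ _ h2t]
  refine lintegral_mono fun q => ?_
  rw [gagDensity, gagDensity, gagDensity, ← ENNReal.add_div, ← mul_div_assoc]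
  gcongr
  exact (ENNReal.rpow_le_rpow (h q) (by linarith)).trans
    (ENNReal.rpow_add_le_mul_rpow_add_rpow _ _ hp)

theorem IsTransport.diffNorm_diag (hP : IsTransport P) (T : TensorField m M ν k) (x : M) :
    diffNorm P T (x, x) = 0 := by
  have h : T x - (T x).compContinuousLinearMap (fun _ => P x x) = 0 := by
    rw [sub_eq_zero]
    ext1 v
    rw [ContinuousMultilinearMap.compContinuousLinearMap_apply]
    simp only [hP.diag]
  refine (congrArg enorm h).trans ?_
  rw [← ofReal_norm, ContinuousMultilinearMap.opNorm_zero, ENNReal.ofReal_zero]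

/-- On the diagonal the density is 0/0, which is 0 in extended nonnegative reals. -/
theorem IsTransport.gagDensity_diag (hP : IsTransport P) (hp : 1 ≤ p) (T : TensorField m M ν k)
    (x : M) : gagDensity P σ p T (x, x) = 0 := by
  rw [gagDensity, hP.diffNorm_diag, ENNReal.zero_rpow_of_pos (by linarith), ENNReal.zero_div]

/-- The Gagliardo energy near the diagonal is small. -/
theorem IsTransport.tendsto_gagliardo_nearDiag (hP : IsTransport P) (hp : 1 ≤ p)
    {T : TensorField m M ν k} (hT : gagliardo P σ p univ T < ⊤) :
    Tendsto (fun ρ : ℝ => gagliardo P σ p (nearDiag M (ENNReal.ofReal ρ)) T) (𝓝[>] 0) (𝓝 0) := by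
  -- The energy is viewed as a measure and continuity from above is used. On measurable sets the
  -- formula for such a measure needs no measurability of the density.
  set κ : Measure (M × M) :=
    ((riemVol m M).prod (riemVol m M)).withDensity (gagDensity P σ p T) with hκ
  have hκA : ∀ A, MeasurableSet A → κ A = gagliardo P σ p A T := fun A hA => withDensity_apply _ hA
  have hm := fun ρ : ℝ => measurableSet_nearDiag M (ENNReal.ofReal ρ)
  have hlim := tendsto_measure_biInter_gt (μ := κ) (a := (0 : ℝ))
    (s := fun ρ : ℝ => nearDiag M (ENNReal.ofReal ρ)) (fun r _ => (hm r).nullMeasurableSet)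
    (fun i j _ hij q (hq : edist q.1 q.2 < ENNReal.ofReal i) =>
      hq.trans_le (ENNReal.ofReal_le_ofReal hij))
    ⟨1, one_pos, by
      rw [hκA _ (hm 1)]
      exact ((lintegral_mono_set (subset_univ _)).trans_lt hT).ne⟩
  -- The intersection lies in the diagonal. The diagonal need not be a null set when m = 0, but the
  -- density vanishes on it.
  have h0 : κ (⋂ r > (0 : ℝ), nearDiag M (ENNReal.ofReal r)) = 0 := by
    have hd : MeasurableSet (diagonal M) := by
      have := secondCountableTopology (M := M)
      exact measurableSet_diagonal
    refine measure_mono_null (t := diagonal M) (fun q hq => ?_) ?_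
    · rw [mem_diagonal_iff, ← edist_eq_zero]
      refine le_antisymm (ENNReal.le_of_forall_pos_le_add fun ε hε _ => ?_) zero_le
      have h1 : edist q.1 q.2 < ENNReal.ofReal ε := mem_iInter₂.1 hq ε (by exact_mod_cast hε)
      rw [zero_add]
      simpa using h1.le
    · rw [hκA _ hd, gagliardo_eq]
      refine (setLIntegral_congr_fun (g := 0) hd fun q hq => ?_).trans lintegral_zero
      obtain ⟨x, y⟩ := q
      obtain rfl : x = y := hq
      exact hP.gagDensity_diag hp T x
  rw [h0] at hlim
  exact hlim.congr fun ρ => hκA _ (hm ρ)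

/-- Off the diagonal the pull-back by a fixed linear map is continuous and the denominator is a
nonzero constant; on the diagonal all densities vanish. This pointwise convergence feeds Fatou's
lemma. -/
theorem IsTransport.tendsto_gagDensity (hP : IsTransport P) (hσ : 0 < σ) (hp : 1 ≤ p)
    {T : ℕ → TensorField m M ν k} {S : TensorField m M ν k} {q : M × M}
    (h₁ : Tendsto (fun i => T i q.1) atTop (𝓝 (S q.1)))
    (h₂ : Tendsto (fun i => T i q.2) atTop (𝓝 (S q.2))) :
    Tendsto (fun i => gagDensity P σ p (T i) q) atTop (𝓝 (gagDensity P σ p S q)) := by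
  obtain ⟨x, y⟩ := q
  rcases eq_or_ne x y with rfl | hxy
  · simp only [hP.gagDensity_diag hp]
    exact tendsto_const_nhds
  refine ENNReal.Tendsto.div_const ?_ (Or.inr ?_)
  · refine ((ENNReal.continuous_rpow_const (y := p)).tendsto _).comp ?_
    refine (continuous_enorm.tendsto _).comp (h₁.sub ?_)
    exact ((ContinuousMultilinearMap.compContinuousLinearMapL (𝕜 := ℝ)
      (F := EuclideanSpace ℝ (Fin ν)) (fun _ : Fin k => P x y)).continuous.tendsto _).comp h₂
  · have : edist x y ≠ 0 := by simpa using hxy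
    have hα : ¬(m : ℝ) + σ * p < 0 := not_lt.2 (by positivity)
    simp [ENNReal.rpow_eq_zero_iff, this, hα]

theorem IsTransport.gagliardo_le_liminf (hP : IsTransport P) (hσ : 0 < σ) (hp : 1 ≤ p)
    {T : ℕ → TensorField m M ν k} {S : TensorField m M ν k} {A : Set (M × M)}
    (hT : ∀ i, AEMeasurable (gagDensity P σ p (T i))
      (((riemVol m M).prod (riemVol m M)).restrict A))
    (h : ∀ᵐ x ∂(riemVol m M), Tendsto (fun i => T i x) atTop (𝓝 (S x))) :
    gagliardo P σ p A S ≤ liminf (fun i => gagliardo P σ p A (T i)) atTop := by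
  refine le_trans ?_ (lintegral_liminf_le' hT)
  refine lintegral_mono_ae (ae_restrict_of_ae ((ae_prod_of_ae h).mono fun q hq => ?_))
  exact (hP.tendsto_gagDensity hσ hp hq.1 hq.2).liminf_eq.ge

/-- The part of the Gagliardo energy far from the diagonal is controlled by the `Lᵖ` norm. -/
theorem IsTransport.exists_gagliardo_le (hP : IsTransport P) (hσ : 0 < σ) (hp : 1 ≤ p) (ν k : ℕ)
    {ρ : ℝ≥0∞} (hρ : 0 < ρ) (hρt : ρ ≠ ⊤) : ∃ A : ℝ≥0, ∀ T : TensorField m M ν k, T.IsMeas →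
      gagliardo P σ p univ T ≤ gagliardo P σ p (nearDiag M ρ) T + A * energy m p T := by
  have := isFiniteMeasure_riemVol (m := m) (M := M)
  have hp0 : 0 < p := by linarith
  obtain ⟨B, hB⟩ := hP.bounded
  have hα : 0 ≤ (m : ℝ) + σ * p := by positivity
  have h2t : (2 : ℝ≥0∞) ^ (p - 1) ≠ ⊤ := ENNReal.rpow_ne_top_of_nonneg (by linarith) (by simp)
  set b : ℝ≥0 := B.toNNReal ^ k with hb
  have hbt : (b : ℝ≥0∞) ^ p ≠ ⊤ := ENNReal.rpow_ne_top_of_nonneg hp0.le ENNReal.coe_ne_top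
  set r : ℝ≥0∞ := (ρ ^ ((m : ℝ) + σ * p))⁻¹ with hr
  have hrt : r ≠ ⊤ := by
    rw [hr, ENNReal.inv_ne_top]
    exact (ENNReal.rpow_pos hρ hρt).ne'
  set Λ : ℝ≥0∞ := 2 ^ (p - 1) * r * ((1 + (b : ℝ≥0∞) ^ p) * riemVol m M univ) with hΛ
  have hΛt : Λ ≠ ⊤ := ENNReal.mul_ne_top (ENNReal.mul_ne_top h2t hrt)
    (ENNReal.mul_ne_top (ENNReal.add_ne_top.2 ⟨by simp, hbt⟩) (measure_ne_top _ _))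
  refine ⟨Λ.toNNReal, fun T hT => ?_⟩
  rw [ENNReal.coe_toNNReal hΛt]
  have hcomp : ∀ q : M × M, ‖(T q.2).compContinuousLinearMap (fun _ => P q.1 q.2)‖ₑ ≤
      b * ‖T q.2‖ₑ := fun q => by
    have h1 : ‖(T q.2).compContinuousLinearMap (fun _ => P q.1 q.2)‖ ≤ b * ‖T q.2‖ := by
      refine ContinuousMultilinearMap.opNorm_le_bound (by positivity) fun v => ?_
      rw [ContinuousMultilinearMap.compContinuousLinearMap_apply]
      refine ((T q.2).le_opNorm _).trans ?_
      rw [mul_comm (b : ℝ), mul_assoc]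
      gcongr
      calc ∏ i, ‖P q.1 q.2 (v i)‖ ≤ ∏ i, (B.toNNReal * ‖v i‖) :=
            Finset.prod_le_prod (fun _ _ => norm_nonneg _) fun i _ => (hB _ _ _).trans (by
              gcongr
              exact Real.le_coe_toNNReal B)
        _ = b * ∏ i, ‖v i‖ := by simp [Finset.prod_mul_distrib, hb]
    rw [← ofReal_norm, ← ofReal_norm, ← ENNReal.ofReal_coe_nnreal,
      ← ENNReal.ofReal_mul (by positivity)]
    exact ENNReal.ofReal_le_ofReal h1
  set f : M → ℝ≥0∞ := fun x => ‖T x‖ₑ ^ p with hf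
  have hfm : AEMeasurable f (riemVol m M) := hT.aemeasurable_enorm.pow_const p
  have hm1 : AEMeasurable (fun q : M × M => f q.1) ((riemVol m M).prod (riemVol m M)) :=
    hfm.comp_quasiMeasurePreserving Measure.quasiMeasurePreserving_fst
  have hm2 : AEMeasurable (fun q : M × M => f q.2) ((riemVol m M).prod (riemVol m M)) :=
    hfm.comp_quasiMeasurePreserving Measure.quasiMeasurePreserving_snd
  -- Off the neighbourhood the kernel is at most ρ^(-(m+σp)), and the norm of the transported tensor
  -- is at most Bᵏ times the original. The integrand is replaced by a measurable upper bound, so P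
  -- itself need not be measurable there.
  have hfar : gagliardo P σ p (nearDiag M ρ)ᶜ T ≤ Λ * energy m p T := by
    calc gagliardo P σ p (nearDiag M ρ)ᶜ T
        ≤ ∫⁻ q in (nearDiag M ρ)ᶜ, 2 ^ (p - 1) * r * (f q.1 + (b : ℝ≥0∞) ^ p * f q.2) ∂((riemVol m M).prod (riemVol m M)) := by
          refine setLIntegral_mono' (measurableSet_nearDiag M ρ).compl fun q hq => ?_
          have hq' : ρ ≤ edist q.1 q.2 := not_lt.1 hq
          rw [div_eq_mul_inv, mul_right_comm]
          refine mul_le_mul' ?_ (ENNReal.inv_le_inv.2 (ENNReal.rpow_le_rpow hq' hα))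
          refine (enorm_sub_rpow_le hp (T q.1)
            ((T q.2).compContinuousLinearMap (fun _ => P q.1 q.2))).trans ?_
          gcongr
          rw [← ENNReal.mul_rpow_of_nonneg _ _ hp0.le]
          exact ENNReal.rpow_le_rpow (hcomp q) hp0.le
      _ ≤ ∫⁻ q, 2 ^ (p - 1) * r * (f q.1 + (b : ℝ≥0∞) ^ p * f q.2) ∂((riemVol m M).prod (riemVol m M)) := setLIntegral_le_lintegral _ _
      _ = Λ * energy m p T := by
          rw [lintegral_const_mul' _ _ (ENNReal.mul_ne_top h2t hrt), lintegral_add_left' hm1,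
            lintegral_const_mul' _ _ hbt, lintegral_prod _ hm1, lintegral_prod _ hm2]
          simp only [lintegral_const]
          rw [lintegral_mul_const' _ _ (measure_ne_top _ _), hΛ, energy, ← hf]
          ring
  calc gagliardo P σ p univ T
      = ∫⁻ q in nearDiag M ρ ∪ (nearDiag M ρ)ᶜ, gagDensity P σ p T q
          ∂((riemVol m M).prod (riemVol m M)) := by rw [union_compl_self]; rfl
    _ ≤ gagliardo P σ p (nearDiag M ρ) T + gagliardo P σ p (nearDiag M ρ)ᶜ T :=
        lintegral_union_le _ _ _
    _ ≤ _ := by gcongr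

end Energy

/-! ### Convergence in a single fibre. -/

section Fibre

variable {E F : Type*} [NormedAddCommGroup E] [NormedSpace ℝ E] [NormedAddCommGroup F]
  [NormedSpace ℝ F] {k : ℕ} {p : ℝ}

local notation "𝕃" => ContinuousMultilinearMap ℝ (fun _ : Fin k => E) F

theorem tendsto_of_tendsto_enorm_sub_rpow (hp : 0 < p)
    {f : ℕ → 𝕃} {a : 𝕃} (h : Tendsto (fun i => ‖f i - a‖ₑ ^ p) atTop (𝓝 0)) :
    Tendsto f atTop (𝓝 a) := by
  rw [tendsto_iff_edist_tendsto_0]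
  have h1 : Tendsto (fun i => (‖f i - a‖ₑ ^ p) ^ (1 / p)) atTop (𝓝 0) :=
    (tendsto_rpow_inv_zero_iff hp).2 h
  refine h1.congr fun i => ?_
  rw [← ENNReal.rpow_mul, mul_one_div_cancel hp.ne', ENNReal.rpow_one, edist_eq_enorm_sub]

/-- The weights force the increments to be at most a constant times 2⁻ⁱ, so the sequence is Cauchy.
-/
theorem exists_tendsto_of_tsum_lt_top [CompleteSpace F] (hp : 0 < p) {f : ℕ → 𝕃}
    (h : ∑' i, ((2 : ℝ≥0∞) ^ i) ^ p * ‖f i - f (i + 1)‖ₑ ^ p < ⊤) :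
    ∃ s, Tendsto f atTop (𝓝 s) := by
  refine cauchySeq_tendsto_of_complete (cauchySeq_of_edist_le_geometric_two
    ((∑' i, ((2 : ℝ≥0∞) ^ i) ^ p * ‖f i - f (i + 1)‖ₑ ^ p) ^ (1 / p))
    (ENNReal.rpow_ne_top_of_nonneg (by positivity) h.ne) fun i => ?_)
  rw [ENNReal.le_div_iff_mul_le (Or.inl (ENNReal.pow_pos (by simp) i).ne')
    (Or.inl (by finiteness)), one_div, ENNReal.le_rpow_inv_iff hp, mul_comm,
    ENNReal.mul_rpow_of_nonneg _ _ hp.le, edist_eq_enorm_sub]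
  exact ENNReal.le_tsum (f := fun i => ((2 : ℝ≥0∞) ^ i) ^ p * ‖f i - f (i + 1)‖ₑ ^ p) i

theorem tendsto_enorm_rpow (p : ℝ) {f : ℕ → 𝕃} {a : 𝕃}
    (h : Tendsto f atTop (𝓝 a)) : Tendsto (fun i => ‖f i‖ₑ ^ p) atTop (𝓝 (‖a‖ₑ ^ p)) :=
  ((ENNReal.continuous_rpow_const.comp continuous_enorm).tendsto a).comp h

end Fibre

/-! ### Completeness of Lᵖ tensor fields and almost everywhere convergent subsequences. -/

section Complete

variable {m : ℕ} {M : Type*} [EMetricSpace M] [ChartedSpace (EuclideanSpace ℝ (Fin m)) M]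

local notation "𝔼" => EuclideanSpace ℝ (Fin m)
local notation "Φ[" c "]" => PartialEquiv.symm (extChartAt (𝓡 m) c)
local notation "TM" => (TangentSpace (𝓡 m) : M → Type _)

variable [IsManifold (𝓡 m) ∞ M] [RiemannianBundle (fun x : M => TangentSpace (𝓡 m) x)]
  [IsContMDiffRiemannianBundle (𝓡 m) ∞ (EuclideanSpace ℝ (Fin m))
    (fun x : M => TangentSpace (𝓡 m) x)]
  [IsRiemannianManifold (𝓡 m) M] [MeasurableSpace M] [BorelSpace M]

variable {ν k : ℕ} {p : ℝ}

theorem enorm_sub_le_add (T S : TensorField m M ν k) (x : M) :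
    ‖(T - S) x‖ₑ ≤ ‖T x‖ₑ + ‖S x‖ₑ := by
  rw [Pi.sub_apply, ← ofReal_norm, ← ofReal_norm, ← ofReal_norm,
    ← ENNReal.ofReal_add (norm_nonneg _) (norm_nonneg _)]
  exact ENNReal.ofReal_le_ofReal (norm_sub_le (T x) (S x))

theorem enorm_sub_le_sub_add_sub (T S U : TensorField m M ν k) (x : M) :
    ‖(T - S) x‖ₑ ≤ ‖(T - U) x‖ₑ + ‖(S - U) x‖ₑ := by
  rw [← sub_sub_sub_cancel_right T S U]
  exact enorm_sub_le_add _ _ x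

theorem enorm_le_sub_add (T S : TensorField m M ν k) (x : M) :
    ‖S x‖ₑ ≤ ‖T x‖ₑ + ‖(T - S) x‖ₑ := by
  have h := enorm_sub_le_add T (T - S) x
  rwa [sub_sub_cancel] at h

variable [CompactSpace M]

theorem isMeas_of_tendsto_ae {T : ℕ → TensorField m M ν k} {S : TensorField m M ν k}
    (hT : ∀ i, (T i).IsMeas)
    (h : ∀ᵐ x ∂(riemVol m M), Tendsto (fun i => T i x) atTop (𝓝 (S x))) : S.IsMeas := by
  intro c v
  refine aestronglyMeasurable_of_tendsto_ae atTop (fun i => hT i c v) ?_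
  filter_upwards [ae_chart_of_ae h c] with z hz
  exact ((ContinuousMultilinearMap.apply ℝ _ _ fun i => paramDeriv c z (v i)).continuous.tendsto
    _).comp hz

theorem energy_le_liminf {T : ℕ → TensorField m M ν k} {S : TensorField m M ν k}
    (hT : ∀ i, (T i).IsMeas)
    (h : ∀ᵐ x ∂(riemVol m M), Tendsto (fun i => T i x) atTop (𝓝 (S x))) :
    energy m p S ≤ liminf (fun i => energy m p (T i)) atTop := by
  refine le_trans ?_ (lintegral_liminf_le' fun i => (hT i).aemeasurable_enorm.pow_const p)
  refine lintegral_mono_ae (h.mono fun x hx => ?_)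
  have h1 : Tendsto (fun i => ‖T i x‖ₑ ^ p) atTop (𝓝 (‖S x‖ₑ ^ p)) := tendsto_enorm_rpow p hx
  exact h1.liminf_eq.ge

/-- By monotone convergence the series has integral at most Σ 2⁻ⁱ = 2, hence is finite almost
everywhere. -/
theorem ae_tsum_lt_top {T : ℕ → TensorField m M ν k} (hT : ∀ i, (T i).IsMeas) {a : ℕ → ℝ≥0∞}
    (ha : ∀ i, a i * energy m p (T i) ≤ 2⁻¹ ^ i) (hat : ∀ i, a i ≠ ⊤) :
    ∀ᵐ x ∂(riemVol m M), ∑' i, a i * ‖T i x‖ₑ ^ p < ⊤ := by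
  have hm : ∀ i, AEMeasurable (fun x => a i * ‖T i x‖ₑ ^ p) (riemVol m M) := fun i =>
    ((hT i).aemeasurable_enorm.pow_const p).const_mul _
  refine ae_lt_top' (AEMeasurable.tsum hm) ?_
  rw [lintegral_tsum hm]
  refine ne_top_of_le_ne_top (b := ∑' i, (2⁻¹ : ℝ≥0∞) ^ i) ?_ (ENNReal.tsum_le_tsum fun i => ?_)
  · rw [ENNReal.tsum_geometric, ENNReal.one_sub_inv_two, inv_inv]
    simp
  · rw [lintegral_const_mul' _ _ (hat i)]
    exact ha i

theorem exists_seq_tendsto_ae_of_energy (hp : 0 < p) {T : ℕ → TensorField m M ν k}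
    {S : TensorField m M ν k} (hT : ∀ i, (T i).IsMeas) (hS : S.IsMeas)
    (h : Tendsto (fun n => energy m p (T n - S)) atTop (𝓝 0)) :
    ∃ φ : ℕ → ℕ, StrictMono φ ∧
      ∀ᵐ x ∂(riemVol m M), Tendsto (fun i => T (φ i) x) atTop (𝓝 (S x)) := by
  obtain ⟨φ, hφ, hφ'⟩ := extraction_forall_of_eventually'
    (P := fun i n => energy m p (T n - S) ≤ 2⁻¹ ^ i) fun i => by
      obtain ⟨N, hN⟩ := eventually_atTop.1 (ENNReal.tendsto_nhds_zero.1 h (2⁻¹ ^ i)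
        (ENNReal.pow_pos (by simp) i))
      exact ⟨N, hN⟩
  refine ⟨φ, hφ, ?_⟩
  filter_upwards [ae_tsum_lt_top (a := fun _ => 1) (fun i => (hT (φ i)).sub hS)
    (fun i => by rw [one_mul]; exact hφ' i) (fun _ => by simp)] with x hx
  simp only [one_mul] at hx
  have h1 : Tendsto (fun i => ‖T (φ i) x - S x‖ₑ ^ p) atTop (𝓝 0) :=
    ENNReal.tendsto_atTop_zero_of_tsum_ne_top hx.ne
  exact tendsto_of_tendsto_enorm_sub_rpow hp h1

/-- Completeness of the space of `Lᵖ` tensor fields. -/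
theorem exists_tendsto_energy (hp : 1 ≤ p) {T : ℕ → TensorField m M ν k}
    (hT : ∀ i, (T i).IsMeas)
    (hc : ∀ ε : ℝ≥0∞, 0 < ε → ∃ N, ∀ n ≥ N, ∀ l ≥ N, energy m p (T n - T l) ≤ ε) :
    ∃ S : TensorField m M ν k, S.IsMeas ∧
      Tendsto (fun n => energy m p (T n - S)) atTop (𝓝 0) := by
  have hp0 : 0 < p := by linarith
  have h2t : ∀ i : ℕ, ((2 : ℝ≥0∞) ^ i) ^ p ≠ ⊤ := fun i =>
    ENNReal.rpow_ne_top_of_nonneg hp0.le (by finiteness)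
  have h20 : ∀ i : ℕ, ((2 : ℝ≥0∞) ^ i) ^ p ≠ 0 := fun i =>
    (ENNReal.rpow_pos (ENNReal.pow_pos (by simp) i) (by finiteness)).ne'
  -- The subsequence converges so fast that the increments remain summable after multiplication by
  -- the weights 2^(ip) required in each fibre.
  obtain ⟨φ, hφ, hφ'⟩ := extraction_forall_of_eventually'
    (P := fun i N => ∀ n ≥ N, ∀ l ≥ N, energy m p (T n - T l) ≤ 2⁻¹ ^ i / ((2 : ℝ≥0∞) ^ i) ^ p)
    fun i => by
      obtain ⟨N, hN⟩ := hc (2⁻¹ ^ i / ((2 : ℝ≥0∞) ^ i) ^ p)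
        (ENNReal.div_pos (ENNReal.pow_pos (by simp) i).ne' (h2t i))
      exact ⟨N, fun N' hN' n hn l hl => hN n (hN'.trans hn) l (hN'.trans hl)⟩
  have hae := ae_tsum_lt_top (p := p) (T := fun i => T (φ i) - T (φ (i + 1)))
    (a := fun i => ((2 : ℝ≥0∞) ^ i) ^ p) (fun i => (hT _).sub (hT _)) (fun i => by
      refine (mul_le_mul_right (hφ' i _ le_rfl _ (hφ.monotone (Nat.le_succ i))) _).trans
        (le_of_eq ?_)
      exact ENNReal.mul_div_cancel (h20 i) (h2t i)) h2t
  have hlim : ∀ᵐ x ∂(riemVol m M), ∃ s, Tendsto (fun i => T (φ i) x) atTop (𝓝 s) := by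
    filter_upwards [hae] with x hx
    exact exists_tendsto_of_tsum_lt_top hp0 (f := fun i => T (φ i) x) hx
  classical
  -- The limit is taken fibre by fibre, with the value 0 on the null set where it does not exist.
  set S : TensorField m M ν k := fun x =>
    if h : ∃ s, Tendsto (fun i => T (φ i) x) atTop (𝓝 s) then h.choose else 0 with hS
  have hTS : ∀ᵐ x ∂(riemVol m M), Tendsto (fun i => T (φ i) x) atTop (𝓝 (S x)) := by
    filter_upwards [hlim] with x hx
    rw [hS]
    simp only [dif_pos hx]
    exact hx.choose_spec
  refine ⟨S, isMeas_of_tendsto_ae (fun i => hT _) hTS, ENNReal.tendsto_nhds_zero.2 fun ε hε => ?_⟩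
  obtain ⟨N, hN⟩ := hc ε hε
  filter_upwards [eventually_ge_atTop N] with n hn
  -- Fatou's lemma along the subsequence turns the Cauchy property into convergence of the full
  -- sequence.
  have h1 : energy m p (T n - S) ≤ liminf (fun i => energy m p (T n - T (φ i))) atTop :=
    energy_le_liminf (fun i => (hT n).sub (hT _))
      (hTS.mono fun x hx => tendsto_const_nhds.sub hx)
  refine h1.trans ((liminf_le_limsup (f := atTop)).trans (limsup_le_of_le (h := ?_)))
  filter_upwards [eventually_ge_atTop N] with i hi
  exact hN n hn _ (hi.trans hφ.le_apply)

end Complete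

/-! ### Convergence in the Sobolev space. -/

section Equivalence

variable {m : ℕ} {M : Type*} [EMetricSpace M] [ChartedSpace (EuclideanSpace ℝ (Fin m)) M]

local notation "𝔼" => EuclideanSpace ℝ (Fin m)
local notation "Φ[" c "]" => PartialEquiv.symm (extChartAt (𝓡 m) c)
local notation "TM" => (TangentSpace (𝓡 m) : M → Type _)

variable [IsManifold (𝓡 m) ∞ M] [RiemannianBundle (fun x : M => TangentSpace (𝓡 m) x)]
  [IsContMDiffRiemannianBundle (𝓡 m) ∞ (EuclideanSpace ℝ (Fin m))
    (fun x : M => TangentSpace (𝓡 m) x)]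
  [IsRiemannianManifold (𝓡 m) M] [MeasurableSpace M] [BorelSpace M]

variable {ν k : ℕ} {σ p : ℝ} [CompactSpace M]
variable {P : ∀ x y : M, TangentSpace (𝓡 m) x →L[ℝ] TangentSpace (𝓡 m) y}

theorem IsWeakDerivChain.weakDeriv_ae_eq {u : M → EuclideanSpace ℝ (Fin ν)}
    {D : ∀ j, TensorField m M ν j} (h : IsWeakDerivChain u k D) {j : ℕ} (hj : j ≤ k) :
    ∀ᵐ x ∂(riemVol m M), weakDeriv (m := m) j u x = D j x :=
  FracSobolev.weakDeriv_ae_eq (h.isIter hj)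

theorem IsWeakDerivChain.sub {u u' : M → EuclideanSpace ℝ (Fin ν)}
    {D D' : ∀ j, TensorField m M ν j} (h : IsWeakDerivChain u k D)
    (h' : IsWeakDerivChain u' k D') : IsWeakDerivChain (u - u') k fun j => D j - D' j := by
  refine ⟨?_, fun j hj => (h.2 j hj).sub (h'.2 j hj)⟩
  show D 0 - D' 0 = _
  rw [h.1, h'.1, zeroTensor_sub]

/-- Derivatives of an element of the Sobolev space. -/
structure IsSobolevChain (P : ∀ x y : M, TangentSpace (𝓡 m) x →L[ℝ] TangentSpace (𝓡 m) y)
    (k : ℕ) (σ p : ℝ) (u : M → EuclideanSpace ℝ (Fin ν)) (D : ∀ j, TensorField m M ν j) :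
    Prop where
  aestronglyMeasurable : AEStronglyMeasurable u (riemVol m M)
  chain : IsWeakDerivChain u k D
  energy_lt_top : ∀ j ≤ k, energy m p (D j) < ⊤
  gagliardo_lt_top : gagliardo P σ p univ (D k) < ⊤

theorem IsSobolevChain.isMeas {u : M → EuclideanSpace ℝ (Fin ν)} {D : ∀ j, TensorField m M ν j}
    (h : IsSobolevChain P k σ p u D) {j : ℕ} (hj : j ≤ k) : (D j).IsMeas :=
  h.chain.isMeas h.aestronglyMeasurable hj

/-- Passes from the independently chosen `weakDeriv` to one coherent chain, without changing any
energy. -/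
theorem MemW.exists_chain (hp : 1 ≤ p) {u : M → EuclideanSpace ℝ (Fin ν)}
    (h : MemW P k σ p u) : ∃ D, IsSobolevChain P k σ p u D := by
  obtain ⟨T, hT⟩ := h.weaklyDiff
  obtain ⟨D, hD, rfl⟩ := hT.exists_chain
  refine ⟨D, h.memLp.1, hD, fun j hj => ?_, ?_⟩
  · have h1 := h.lpNorm_lt_top j hj
    rw [lpNorm_eq, energy_congr (hD.weakDeriv_ae_eq hj)] at h1
    exact (ENNReal.rpow_lt_top_iff_of_pos (by positivity)).1 h1
  · rw [← gagliardo_congr (hD.weakDeriv_ae_eq le_rfl)]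
    exact h.gagliardo_lt_top

theorem IsSobolevChain.memW (hp : 1 ≤ p) {u : M → EuclideanSpace ℝ (Fin ν)}
    {D : ∀ j, TensorField m M ν j} (h : IsSobolevChain P k σ p u D) : MemW P k σ p u := by
  refine ⟨⟨h.aestronglyMeasurable, ?_⟩, ⟨D k, h.chain.isIter le_rfl⟩, fun j hj => ?_, ?_⟩
  · rw [eLpNorm_eq_energy hp, ← h.chain.1]
    exact ENNReal.rpow_lt_top_of_nonneg (by positivity) (h.energy_lt_top 0 (Nat.zero_le _)).ne
  · rw [lpNorm_eq, energy_congr (h.chain.weakDeriv_ae_eq hj)]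
    exact ENNReal.rpow_lt_top_of_nonneg (by positivity) (h.energy_lt_top j hj).ne
  · rw [gagliardo_congr (h.chain.weakDeriv_ae_eq le_rfl)]
    exact h.gagliardo_lt_top

theorem IsWeakDerivChain.normW_eq {u : M → EuclideanSpace ℝ (Fin ν)}
    {D : ∀ j, TensorField m M ν j} (h : IsWeakDerivChain u k D) :
    normW P k σ p u = ∑ j ∈ Finset.range (k + 1), energy m p (D j) ^ (1 / p) +
      gagliardo P σ p univ (D k) ^ (1 / p) := by
  rw [normW, gagliardo_congr (h.weakDeriv_ae_eq le_rfl)]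
  congr 1
  refine Finset.sum_congr rfl fun j hj => ?_
  rw [lpNorm_eq, energy_congr (h.weakDeriv_ae_eq (Nat.lt_succ_iff.1 (Finset.mem_range.1 hj)))]

theorem tendsto_normW_iff (hp : 1 ≤ p) {u : ℕ → M → EuclideanSpace ℝ (Fin ν)}
    {D : ℕ → ∀ j, TensorField m M ν j} (h : ∀ n, IsWeakDerivChain (u n) k (D n)) :
    Tendsto (fun n => normW P k σ p (u n)) atTop (𝓝 0) ↔
      (∀ j ≤ k, Tendsto (fun n => energy m p (D n j)) atTop (𝓝 0)) ∧
      Tendsto (fun n => gagliardo P σ p univ (D n k)) atTop (𝓝 0) := by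
  have hp0 : 0 < p := by linarith
  simp only [(h _).normW_eq]
  refine ⟨fun hn => ⟨fun j hj => (tendsto_rpow_inv_zero_iff hp0).1 ?_,
    (tendsto_rpow_inv_zero_iff hp0).1 ?_⟩, fun ⟨h1, h2⟩ => ?_⟩
  · refine tendsto_of_tendsto_of_tendsto_of_le_of_le tendsto_const_nhds hn (fun _ => zero_le)
      fun n => le_add_right ?_
    exact Finset.single_le_sum (f := fun j => energy m p (D n j) ^ (1 / p)) (fun _ _ => zero_le)
      (Finset.mem_range.2 (Nat.lt_succ_iff.2 hj))
  · exact tendsto_of_tendsto_of_tendsto_of_le_of_le tendsto_const_nhds hn (fun _ => zero_le)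
      fun n => le_add_self
  · have h3 := tendsto_finsetSum (Finset.range (k + 1)) fun j hj =>
      (tendsto_rpow_inv_zero_iff hp0).2 (h1 j (Nat.lt_succ_iff.1 (Finset.mem_range.1 hj)))
    have h4 := h3.add ((tendsto_rpow_inv_zero_iff hp0).2 h2)
    simpa only [Finset.sum_const_zero, add_zero] using h4

theorem tendstoLp_iff (hp : 1 ≤ p) {u : ℕ → M → EuclideanSpace ℝ (Fin ν)}
    {u' : M → EuclideanSpace ℝ (Fin ν)} :
    TendstoLp m p u u' ↔ MemLp u' (ENNReal.ofReal p) (riemVol m M) ∧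
      Tendsto (fun n => energy m p (zeroTensor (m := m) (u n) - zeroTensor u')) atTop (𝓝 0) := by
  refine and_congr_right fun _ => ?_
  simp only [eLpNorm_eq_energy hp, zeroTensor_sub]
  exact tendsto_rpow_inv_zero_iff (by linarith)

/-- Convergence implies equismallness of the Gagliardo energies near the diagonal. -/
theorem IsTransport.tendsto_iSup_gagliardo (hP : IsTransport P) (hp : 1 ≤ p)
    {T : ℕ → TensorField m M ν k} {S : TensorField m M ν k} (hT : ∀ n, (T n).IsMeas)
    (hS : S.IsMeas) (hTt : ∀ n, gagliardo P σ p univ (T n) < ⊤)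
    (hSt : gagliardo P σ p univ S < ⊤)
    (h : Tendsto (fun n => gagliardo P σ p univ (T n - S)) atTop (𝓝 0)) :
    Tendsto (fun ρ : ℝ => ⨆ n, gagliardo P σ p (nearDiag M (ENNReal.ofReal ρ)) (T n))
      (𝓝[>] 0) (𝓝 0) := by
  obtain ⟨δ, hδ, hm⟩ := hP.exists_aemeasurable_gagDensity
  have hδρ : ∀ᶠ ρ : ℝ in 𝓝[>] 0, ENNReal.ofReal ρ ≤ δ := by
    refine nhdsWithin_le_nhds ?_
    have h1 := (ENNReal.continuous_ofReal.tendsto 0).eventually_lt_const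
      (by rwa [ENNReal.ofReal_zero] : ENNReal.ofReal 0 < δ)
    exact h1.mono fun _ h => h.le
  refine ENNReal.tendsto_nhds_zero.2 fun ε hε => ?_
  have h2 : (2 : ℝ≥0∞) ^ (p - 1) ≠ ⊤ := ENNReal.rpow_ne_top_of_nonneg (by linarith) (by simp)
  have h20 : (2 : ℝ≥0∞) ^ (p - 1) ≠ 0 := (ENNReal.rpow_pos (by simp) (by simp)).ne'
  set ε' : ℝ≥0∞ := ε / 2 ^ (p - 1) / 2 with hε'
  have hε'0 : 0 < ε' := ENNReal.half_pos (ENNReal.div_pos hε.ne' h2).ne'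
  -- Indices from N on are compared with S, uniformly in ρ. The fewer than N others are treated one
  -- by one.
  obtain ⟨N, hN⟩ := eventually_atTop.1 (ENNReal.tendsto_nhds_zero.1 h ε' hε'0)
  have h3 := ENNReal.tendsto_nhds_zero.1 (hP.tendsto_gagliardo_nearDiag hp hSt) ε' hε'0
  have h4 : ∀ᶠ ρ : ℝ in 𝓝[>] 0, ∀ n ∈ Finset.range N,
      gagliardo P σ p (nearDiag M (ENNReal.ofReal ρ)) (T n) ≤ ε :=
    (Finset.eventually_all _).2 fun n _ =>
      ENNReal.tendsto_nhds_zero.1 (hP.tendsto_gagliardo_nearDiag hp (hTt n)) ε hε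
  filter_upwards [hδρ, h3, h4] with ρ h5 h6 h7
  refine iSup_le fun n => ?_
  rcases lt_or_ge n N with hn | hn
  · exact h7 n (Finset.mem_range.2 hn)
  calc gagliardo P σ p (nearDiag M (ENNReal.ofReal ρ)) (T n)
      ≤ 2 ^ (p - 1) * (gagliardo P σ p (nearDiag M (ENNReal.ofReal ρ)) (T n - S) +
          gagliardo P σ p (nearDiag M (ENNReal.ofReal ρ)) S) :=
        gagliardo_le_of_diffNorm_le hp (hm ((hT n).sub hS) h5) (diffNorm_le_add _ _)
    _ ≤ 2 ^ (p - 1) * (ε' + ε') := by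
        gcongr
        exact (lintegral_mono_set (subset_univ _)).trans (hN n hn)
    _ = ε := by
        rw [hε', ENNReal.add_halves, ENNReal.mul_div_cancel h20 h2]

/-- Under convergence in `Lᵖ` and equismallness of the Gagliardo energies near the diagonal, all
the derivatives form Cauchy sequences. -/
theorem IsTransport.cauchy_energy (hP : IsTransport P) (hσ : 0 < σ) (hp : 1 ≤ p)
    {u : ℕ → M → EuclideanSpace ℝ (Fin ν)} {D : ℕ → ∀ j, TensorField m M ν j}
    (hD : ∀ n, IsSobolevChain P k σ p (u n) (D n)) {S₀ : TensorField m M ν 0} (hS₀ : S₀.IsMeas)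
    (hlim : Tendsto (fun n => energy m p (D n 0 - S₀)) atTop (𝓝 0))
    (hsup : ∀ ε : ℝ≥0∞, 0 < ε → ∀ δ : ℝ≥0∞, 0 < δ → ∃ ρ : ℝ≥0∞, 0 < ρ ∧ ρ ≤ δ ∧
      ∀ᶠ n in atTop, gagliardo P σ p (nearDiag M ρ) (D n k) ≤ ε)
    {j : ℕ} (hj : j ≤ k) {ε : ℝ≥0∞} (hε : 0 < ε) :
    ∃ N, ∀ n ≥ N, ∀ l ≥ N, energy m p (D n j - D l j) ≤ ε := by
  obtain ⟨δ, hδ, hm⟩ := hP.exists_aemeasurable_gagDensity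
  obtain ⟨C₀, hC₀⟩ := hP.exists_energy_le (ν := ν) hσ hp k
  have h2 : (2 : ℝ≥0∞) ^ (p - 1) ≠ ⊤ := ENNReal.rpow_ne_top_of_nonneg (by linarith) (by simp)
  have hfin : ∀ n l, ∀ i ≤ k, energy m p (D n i - D l i) < ⊤ := fun n l i hi =>
    (energy_le_of_enorm_le hp ((hD n).isMeas hi).aemeasurable_enorm
      (enorm_sub_le_add _ _)).trans_lt (ENNReal.mul_lt_top h2.lt_top
        (ENNReal.add_lt_top.2 ⟨(hD n).energy_lt_top i hi, (hD l).energy_lt_top i hi⟩))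
  have hsmall : ∀ B : ℝ≥0, ∃ ε' : ℝ≥0∞, 0 < ε' ∧ B * (2 ^ (p - 1) * (ε' + ε')) ≤ ε / 2 := by
    intro B
    have hε2 : 0 < ε / 2 := ENNReal.half_pos hε.ne'
    have hb : (B : ℝ≥0∞) * 2 ^ (p - 1) + 1 ≠ ⊤ :=
      ENNReal.add_ne_top.2 ⟨ENNReal.mul_ne_top ENNReal.coe_ne_top h2, by simp⟩
    refine ⟨ε / 2 / (B * 2 ^ (p - 1) + 1) / 2,
      ENNReal.half_pos (ENNReal.div_pos hε2.ne' hb).ne', ?_⟩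
    rw [ENNReal.add_halves, ← mul_assoc]
    calc (B : ℝ≥0∞) * 2 ^ (p - 1) * (ε / 2 / (B * 2 ^ (p - 1) + 1))
        ≤ (B * 2 ^ (p - 1) + 1) * (ε / 2 / (B * 2 ^ (p - 1) + 1)) := by gcongr; simp
      _ = ε / 2 := ENNReal.mul_div_cancel (by simp) hb
  -- The choices are not circular because C₀ is independent of ρ: C₀ determines ε₁, then ρ, then A,
  -- then ε₂, and finally N.
  obtain ⟨ε₁, hε₁, hC₁⟩ := hsmall C₀
  obtain ⟨ρ, hρ, hρδ, hg⟩ := hsup ε₁ hε₁ δ hδ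
  obtain ⟨A, hA⟩ := hC₀ ρ hρ
  obtain ⟨ε₂, hε₂, hC₂⟩ := hsmall A
  obtain ⟨N, hN⟩ := eventually_atTop.1 (hg.and (ENNReal.tendsto_nhds_zero.1 hlim ε₂ hε₂))
  refine ⟨N, fun n hn l hl => ?_⟩
  have h3 := hA (fun i => D n i - D l i)
    (fun i hi => ((hD n).chain.2 i hi).sub ((hD l).chain.2 i hi)) (hfin n l) j hj
  have h4 : gagliardo P σ p (nearDiag M ρ) (D n k - D l k) ≤ 2 ^ (p - 1) * (ε₁ + ε₁) :=
    (gagliardo_le_of_diffNorm_le hp (hm ((hD n).isMeas le_rfl) hρδ) (diffNorm_sub_le _ _)).trans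
      (by gcongr; exacts [(hN n hn).1, (hN l hl).1])
  have h5 : energy m p (D n 0 - D l 0) ≤ 2 ^ (p - 1) * (ε₂ + ε₂) :=
    (energy_le_of_enorm_le hp (((hD n).isMeas (Nat.zero_le k)).sub hS₀).aemeasurable_enorm
      (enorm_sub_le_sub_add_sub _ _ S₀)).trans (by gcongr; exacts [(hN n hn).2, (hN l hl).2])
  calc energy m p (D n j - D l j)
      ≤ C₀ * (2 ^ (p - 1) * (ε₁ + ε₁)) + A * (2 ^ (p - 1) * (ε₂ + ε₂)) :=
        h3.trans (add_le_add (mul_le_mul_right h4 _) (mul_le_mul_right h5 _))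
    _ ≤ ε / 2 + ε / 2 := add_le_add hC₁ hC₂
    _ = ε := ENNReal.add_halves ε

/-- Under convergence in `Lᵖ` and equismallness of the Gagliardo energies near the diagonal, the
sequence converges in the Sobolev space. -/
theorem IsTransport.exists_limit (hP : IsTransport P) (hσ : 0 < σ) (hp : 1 ≤ p)
    {u : ℕ → M → EuclideanSpace ℝ (Fin ν)} {D : ℕ → ∀ j, TensorField m M ν j}
    (hD : ∀ n, IsSobolevChain P k σ p (u n) (D n)) {u' : M → EuclideanSpace ℝ (Fin ν)}
    (hu' : MemLp u' (ENNReal.ofReal p) (riemVol m M))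
    (hlim : Tendsto (fun n => energy m p (D n 0 - zeroTensor u')) atTop (𝓝 0))
    (hsup : ∀ ε : ℝ≥0∞, 0 < ε → ∀ δ : ℝ≥0∞, 0 < δ → ∃ ρ : ℝ≥0∞, 0 < ρ ∧ ρ ≤ δ ∧
      ∀ᶠ n in atTop, gagliardo P σ p (nearDiag M ρ) (D n k) ≤ ε) :
    ∃ S, IsSobolevChain P k σ p u' S ∧
      (∀ j ≤ k, Tendsto (fun n => energy m p (D n j - S j)) atTop (𝓝 0)) ∧
      Tendsto (fun n => gagliardo P σ p univ (D n k - S k)) atTop (𝓝 0) := by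
  have hp0 : 0 < p := by linarith
  have h2 : (2 : ℝ≥0∞) ^ (p - 1) ≠ ⊤ := ENNReal.rpow_ne_top_of_nonneg (by linarith) (by simp)
  obtain ⟨δ, hδ, hm⟩ := hP.exists_aemeasurable_gagDensity
  have hS₀ := isMeas_zeroTensor hu'.1
  -- The last clause fixes the limit of order 0 as `zeroTensor u'` itself, since a chain demands
  -- equality there and not only almost everywhere.
  have hex : ∀ j, ∃ S : TensorField m M ν j, j ≤ k → (S.IsMeas ∧
      Tendsto (fun n => energy m p (D n j - S)) atTop (𝓝 0) ∧
      (∀ h : j = 0, h ▸ S = zeroTensor (m := m) u')) := by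
    intro j
    by_cases hj : j ≤ k
    swap
    · exact ⟨0, fun h => absurd h hj⟩
    rcases j with _ | j
    · exact ⟨zeroTensor u', fun _ => ⟨hS₀, hlim, fun _ => rfl⟩⟩
    · obtain ⟨S, hS, hS'⟩ := exists_tendsto_energy hp (fun n => (hD n).isMeas hj)
        fun ε hε => hP.cauchy_energy hσ hp hD hS₀ hlim hsup hj hε
      exact ⟨S, fun _ => ⟨hS, hS', fun h => absurd h (Nat.succ_ne_zero j)⟩⟩
  choose S hS using hex
  have hSm : ∀ j ≤ k, (S j).IsMeas := fun j hj => (hS j hj).1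
  have hSlim : ∀ j ≤ k, Tendsto (fun n => energy m p (D n j - S j)) atTop (𝓝 0) := fun j hj =>
    (hS j hj).2.1
  have hS0 : S 0 = zeroTensor u' := (hS 0 (Nat.zero_le k)).2.2 rfl
  have hSt : ∀ j ≤ k, energy m p (S j) < ⊤ := fun j hj => by
    obtain ⟨n, hn⟩ := (ENNReal.tendsto_nhds_zero.1 (hSlim j hj) 1 one_pos).exists
    refine (energy_le_of_enorm_le hp ((hD n).isMeas hj).aemeasurable_enorm
      (enorm_le_sub_add (D n j) (S j))).trans_lt (ENNReal.mul_lt_top h2.lt_top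
        (ENNReal.add_lt_top.2 ⟨(hD n).energy_lt_top j hj, hn.trans_lt ENNReal.one_lt_top⟩))
  have hchain : IsWeakDerivChain u' k S := ⟨hS0, fun j hj =>
    IsWeakCovDeriv.of_tendsto hp (fun n => (hD n).chain.2 j hj) (hSm j hj.le) (hSm (j + 1) hj)
      (hSt j hj.le) (hSt (j + 1) hj) (hSlim j hj.le) (hSlim (j + 1) hj)⟩
  obtain ⟨φ, hφ, hae⟩ := exists_seq_tendsto_ae_of_energy hp0 (fun n => (hD n).isMeas le_rfl)
    (hSm k le_rfl) (hSlim k le_rfl)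
  -- Fatou's lemma is applied in the second index: `S k` is replaced by `D (φ i) k` with i tending
  -- to infinity, and both fields then have small energy near the diagonal.
  have hnear : ∀ ε : ℝ≥0∞, 0 < ε → ∃ ρ : ℝ≥0∞, 0 < ρ ∧ ρ ≠ ⊤ ∧ ρ ≤ δ ∧
      ∀ᶠ n in atTop, gagliardo P σ p (nearDiag M ρ) (D n k - S k) ≤ 2 ^ (p - 1) * (ε + ε) := by
    intro ε hε
    -- δ ensures measurability, and 1 keeps ρ finite for the bound away from the diagonal.
    obtain ⟨ρ, hρ, hρδ, hg⟩ := hsup ε hε (min δ 1) (lt_min hδ one_pos)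
    refine ⟨ρ, hρ, ne_top_of_le_ne_top (by simp) (hρδ.trans (min_le_right _ _)),
      hρδ.trans (min_le_left _ _), ?_⟩
    obtain ⟨N, hN⟩ := eventually_atTop.1 hg
    have hρδ' := hρδ.trans (min_le_left _ _)
    filter_upwards [eventually_ge_atTop N] with n hn
    refine (hP.gagliardo_le_liminf hσ hp (T := fun i => D n k - D (φ i) k)
      (fun i => hm (((hD n).isMeas le_rfl).sub ((hD (φ i)).isMeas le_rfl)) hρδ')
      (hae.mono fun x hx => tendsto_const_nhds.sub hx)).trans
      ((liminf_le_limsup (f := atTop)).trans (limsup_le_of_le (h := ?_)))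
    filter_upwards [eventually_ge_atTop N] with i hi
    refine (gagliardo_le_of_diffNorm_le hp (hm ((hD n).isMeas le_rfl) hρδ')
      (diffNorm_sub_le _ _)).trans ?_
    gcongr
    exacts [hN n hn, hN _ (hi.trans hφ.le_apply)]
  have hfull : ∀ ε : ℝ≥0∞, 0 < ε →
      ∀ᶠ n in atTop, gagliardo P σ p univ (D n k - S k) ≤ 2 ^ (p - 1) * (ε + ε) + ε := by
    intro ε hε
    obtain ⟨ρ, hρ, hρt, -, hg⟩ := hnear ε hε
    obtain ⟨A, hA⟩ := hP.exists_gagliardo_le hσ hp ν k hρ hρt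
    have h3 : Tendsto (fun n => (A : ℝ≥0∞) * energy m p (D n k - S k)) atTop (𝓝 0) := by
      simpa using ENNReal.Tendsto.const_mul (hSlim k le_rfl) (Or.inr (ENNReal.coe_ne_top (r := A)))
    filter_upwards [hg, ENNReal.tendsto_nhds_zero.1 h3 ε hε] with n h4 h5
    exact (hA _ (((hD n).isMeas le_rfl).sub (hSm k le_rfl))).trans (add_le_add h4 h5)
  refine ⟨S, ⟨hu'.1, hchain, hSt, ?_⟩, hSlim, ENNReal.tendsto_nhds_zero.2 fun ε hε => ?_⟩
  -- Finite energy of the limit: near the diagonal it is compared with `D n k` for one n, far away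
  -- its Lᵖ norm suffices.
  · obtain ⟨ρ, hρ, hρt, hρδ, hg⟩ := hnear 1 one_pos
    obtain ⟨A, hA⟩ := hP.exists_gagliardo_le hσ hp ν k hρ hρt
    obtain ⟨n, hn⟩ := hg.exists
    refine (hA _ (hSm k le_rfl)).trans_lt (ENNReal.add_lt_top.2 ⟨?_,
      ENNReal.mul_lt_top ENNReal.coe_lt_top (hSt k le_rfl)⟩)
    refine (gagliardo_le_of_diffNorm_le hp (hm (((hD n).isMeas le_rfl).sub (hSm k le_rfl)) hρδ)
      (T₂ := D n k) fun q => ?_).trans_lt (ENNReal.mul_lt_top h2.lt_top (ENNReal.add_lt_top.2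
        ⟨hn.trans_lt (ENNReal.mul_lt_top h2.lt_top (by finiteness)),
        (lintegral_mono_set (subset_univ _)).trans_lt (hD n).gagliardo_lt_top⟩))
    rw [diffNorm_sub_comm]
    exact diffNorm_le_add _ _ q
  · have hb : (2 : ℝ≥0∞) ^ (p - 1) * 2 + 1 ≠ ⊤ :=
      ENNReal.add_ne_top.2 ⟨ENNReal.mul_ne_top h2 (by simp), by simp⟩
    have h3 := hfull (ε / (2 ^ (p - 1) * 2 + 1)) (ENNReal.div_pos hε.ne' hb)
    filter_upwards [h3] with n hn
    refine hn.trans (le_of_eq ?_)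
    calc (2 : ℝ≥0∞) ^ (p - 1) * (ε / (2 ^ (p - 1) * 2 + 1) + ε / (2 ^ (p - 1) * 2 + 1)) +
          ε / (2 ^ (p - 1) * 2 + 1) = (2 ^ (p - 1) * 2 + 1) * (ε / (2 ^ (p - 1) * 2 + 1)) := by ring
      _ = ε := ENNReal.mul_div_cancel (by simp) hb

end Equivalence

end FracSobolev

end

/-! ### The equivalence theorem. -/

theorem mainTheorem5 {m : ℕ} {M : Type*} [EMetricSpace M] [CompactSpace M]
    [ChartedSpace (EuclideanSpace ℝ (Fin m)) M] [IsManifold (𝓡 m) ∞ M]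
    [RiemannianBundle (fun x : M => TangentSpace (𝓡 m) x)]
    [IsContMDiffRiemannianBundle (𝓡 m) ∞ (EuclideanSpace ℝ (Fin m))
      (fun x : M => TangentSpace (𝓡 m) x)]
    [IsRiemannianManifold (𝓡 m) M] [MeasurableSpace M] [BorelSpace M]
    (P : ∀ x y : M, TangentSpace (𝓡 m) x →L[ℝ] TangentSpace (𝓡 m) y)
    (hP : FracSobolev.IsTransport P)
    {ν k : ℕ} {σ p : ℝ} (hσ : σ ∈ Set.Ioo (0 : ℝ) 1) (hp : 1 ≤ p)
    (u : ℕ → M → EuclideanSpace ℝ (Fin ν)) (hu : ∀ n, FracSobolev.MemW P k σ p (u n))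
    (u' : M → EuclideanSpace ℝ (Fin ν)) :
    List.TFAE [
      FracSobolev.TendstoW P k σ p u u',
      FracSobolev.TendstoLp m p u u' ∧
        Tendsto (fun ρ : ℝ => limsup (fun n => FracSobolev.gagliardo P σ p
          {q : M × M | edist q.1 q.2 < ENNReal.ofReal ρ} (FracSobolev.weakDeriv k (u n))) atTop)
          (𝓝[>] 0) (𝓝 0),
      FracSobolev.TendstoLp m p u u' ∧
        Tendsto (fun ρ : ℝ => ⨆ n, FracSobolev.gagliardo P σ p
          {q : M × M | edist q.1 q.2 < ENNReal.ofReal ρ} (FracSobolev.weakDeriv k (u n)))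
          (𝓝[>] 0) (𝓝 0)] := by
  have hp0 : 0 < p := by linarith
  choose D hD using fun n => (hu n).exists_chain hp
  have hg : ∀ (ρ : ℝ) n, FracSobolev.gagliardo P σ p
      {q : M × M | edist q.1 q.2 < ENNReal.ofReal ρ} (FracSobolev.weakDeriv k (u n)) =
        FracSobolev.gagliardo P σ p (FracSobolev.nearDiag M (ENNReal.ofReal ρ)) (D n k) :=
    fun ρ n => FracSobolev.gagliardo_congr ((hD n).chain.weakDeriv_ae_eq le_rfl) _
  simp only [hg]
  tfae_have 1 → 3 := by
    rintro ⟨h1, h2⟩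
    obtain ⟨S, hS⟩ := h1.exists_chain hp
    obtain ⟨h3, h4⟩ :=
      (FracSobolev.tendsto_normW_iff hp fun n => (hD n).chain.sub hS.chain).1 h2
    refine ⟨(FracSobolev.tendstoLp_iff hp).2 ⟨h1.memLp, ?_⟩, ?_⟩
    · simpa only [Pi.sub_apply, (hD _).chain.1, hS.chain.1] using h3 0 (Nat.zero_le k)
    · exact hP.tendsto_iSup_gagliardo hp (fun n => (hD n).isMeas le_rfl) (hS.isMeas le_rfl)
        (fun n => (hD n).gagliardo_lt_top) hS.gagliardo_lt_top h4
  tfae_have 3 → 2 := fun ⟨h1, h2⟩ => ⟨h1, tendsto_of_tendsto_of_tendsto_of_le_of_le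
    tendsto_const_nhds h2 (fun _ => zero_le) fun _ => limsup_le_iSup⟩
  tfae_have 2 → 1 := by
    rintro ⟨h1, h2⟩
    obtain ⟨hu', hlim⟩ := (FracSobolev.tendstoLp_iff hp).1 h1
    obtain ⟨S, hS, h3, h4⟩ := hP.exists_limit hσ.1 hp hD hu'
      (by simpa only [(hD _).chain.1] using hlim) fun ε hε δ hδ => by
        have h5 : ∀ᶠ ρ : ℝ in 𝓝[>] 0, ENNReal.ofReal ρ < δ :=
          nhdsWithin_le_nhds ((ENNReal.continuous_ofReal.tendsto 0).eventually_lt_const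
            (by rwa [ENNReal.ofReal_zero]))
        obtain ⟨ρ, ⟨h6, h7⟩, h8⟩ :=
          -- One radius is taken that is both small and has its limsup below ε; the energies
          -- themselves are then below ε for all large n.
          ((h5.and (h2.eventually_lt_const hε)).and self_mem_nhdsWithin).exists
        exact ⟨ENNReal.ofReal ρ, ENNReal.ofReal_pos.2 h8, h6.le,
          (eventually_lt_of_limsup_lt h7).mono fun _ h => h.le⟩
    exact ⟨hS.memW hp, (FracSobolev.tendsto_normW_iff hp fun n =>
      (hD n).chain.sub hS.chain).2 ⟨h3, h4⟩⟩
  tfae_finish
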